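/- Let $M^3$ be a connected smooth $3$-manifold and $x : M^3 \to \mathbb{E}^4$ a smooth immersion into Euclidean $4$-space; equip $M$ with the induced metric, and let $h$ be its second fundamental form. For $p \in M$ and an orthonormal basis $e_1,e_2,e_3$ of $T_pM$ let $\rho = \frac{1}{3}\sum_{i<j}K(e_i\wedge e_j)$ be the normalized scalar curvature ($K$ being the sectional curvature of $M$), let $\mathcal{C} = \frac13\sum_{i,j=1}^{3}\|h(e_i,e_j)\|^2$ be the Casorati curvature, and for a plane $L\subset T_pM$ with orthonormal basis $f_1,f_2$ let $\mathcal{C}(L)=\frac12\sum_{i,j=1}^{2}\|h(f_i,f_j)\|^2$. Put $$\delta_C(2) = \tfrac12\,\mathcal{C} + \tfrac23\,\inf\{\mathcal{C}(L) \mid L \text{ a plane in } T_pM\}.$$ Suppose that $M$ is Casorati ideal, i.e. that equality $\rho = \delta_C(2)$ holds in the inequality $\rho\le\delta_C(2)$ at every point of $M$, and that $M$ is not totally geodesic (i.e. $h$ does not vanish identically). Then there is a real number $a>0$ such that, up to an isometry of $\mathbb{E}^4$, $M$ is (immersed as) an open part of the rotational hypersurface $\Sigma_a$ parametrized by $$\Big(\tfrac1a\,\mathrm{sd}\big(at,\tfrac1{\sqrt2}\big)\sin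 u,\ \tfrac1a\,\mathrm{sd}\big(at,\tfrac1{\sqrt2}\big)\cos u\sin v,\ \tfrac1a\,\mathrm{sd}\big(at,\tfrac1{\sqrt2}\big)\cos u\cos v,\ \tfrac12\int_0^t \mathrm{sd}^2\big(as,\tfrac1{\sqrt2}\big)\,ds\Big),$$ $0<t<2K/a$, $u,v\in\mathbb{R}$; that is, for some isometry $T$ of $\mathbb{E}^4$ the map $T\circ x$ takes values in $\Sigma_a$ and is a local homeomorphism $M\to\Sigma_a$. Here $\mathrm{sd}(\cdot,k)=\mathrm{sn}(\cdot,k)/\mathrm{dn}(\cdot,k)$ is Jacobi's elliptic function of modulus $k$, and $K=\int_0^{\pi/2}\big(1-\tfrac12\sin^2\theta\big)^{-1/2}d\theta$ is the complete elliptic integral of the first kind of modulus $1/\sqrt2$ (so that $\mathrm{sd}(at,1/\sqrt2)$ is positive for $0<t<2K/a$ and vanishes at both ends). -/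

import Mathlib

open Set Filter Topology
open scoped ContDiff Manifold RealInnerProductSpace

noncomputable section

/-- `𝔼 n` is Euclidean `n`-space. -/
notation "𝔼" n:max => EuclideanSpace ℝ (Fin n)

namespace Casorati

/-! ### Riemannian geometry of a local parametrization

`X : 𝔼 n → 𝔼 m` is a parametrized piece of a submanifold of Euclidean space; `y` is a point of its
parameter domain, and tangent vectors at `y` are written in coordinates, as elements of `𝔼 n`. -/

section Local

variable {n m : ℕ}

/-- The `i`-th coordinate vector of the parameter space. -/
def coordVec (i : Fin n) : 𝔼 n := EuclideanSpace.single i 1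

/-- The partial derivative `∂_i f`. -/
def pderiv (i : Fin n) (f : 𝔼 n → ℝ) (y : 𝔼 n) : ℝ := fderiv ℝ f y (coordVec i)

/-- The induced metric (first fundamental form) `g_y(v, w) = ⟨dX v, dX w⟩`. -/
def metric (X : 𝔼 n → 𝔼 m) (y v w : 𝔼 n) : ℝ := ⟪fderiv ℝ X y v, fderiv ℝ X y w⟫

/-- The matrix `(g_ij)` of the induced metric. -/
def gram (X : 𝔼 n → 𝔼 m) (y : 𝔼 n) : Matrix (Fin n) (Fin n) ℝ :=
  Matrix.of fun i j => metric X y (coordVec i) (coordVec j)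

/-- The Christoffel symbol `Γ^k_{ij}` of the Levi-Civita connection of the induced metric. -/
def christoffel (X : 𝔼 n → 𝔼 m) (k i j : Fin n) (y : 𝔼 n) : ℝ :=
  (1 / 2) * ∑ l, (gram X y)⁻¹ k l *
    (pderiv i (fun z => gram X z j l) y + pderiv j (fun z => gram X z i l) y
      - pderiv l (fun z => gram X z i j) y)

/-- The components of the Riemann tensor of the induced metric:
`R(∂_i, ∂_j) ∂_k = ∑ l, (riemann X l k i j) ∂_l`, where
`R(U, V) W = ∇_U ∇_V W - ∇_V ∇_U W - ∇_[U,V] W`. -/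
def riemann (X : 𝔼 n → 𝔼 m) (l k i j : Fin n) (y : 𝔼 n) : ℝ :=
  pderiv i (christoffel X l j k) y - pderiv j (christoffel X l i k) y
    + ∑ p, (christoffel X l i p y * christoffel X p j k y
      - christoffel X l j p y * christoffel X p i k y)

/-- The curvature `g(R(u, v) w, z)` of the induced metric. -/
def curvature (X : 𝔼 n → 𝔼 m) (y u v w z : 𝔼 n) : ℝ :=
  ∑ i, ∑ j, ∑ k, ∑ l, ∑ q, u i * v j * w k * z q * riemann X l k i j y * gram X y l q

/-- The sectional curvature `K(u ∧ v)` of the induced metric. -/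
def sectionalCurvature (X : 𝔼 n → 𝔼 m) (y u v : 𝔼 n) : ℝ :=
  curvature X y u v v u / (metric X y u u * metric X y v v - metric X y u v ^ 2)

/-- The second fundamental form `h(v, w)`: the component of `∂_v ∂_w X` normal to the tangent space
`dX (𝔼 n)`. -/
def secondFF (X : 𝔼 n → 𝔼 m) (y v w : 𝔼 n) : 𝔼 m :=
  ((fderiv ℝ X y).range)ᗮ.starProjection (fderiv ℝ (fun z => fderiv ℝ X z w) y v)

/-- `e` is a family of tangent vectors at `y` that is orthonormal for the induced metric. -/
def IsOrthonormalFamily (X : 𝔼 n → 𝔼 m) (y : 𝔼 n) {l : ℕ} (e : Fin l → 𝔼 n) : Prop :=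
  Orthonormal ℝ fun i => fderiv ℝ X y (e i)

/-- The normalized scalar curvature `ρ = (2 / (n (n - 1))) ∑_{i < j} K(e_i ∧ e_j)`, computed in the
orthonormal frame `e`. -/
def normalizedScalarCurvature (X : 𝔼 n → 𝔼 m) (y : 𝔼 n) (e : Fin n → 𝔼 n) : ℝ :=
  2 / ((n : ℝ) * ((n : ℝ) - 1)) *
    ∑ i, ∑ j ∈ Finset.univ.filter (fun j => i < j), sectionalCurvature X y (e i) (e j)

/-- The Casorati curvature `C(L) = (1 / l) ∑_{i, j} ‖h(e_i, e_j)‖ ^ 2` of the `l`-dimensional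
tangent subspace `L` with orthonormal basis `e`; for `l = n` it is the Casorati curvature `C`. -/
def casorati (X : 𝔼 n → 𝔼 m) (y : 𝔼 n) {l : ℕ} (e : Fin l → 𝔼 n) : ℝ :=
  1 / (l : ℝ) * ∑ i, ∑ j, ‖secondFF X y (e i) (e j)‖ ^ 2

/-- The normalized `δ`-Casorati curvature
`δ_C(n - 1) = C / 2 + ((n + 1) / (2 n)) inf {C(L) | L a hyperplane of the tangent space}`,
with `C` computed in the orthonormal frame `e`. Hyperplanes `L` of the tangent space are given by
their orthonormal bases `f`. -/
def deltaCasorati (X : 𝔼 n → 𝔼 m) (y : 𝔼 n) (e : Fin n → 𝔼 n) : ℝ :=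
  1 / 2 * casorati X y e + ((n : ℝ) + 1) / (2 * (n : ℝ)) *
    sInf {c | ∃ f : Fin (n - 1) → 𝔼 n, IsOrthonormalFamily X y f ∧ c = casorati X y f}

end Local

/-! ### Submanifolds of Euclidean space -/

section Submanifold

variable {n m : ℕ} {M : Type*} [TopologicalSpace M] [ChartedSpace (𝔼 n) M]

/-- `x : M → 𝔼 m` is a smooth immersion. -/
def IsSmoothImmersion (x : M → 𝔼 m) : Prop :=
  ContMDiff 𝓘(ℝ, 𝔼 n) 𝓘(ℝ, 𝔼 m) ∞ x ∧
    ∀ p : M, Function.Injective (mfderiv 𝓘(ℝ, 𝔼 n) 𝓘(ℝ, 𝔼 m) x p)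

/-- Equality `ρ = δ_C(n - 1) + c` holds at every point of the immersed submanifold, where `c = 0` is
the curvature of Euclidean space. Both sides depend neither on the chart nor on the orthonormal
frame in which they are computed. -/
def IsCasoratiIdeal (x : M → 𝔼 m) : Prop :=
  ∀ φ ∈ atlas (𝔼 n) M, ∀ p ∈ φ.source, ∀ e : Fin n → 𝔼 n,
    IsOrthonormalFamily (x ∘ φ.symm) (φ p) e →
      normalizedScalarCurvature (x ∘ φ.symm) (φ p) e = deltaCasorati (x ∘ φ.symm) (φ p) e

/-- The second fundamental form vanishes identically. -/
def IsTotallyGeodesic (x : M → 𝔼 m) : Prop :=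
  ∀ φ ∈ atlas (𝔼 n) M, ∀ p ∈ φ.source, ∀ v w : 𝔼 n, secondFF (x ∘ φ.symm) (φ p) v w = 0

end Submanifold

/-! ### Jacobi's elliptic functions with modulus `k` -/

/-- The incomplete elliptic integral of the first kind `F(θ, k)`. -/
def ellipticF (k θ : ℝ) : ℝ := ∫ s in (0 : ℝ)..θ, 1 / √(1 - k ^ 2 * Real.sin s ^ 2)

/-- The complete elliptic integral of the first kind `K(k) = F(π / 2, k)`. -/
def ellipticK (k : ℝ) : ℝ := ellipticF k (Real.pi / 2)

/-- For `|k| < 1` the function `F(·, k)` is a bijection of the real line, so its inverse exists. -/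
theorem ellipticF_bijective {k : ℝ} (hk : |k| < 1) : Function.Bijective (ellipticF k) := by
  have hk2 : k ^ 2 < 1 := (sq_lt_one_iff_abs_lt_one k).2 hk
  have hpos : ∀ s : ℝ, 0 < 1 - k ^ 2 * Real.sin s ^ 2 := fun s => by
    nlinarith [Real.sin_sq_le_one s, sq_nonneg (Real.sin s), sq_nonneg k]
  have hcont : Continuous fun s : ℝ => 1 / √(1 - k ^ 2 * Real.sin s ^ 2) :=
    continuous_const.div (by fun_prop) fun s => (Real.sqrt_pos.2 (hpos s)).ne'
  have hge : ∀ s : ℝ, 1 ≤ 1 / √(1 - k ^ 2 * Real.sin s ^ 2) := fun s => by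
    rw [le_div_iff₀ (Real.sqrt_pos.2 (hpos s)), one_mul, Real.sqrt_le_iff]
    constructor <;> nlinarith [mul_nonneg (sq_nonneg k) (sq_nonneg (Real.sin s))]
  have hgrow : ∀ a b : ℝ, a ≤ b → b - a ≤ ellipticF k b - ellipticF k a := fun a b hab => by
    unfold ellipticF
    rw [intervalIntegral.integral_interval_sub_left (hcont.intervalIntegrable _ _)
      (hcont.intervalIntegrable _ _)]
    calc b - a = ∫ _ in a..b, (1 : ℝ) := by simp
      _ ≤ _ := intervalIntegral.integral_mono_on hab (by simp) (hcont.intervalIntegrable _ _)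
        fun s _ => hge s
  have h0 : ellipticF k 0 = 0 := by simp [ellipticF]
  have hmono : StrictMono (ellipticF k) := fun a b hab => by linarith [hgrow a b hab.le]
  have hFc : Continuous (ellipticF k) :=
    intervalIntegral.continuous_primitive (fun a b => hcont.intervalIntegrable a b) 0
  refine ⟨hmono.injective, hFc.surjective ?_ ?_⟩
  · refine tendsto_atTop_mono' _ ?_ tendsto_id
    filter_upwards [eventually_ge_atTop 0] with s hs
    simpa [h0] using hgrow 0 s hs
  · refine tendsto_atBot_mono' _ ?_ tendsto_id
    filter_upwards [eventually_le_atBot 0] with s hs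
    have := hgrow s 0 hs
    simp only [h0, id] at *
    linarith

/-- Jacobi's amplitude `am(·, k)`, the inverse of `F(·, k)`. -/
def jacobiAm (k : ℝ) : ℝ → ℝ := Function.invFun (ellipticF k)

def jacobiSn (u k : ℝ) : ℝ := Real.sin (jacobiAm k u)

def jacobiDn (u k : ℝ) : ℝ := √(1 - k ^ 2 * jacobiSn u k ^ 2)

def jacobiSd (u k : ℝ) : ℝ := jacobiSn u k / jacobiDn u k

/-! ### The model hypersurface -/

/-- The parametrization of the rotational hypersurface with parameter `a`. -/
def rotParam (a t u v : ℝ) : 𝔼 4 :=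
  !₂[1 / a * jacobiSd (a * t) (1 / √2) * Real.sin u,
     1 / a * jacobiSd (a * t) (1 / √2) * Real.cos u * Real.sin v,
     1 / a * jacobiSd (a * t) (1 / √2) * Real.cos u * Real.cos v,
     1 / 2 * ∫ s in (0 : ℝ)..t, jacobiSd (a * s) (1 / √2) ^ 2]

/-- The rotational hypersurface with parameter `a`. The interval `0 < t < 2 K / a` lies between two
consecutive zeros of `sd(a t, 1 / √2)`, where the profile curve meets the axis. -/
def rotHypersurface (a : ℝ) : Set (𝔼 4) :=
  {q | ∃ t u v : ℝ, 0 < t ∧ t < 2 * ellipticK (1 / √2) / a ∧ q = rotParam a t u v}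

end Casorati

end

noncomputable section

namespace Casorati

/-! ### Jacobi's elliptic functions of modulus `1 / √2` -/

/-! For an orthonormal frame whose first two vectors span a plane minimizing the Casorati curvature,
the Gauss equation writes `3 (δ_C(2) - ρ)` as a sum of squares in the entries of `h`
(`quadratic_equality`). Equality therefore forces principal curvatures `l, l, 2l`.

Where `l ≠ 0`, choose the normal `n` with `l > 0`, let `ξ` be a unit principal direction for `2l`,
`θ` its dual one-form and `m` the derivative of `l` along `ξ`. The Codazzi equation, here the
symmetry of the second derivatives of `n`, gives `dl = m θ` and `dξ = (m/l)(dx - θ ξ) + 2l θ n`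
(`codazzi_linear_algebra`). Then `l² ξ + m n` has differential `(2l³ + dm(ξ)) θ n`, and the symmetry
of its second derivatives forces `dm(ξ) = -2l³` (`mu_mu`). So `l² ξ + m n` is locally constant, and
so is `m² + l⁴`, written `a⁴/4`.

The unit vector `E = (2/a²)(l² ξ + m n)` is the direction of the axis. The point lies at distance
`2l/a²` from the axis, in the direction `(2/a²)(m ξ - l² n)`. With `σ = 2m/a²` the conservation law
reads `σ² + (2l/a)⁴/4 = 1`, which is the first integral `sd'² + sd⁴/4 = 1` for modulus `1/√2`. This
identifies `2l/a` with `sd`, `σ` with `sd'`, and the height along the axis with a function of `σ`.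
After subtraction of the radial and axial parts, a constant point `C` of the axis remains
(`hasFDerivAt_center`).

To globalize, consider the set of points where some frame has given invariants `a, E, C`. It is open
because the invariants are locally constant. It is closed (`isClosed_matchSet`) because near a limit
point with `h ≠ 0` frames agree up to the sign of `(ξ, m)`, while a limit point with `h = 0` is
impossible: `m²` is at most `l` times a locally bounded quantity (`mu_sq_le`), so `m² + l⁴` would
tend to `0` instead of `a⁴/4`. Connectedness gives all of `M`.

Finally, the model is homeomorphic to an open spherical shell in `𝔼 3` by a map that is smooth on
the ambient space near it, so the inverse function theorem turns the immersion into a local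
homeomorphism onto the model. -/

theorem abs_one_div_sqrt_two_lt_one : |1 / √2| < 1 := by
  rw [abs_of_pos (by positivity), div_lt_one (by positivity)]
  exact Real.lt_sqrt_of_sq_lt (by norm_num)

theorem one_div_sqrt_two_sq : (1 / √2) ^ 2 = 1 / 2 := by
  rw [div_pow, Real.sq_sqrt (by norm_num)]; norm_num

theorem one_sub_sq_mul_sin_sq_pos {k : ℝ} (hk : |k| < 1) (s : ℝ) :
    0 < 1 - k ^ 2 * Real.sin s ^ 2 := by
  have hk2 : k ^ 2 < 1 := (sq_lt_one_iff_abs_lt_one k).2 hk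
  nlinarith [Real.sin_sq_le_one s, sq_nonneg (Real.sin s), sq_nonneg k]

theorem continuous_ellipticF_integrand {k : ℝ} (hk : |k| < 1) :
    Continuous fun s : ℝ => 1 / √(1 - k ^ 2 * Real.sin s ^ 2) :=
  continuous_const.div (by fun_prop) fun s =>
    (Real.sqrt_pos.2 (one_sub_sq_mul_sin_sq_pos hk s)).ne'

theorem hasStrictDerivAt_ellipticF {k : ℝ} (hk : |k| < 1) (θ : ℝ) :
    HasStrictDerivAt (ellipticF k) (1 / √(1 - k ^ 2 * Real.sin θ ^ 2)) θ :=
  (continuous_ellipticF_integrand hk).integral_hasStrictDerivAt 0 θ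

theorem strictMono_ellipticF {k : ℝ} (hk : |k| < 1) : StrictMono (ellipticF k) :=
  strictMono_of_deriv_pos fun θ => by
    rw [(hasStrictDerivAt_ellipticF hk θ).hasDerivAt.deriv]
    exact one_div_pos.2 (Real.sqrt_pos.2 (one_sub_sq_mul_sin_sq_pos hk θ))

theorem jacobiAm_ellipticF {k : ℝ} (hk : |k| < 1) (θ : ℝ) : jacobiAm k (ellipticF k θ) = θ :=
  Function.leftInverse_invFun (ellipticF_bijective hk).1 θ

theorem ellipticF_jacobiAm {k : ℝ} (hk : |k| < 1) (u : ℝ) : ellipticF k (jacobiAm k u) = u :=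
  Function.rightInverse_invFun (ellipticF_bijective hk).2 u

theorem strictMono_jacobiAm {k : ℝ} (hk : |k| < 1) : StrictMono (jacobiAm k) := fun u v h => by
  rw [← (strictMono_ellipticF hk).lt_iff_lt, ellipticF_jacobiAm hk, ellipticF_jacobiAm hk]
  exact h

theorem ellipticF_zero (k : ℝ) : ellipticF k 0 = 0 := by simp [ellipticF]

theorem jacobiAm_zero {k : ℝ} (hk : |k| < 1) : jacobiAm k 0 = 0 := by
  have := jacobiAm_ellipticF hk 0
  rwa [ellipticF_zero] at this

/-- The integrand is symmetric about `π / 2`, so the two halves of `[0, π]` contribute equally. -/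
theorem ellipticF_pi {k : ℝ} (hk : |k| < 1) : ellipticF k Real.pi = 2 * ellipticK k := by
  have hc := continuous_ellipticF_integrand hk
  have h1 : (∫ s in (Real.pi / 2)..Real.pi, 1 / √(1 - k ^ 2 * Real.sin s ^ 2))
      = ∫ s in (0 : ℝ)..(Real.pi / 2), 1 / √(1 - k ^ 2 * Real.sin s ^ 2) := by
    have := intervalIntegral.integral_comp_sub_left (a := Real.pi / 2) (b := Real.pi)
      (fun s => 1 / √(1 - k ^ 2 * Real.sin s ^ 2)) Real.pi
    simp only [Real.sin_pi_sub, sub_self] at this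
    rw [this]; congr 1; ring
  unfold ellipticK ellipticF
  rw [← intervalIntegral.integral_add_adjacent_intervals (b := Real.pi / 2)
    (hc.intervalIntegrable _ _) (hc.intervalIntegrable _ _), h1]
  ring

theorem jacobiAm_two_mul_ellipticK {k : ℝ} (hk : |k| < 1) :
    jacobiAm k (2 * ellipticK k) = Real.pi := by
  rw [← ellipticF_pi hk, jacobiAm_ellipticF hk]

theorem ellipticK_pos {k : ℝ} (hk : |k| < 1) : 0 < ellipticK k := by
  have := strictMono_ellipticF hk Real.pi_pos
  rw [ellipticF_zero, ellipticF_pi hk] at this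
  linarith

theorem jacobiDn_pos {k : ℝ} (hk : |k| < 1) (u : ℝ) : 0 < jacobiDn u k :=
  Real.sqrt_pos.2 (one_sub_sq_mul_sin_sq_pos hk _)

theorem jacobiDn_sq {k : ℝ} (hk : |k| < 1) (u : ℝ) :
    jacobiDn u k ^ 2 = 1 - k ^ 2 * jacobiSn u k ^ 2 :=
  Real.sq_sqrt (one_sub_sq_mul_sin_sq_pos hk _).le

theorem hasStrictDerivAt_jacobiAm {k : ℝ} (hk : |k| < 1) (u : ℝ) :
    HasStrictDerivAt (jacobiAm k) (jacobiDn u k) u := by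
  have h := (hasStrictDerivAt_ellipticF hk (jacobiAm k u)).to_local_left_inverse
    (one_div_pos.2 (Real.sqrt_pos.2 (one_sub_sq_mul_sin_sq_pos hk _))).ne'
    (Eventually.of_forall (jacobiAm_ellipticF hk))
  rw [ellipticF_jacobiAm hk] at h
  simpa [jacobiDn, jacobiSn] using h

theorem hasStrictDerivAt_jacobiSn {k : ℝ} (hk : |k| < 1) (u : ℝ) :
    HasStrictDerivAt (fun u => jacobiSn u k) (Real.cos (jacobiAm k u) * jacobiDn u k) u :=
  (hasStrictDerivAt_jacobiAm hk u).sin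

theorem hasStrictDerivAt_jacobiDn {k : ℝ} (hk : |k| < 1) (u : ℝ) :
    HasStrictDerivAt (fun u => jacobiDn u k)
      (-(k ^ 2 * jacobiSn u k * Real.cos (jacobiAm k u))) u := by
  have h := ((((hasStrictDerivAt_jacobiSn hk u).pow 2).const_mul (k ^ 2)).const_sub 1).sqrt
    (one_sub_sq_mul_sin_sq_pos hk _).ne'
  refine h.congr_deriv ?_
  change -(k ^ 2 * (((2 : ℕ) : ℝ) * jacobiSn u k ^ (2 - 1) * (_ * jacobiDn u k))) /
    (2 * jacobiDn u k) = _
  have := (jacobiDn_pos hk u).ne'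
  simp only [Nat.add_one_sub_one, pow_one]
  field_simp
  push_cast
  ring

/-- The derivative `cn / dn ^ 2` of `sd`. -/
def jacobiSdDeriv (u k : ℝ) : ℝ := Real.cos (jacobiAm k u) / jacobiDn u k ^ 2

theorem hasStrictDerivAt_jacobiSd {k : ℝ} (hk : |k| < 1) (u : ℝ) :
    HasStrictDerivAt (fun u => jacobiSd u k) (jacobiSdDeriv u k) u := by
  have hd := (jacobiDn_pos hk u).ne'
  refine ((hasStrictDerivAt_jacobiSn hk u).div (hasStrictDerivAt_jacobiDn hk u) hd).congr_deriv ?_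
  have h2 := jacobiDn_sq hk u
  simp only [jacobiSdDeriv]
  field_simp
  linear_combination Real.cos (jacobiAm k u) * h2

/-- For `k² = 1/2` the linear term in the differential equation of `sd` drops out and `sd'' =
-sd³/2` remains. This is the equation that the double principal curvature satisfies, after scaling,
along the principal direction. -/
theorem hasStrictDerivAt_jacobiSdDeriv (u : ℝ) :
    HasStrictDerivAt (fun u => jacobiSdDeriv u (1 / √2)) (-(jacobiSd u (1 / √2) ^ 3 / 2)) u := by
  have hk := abs_one_div_sqrt_two_lt_one
  have hd := (jacobiDn_pos hk u).ne'
  refine ((hasStrictDerivAt_jacobiAm hk u).cos.div ((hasStrictDerivAt_jacobiDn hk u).pow 2)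
    (pow_ne_zero 2 hd)).congr_deriv ?_
  have h2 := jacobiDn_sq hk u
  rw [one_div_sqrt_two_sq] at h2 ⊢
  have h3 : Real.cos (jacobiAm (1 / √2) u) ^ 2 = 1 - jacobiSn u (1 / √2) ^ 2 := by
    rw [Real.cos_sq']; rfl
  change (-jacobiSn u (1 / √2) * _ * jacobiDn u (1 / √2) ^ 2 - _ * (((2 : ℕ) : ℝ) *
    jacobiDn u (1 / √2) ^ (2 - 1) * _)) / (jacobiDn u (1 / √2) ^ 2) ^ 2 = _
  simp only [jacobiSd, Nat.add_one_sub_one, pow_one]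
  generalize jacobiDn u (1 / √2) = d at *
  generalize jacobiSn u (1 / √2) = s at *
  generalize Real.cos (jacobiAm (1 / √2) u) = c at *
  field_simp
  push_cast
  linear_combination (2 * s) * (h3 - h2)

/-- The energy integral of `sd'' = -sd³/2`. It also says that the profile curve, whose velocity has
components `sd'` and `sd²/2`, has unit speed. -/
theorem jacobiSdDeriv_sq_add (u : ℝ) :
    jacobiSdDeriv u (1 / √2) ^ 2 + jacobiSd u (1 / √2) ^ 4 / 4 = 1 := by
  have hk := abs_one_div_sqrt_two_lt_one
  have hd := (jacobiDn_pos hk u).ne'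
  have h2 := jacobiDn_sq hk u
  rw [one_div_sqrt_two_sq] at h2
  have h3 : Real.cos (jacobiAm (1 / √2) u) ^ 2 = 1 - jacobiSn u (1 / √2) ^ 2 := by
    rw [Real.cos_sq']; rfl
  simp only [jacobiSd, jacobiSdDeriv]
  field_simp
  linear_combination 4 * h3 - 4 * (jacobiDn u (1 / √2) ^ 2 + 1 - 1 / 2 * jacobiSn u (1 / √2) ^ 2) * h2

theorem jacobiSd_pos {k u : ℝ} (hk : |k| < 1) (h0 : 0 < u) (h1 : u < 2 * ellipticK k) :
    0 < jacobiSd u k := by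
  refine div_pos (Real.sin_pos_of_pos_of_lt_pi ?_ ?_) (jacobiDn_pos hk u)
  · simpa [jacobiAm_zero hk] using strictMono_jacobiAm hk h0
  · simpa [jacobiAm_two_mul_ellipticK hk] using strictMono_jacobiAm hk h1

theorem jacobiSdDeriv_zero : jacobiSdDeriv 0 (1 / √2) = 1 := by
  simp only [jacobiSdDeriv, jacobiDn, jacobiSn, jacobiAm_zero abs_one_div_sqrt_two_lt_one]
  simp

theorem jacobiSdDeriv_two_mul_ellipticK :
    jacobiSdDeriv (2 * ellipticK (1 / √2)) (1 / √2) = -1 := by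
  simp only [jacobiSdDeriv, jacobiDn, jacobiSn,
    jacobiAm_two_mul_ellipticK abs_one_div_sqrt_two_lt_one]
  simp

/-- The domain `(0, 2 K)` of the scaled arc length parameter of the profile curve. -/
abbrev profileDomain : Set ℝ := Ioo 0 (2 * ellipticK (1 / √2))

theorem strictAntiOn_jacobiSdDeriv :
    StrictAntiOn (fun u => jacobiSdDeriv u (1 / √2)) profileDomain := by
  refine strictAntiOn_of_deriv_neg (convex_Ioo _ _)
    (fun u _ => (hasStrictDerivAt_jacobiSdDeriv u).hasDerivAt.continuousAt.continuousWithinAt) ?_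
  intro u hu
  rw [interior_Ioo] at hu
  rw [(hasStrictDerivAt_jacobiSdDeriv u).hasDerivAt.deriv]
  have := jacobiSd_pos abs_one_div_sqrt_two_lt_one hu.1 hu.2
  have := pow_pos this 3
  linarith

/-- The inverse of `sd'` on `(0, 2 K)`. -/
def jacobiSdDerivInv : ℝ → ℝ :=
  Function.invFunOn (fun u => jacobiSdDeriv u (1 / √2)) profileDomain

theorem exists_jacobiSdDeriv_eq {σ : ℝ} (hσ : σ ∈ Ioo (-1 : ℝ) 1) :
    ∃ u ∈ profileDomain, jacobiSdDeriv u (1 / √2) = σ := by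
  have h := intermediate_value_Ioo' (f := fun u => jacobiSdDeriv u (1 / √2)) (a := 0)
    (b := 2 * ellipticK (1 / √2)) (by linarith [ellipticK_pos abs_one_div_sqrt_two_lt_one])
    (fun u _ => (hasStrictDerivAt_jacobiSdDeriv u).hasDerivAt.continuousAt.continuousWithinAt)
  simp only [jacobiSdDeriv_zero, jacobiSdDeriv_two_mul_ellipticK] at h
  exact h hσ

theorem jacobiSdDerivInv_mem {σ : ℝ} (hσ : σ ∈ Ioo (-1 : ℝ) 1) :
    jacobiSdDerivInv σ ∈ profileDomain :=
  Function.invFunOn_mem (exists_jacobiSdDeriv_eq hσ)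

theorem jacobiSdDeriv_jacobiSdDerivInv {σ : ℝ} (hσ : σ ∈ Ioo (-1 : ℝ) 1) :
    jacobiSdDeriv (jacobiSdDerivInv σ) (1 / √2) = σ :=
  Function.invFunOn_eq (f := fun u => jacobiSdDeriv u (1 / √2)) (exists_jacobiSdDeriv_eq hσ)

theorem hasStrictDerivAt_invFunOn {f : ℝ → ℝ} {s : Set ℝ} {t f' : ℝ} (hs : s ∈ 𝓝 t)
    (hf : HasStrictDerivAt f f' t) (hf' : f' ≠ 0) (hinj : InjOn f s) :
    HasStrictDerivAt (Function.invFunOn f s) f'⁻¹ (f t) := by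
  refine hf.to_local_left_inverse hf' ?_
  filter_upwards [hs] with y hy
  exact hinj.leftInvOn_invFunOn hy

theorem hasStrictDerivAt_jacobiSdDerivInv {σ : ℝ} (hσ : σ ∈ Ioo (-1 : ℝ) 1) :
    HasStrictDerivAt jacobiSdDerivInv
      (-(jacobiSd (jacobiSdDerivInv σ) (1 / √2) ^ 3 / 2))⁻¹ σ := by
  have hu := jacobiSdDerivInv_mem hσ
  have hpos := pow_pos (jacobiSd_pos abs_one_div_sqrt_two_lt_one hu.1 hu.2) 3
  have h := hasStrictDerivAt_invFunOn (Ioo_mem_nhds hu.1 hu.2)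
    (hasStrictDerivAt_jacobiSdDeriv (jacobiSdDerivInv σ)) (by linarith)
    strictAntiOn_jacobiSdDeriv.injOn
  rwa [jacobiSdDeriv_jacobiSdDerivInv hσ] at h

/-- The radius `sd(a t) / a` of the profile curve. -/
def profileRadius (a t : ℝ) : ℝ := 1 / a * jacobiSd (a * t) (1 / √2)

/-- The height of the profile curve. -/
def profileHeight (a t : ℝ) : ℝ := 1 / 2 * ∫ s in (0 : ℝ)..t, jacobiSd (a * s) (1 / √2) ^ 2

theorem hasStrictDerivAt_profileRadius {a : ℝ} (ha : 0 < a) (t : ℝ) :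
    HasStrictDerivAt (profileRadius a) (jacobiSdDeriv (a * t) (1 / √2)) t := by
  have h := ((hasStrictDerivAt_jacobiSd abs_one_div_sqrt_two_lt_one (a * t)).comp t
    ((hasStrictDerivAt_id t).const_mul a)).const_mul (1 / a)
  refine h.congr_deriv ?_
  field_simp

theorem continuous_jacobiSd {k : ℝ} (hk : |k| < 1) : Continuous fun u => jacobiSd u k :=
  continuous_iff_continuousAt.2 fun u => (hasStrictDerivAt_jacobiSd hk u).hasDerivAt.continuousAt

theorem hasStrictDerivAt_profileHeight (a t : ℝ) :
    HasStrictDerivAt (profileHeight a) (1 / 2 * jacobiSd (a * t) (1 / √2) ^ 2) t := by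
  have hc : Continuous fun s => jacobiSd (a * s) (1 / √2) ^ 2 :=
    ((continuous_jacobiSd abs_one_div_sqrt_two_lt_one).comp (continuous_const_mul a)).pow 2
  exact (hc.integral_hasStrictDerivAt 0 t).const_mul (1 / 2)

/-- The height of the profile curve as a function of the derivative of its radius. -/
def heightOfSlope (a σ : ℝ) : ℝ := profileHeight a (jacobiSdDerivInv σ / a)

/-- Comparing the hypothesis with the first integral of `sd` gives `sd = 2l/a`, both sides being
positive. By the chain rule the derivative is `z' = sd²/2` times `1/a` times the inverse of `sd'' =
-sd³/2`, that is `-1/(a sd)`. -/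
theorem hasDerivAt_heightOfSlope {a σ l : ℝ} (ha : 0 < a) (hl : 0 < l) (hσ : σ ∈ Ioo (-1 : ℝ) 1)
    (h : σ ^ 2 + 4 * l ^ 4 / a ^ 4 = 1) :
    jacobiSd (jacobiSdDerivInv σ) (1 / √2) = 2 * l / a ∧
      HasDerivAt (heightOfSlope a) (-(1 / (2 * l))) σ := by
  have hu := jacobiSdDerivInv_mem hσ
  have hpos := jacobiSd_pos abs_one_div_sqrt_two_lt_one hu.1 hu.2
  have hS := jacobiSdDeriv_sq_add (jacobiSdDerivInv σ)
  rw [jacobiSdDeriv_jacobiSdDerivInv hσ] at hS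
  have hsd : jacobiSd (jacobiSdDerivInv σ) (1 / √2) = 2 * l / a := by
    refine (pow_left_inj₀ hpos.le (by positivity) (n := 4) (by norm_num)).1 ?_
    rw [div_pow, mul_pow]
    have : 4 * l ^ 4 / a ^ 4 * 4 = 2 ^ 4 * l ^ 4 / a ^ 4 := by ring
    linarith
  refine ⟨hsd, ?_⟩
  have h1 := (hasStrictDerivAt_profileHeight a (jacobiSdDerivInv σ / a)).hasDerivAt.comp σ
    ((hasStrictDerivAt_jacobiSdDerivInv hσ).hasDerivAt.div_const a)
  refine h1.congr_deriv ?_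
  rw [mul_div_cancel₀ _ ha.ne', hsd]
  field_simp

/-! ### The model hypersurface -/

theorem profileRadius_pos {a t : ℝ} (ha : 0 < a) (h0 : 0 < t)
    (h1 : t < 2 * ellipticK (1 / √2) / a) : 0 < profileRadius a t :=
  mul_pos (one_div_pos.2 ha) (jacobiSd_pos abs_one_div_sqrt_two_lt_one (mul_pos ha h0)
    (by rwa [lt_div_iff₀' ha] at h1))

theorem mem_rotHypersurface {a t : ℝ} (ha : 0 < a) (h0 : 0 < t)
    (h1 : t < 2 * ellipticK (1 / √2) / a) {q : 𝔼 4}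
    (hr : q 0 ^ 2 + q 1 ^ 2 + q 2 ^ 2 = profileRadius a t ^ 2) (hh : q 3 = profileHeight a t) :
    q ∈ rotHypersurface a := by
  have hpos := profileRadius_pos ha h0 h1
  have hsin : Real.sin (Real.arcsin (q 0 / profileRadius a t)) = q 0 / profileRadius a t := by
    have h2 : (q 0 / profileRadius a t) ^ 2 ≤ 1 := by
      rw [div_pow, div_le_one (by positivity)]; nlinarith [sq_nonneg (q 1), sq_nonneg (q 2)]
    have h3 := (sq_le_one_iff_abs_le_one _).1 h2
    exact Real.sin_arcsin (abs_le.1 h3).1 (abs_le.1 h3).2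
  have hcos : profileRadius a t * Real.cos (Real.arcsin (q 0 / profileRadius a t))
      = ‖(⟨q 2, q 1⟩ : ℂ)‖ := by
    rw [Complex.norm_eq_sqrt_sq_add_sq]
    symm
    rw [Real.sqrt_eq_iff_mul_self_eq (by positivity)
      (mul_nonneg hpos.le (Real.cos_arcsin_nonneg _)), mul_mul_mul_comm, ← sq (Real.cos _),
      Real.cos_sq', hsin]
    field_simp
    linear_combination hr
  -- The latitude comes from the first coordinate. Since `arcsin` takes values where `cos ≥ 0`, the
  -- horizontal remainder has length exactly `r cos u`, and the longitude is its argument.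
  refine ⟨t, Real.arcsin (q 0 / profileRadius a t), Complex.arg ⟨q 2, q 1⟩, h0, h1, ?_⟩
  ext i
  fin_cases i
  · change q 0 = profileRadius a t * _
    rw [hsin, mul_div_cancel₀ _ hpos.ne']
  · change q 1 = profileRadius a t * _ * _
    rw [hcos, Complex.norm_mul_sin_arg]
  · change q 2 = profileRadius a t * _ * _
    rw [hcos, Complex.norm_mul_cos_arg]
  · exact hh

theorem exists_of_mem_rotHypersurface {a : ℝ} {q : 𝔼 4} (hq : q ∈ rotHypersurface a) :
    ∃ t, 0 < t ∧ t < 2 * ellipticK (1 / √2) / a ∧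
      q 0 ^ 2 + q 1 ^ 2 + q 2 ^ 2 = profileRadius a t ^ 2 ∧ q 3 = profileHeight a t := by
  obtain ⟨t, u, v, h0, h1, rfl⟩ := hq
  refine ⟨t, h0, h1, ?_, rfl⟩
  change (profileRadius a t * _) ^ 2 + (profileRadius a t * _ * _) ^ 2
    + (profileRadius a t * _ * _) ^ 2 = _
  linear_combination (profileRadius a t ^ 2) * Real.sin_sq_add_cos_sq u
    + (profileRadius a t ^ 2 * Real.cos u ^ 2) * Real.sin_sq_add_cos_sq v

/-! ### The model as a hypersurface of revolution over its height, and its homeomorphism with a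
shell -/

theorem strictMonoOn_profileHeight {a : ℝ} (ha : 0 < a) :
    StrictMonoOn (profileHeight a) (Icc 0 (2 * ellipticK (1 / √2) / a)) := by
  refine strictMonoOn_of_deriv_pos (convex_Icc _ _)
    (fun u _ => (hasStrictDerivAt_profileHeight a u).hasDerivAt.continuousAt.continuousWithinAt) ?_
  intro u hu
  rw [interior_Icc] at hu
  rw [(hasStrictDerivAt_profileHeight a u).hasDerivAt.deriv]
  have := jacobiSd_pos abs_one_div_sqrt_two_lt_one (mul_pos ha hu.1)
    (by have := hu.2; rwa [lt_div_iff₀' ha] at this)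
  positivity

theorem profileHeight_zero (a : ℝ) : profileHeight a 0 = 0 := by simp [profileHeight]

/-- The height interval of the model hypersurface. -/
def heightRange (a : ℝ) : Set ℝ := Ioo 0 (profileHeight a (2 * ellipticK (1 / √2) / a))

/-- The radius of the profile curve as a function of its height. -/
def radiusOfHeight (a z : ℝ) : ℝ :=
  profileRadius a (Function.invFunOn (profileHeight a) (Ioo 0 (2 * ellipticK (1 / √2) / a)) z)

theorem radiusOfHeight_profileHeight {a t : ℝ} (ha : 0 < a) (h0 : 0 < t)
    (h1 : t < 2 * ellipticK (1 / √2) / a) :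
    radiusOfHeight a (profileHeight a t) = profileRadius a t := by
  unfold radiusOfHeight
  rw [((strictMonoOn_profileHeight ha).mono Ioo_subset_Icc_self).injOn.leftInvOn_invFunOn ⟨h0, h1⟩]

theorem profileHeight_mem_heightRange {a t : ℝ} (ha : 0 < a) (h0 : 0 < t)
    (h1 : t < 2 * ellipticK (1 / √2) / a) : profileHeight a t ∈ heightRange a := by
  have h := strictMonoOn_profileHeight ha
  refine ⟨?_, h ⟨h0.le, h1.le⟩ ⟨(h0.trans h1).le, le_rfl⟩ h1⟩
  simpa [profileHeight_zero] using h ⟨le_rfl, (h0.trans h1).le⟩ ⟨h0.le, h1.le⟩ h0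

theorem exists_profileHeight_eq {a z : ℝ} (ha : 0 < a) (hz : z ∈ heightRange a) :
    ∃ t, 0 < t ∧ t < 2 * ellipticK (1 / √2) / a ∧ profileHeight a t = z := by
  have hK := ellipticK_pos abs_one_div_sqrt_two_lt_one
  have h := intermediate_value_Ioo (f := profileHeight a) (a := 0)
    (b := 2 * ellipticK (1 / √2) / a) (by positivity)
    (fun u _ => (hasStrictDerivAt_profileHeight a u).hasDerivAt.continuousAt.continuousWithinAt)
  rw [profileHeight_zero] at h
  obtain ⟨t, ht, rfl⟩ := h hz
  exact ⟨t, ht.1, ht.2, rfl⟩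

theorem differentiableAt_radiusOfHeight {a z : ℝ} (ha : 0 < a) (hz : z ∈ heightRange a) :
    DifferentiableAt ℝ (radiusOfHeight a) z := by
  obtain ⟨t, h0, h1, rfl⟩ := exists_profileHeight_eq ha hz
  have hpos := jacobiSd_pos abs_one_div_sqrt_two_lt_one (mul_pos ha h0)
    (by rwa [lt_div_iff₀' ha] at h1)
  have h := hasStrictDerivAt_invFunOn (Ioo_mem_nhds h0 h1) (hasStrictDerivAt_profileHeight a t)
    (by positivity) ((strictMonoOn_profileHeight ha).mono Ioo_subset_Icc_self).injOn
  exact (hasStrictDerivAt_profileRadius ha _).hasDerivAt.differentiableAt.comp _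
    h.hasDerivAt.differentiableAt

/-- Height increases strictly along the profile curve, so `t` can be recovered from `q 3`. This
implicit description eliminates all three parameters. -/
theorem mem_rotHypersurface_iff {a : ℝ} (ha : 0 < a) {q : 𝔼 4} :
    q ∈ rotHypersurface a ↔ q 3 ∈ heightRange a ∧ 0 < radiusOfHeight a (q 3) ∧
      q 0 ^ 2 + q 1 ^ 2 + q 2 ^ 2 = radiusOfHeight a (q 3) ^ 2 := by
  constructor
  · intro h
    obtain ⟨t, h0, h1, hr, hh⟩ := exists_of_mem_rotHypersurface h
    rw [hh, radiusOfHeight_profileHeight ha h0 h1]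
    exact ⟨profileHeight_mem_heightRange ha h0 h1, profileRadius_pos ha h0 h1, hr⟩
  · rintro ⟨h1, -, h2⟩
    obtain ⟨t, h0, h1, hh⟩ := exists_profileHeight_eq ha h1
    rw [← hh, radiusOfHeight_profileHeight ha h0 h1] at h2
    exact mem_rotHypersurface ha h0 h1 h2 hh.symm

theorem radiusOfHeight_pos {a z : ℝ} (ha : 0 < a) (hz : z ∈ heightRange a) :
    0 < radiusOfHeight a z := by
  obtain ⟨t, h0, h1, rfl⟩ := exists_profileHeight_eq ha hz
  rw [radiusOfHeight_profileHeight ha h0 h1]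
  exact profileRadius_pos ha h0 h1

/-- The spherical shell onto which the model hypersurface is mapped by `toShell`. -/
def shell (a : ℝ) : Set (𝔼 3) := {y | ‖y‖ ∈ heightRange a}

/-- The point of the shell with the direction of the horizontal part of `q`, at distance `q 3` from
the origin. -/
def toShell (q : 𝔼 4) : 𝔼 3 :=
  (q 3 / √(q 0 ^ 2 + q 1 ^ 2 + q 2 ^ 2)) • !₂[q 0, q 1, q 2]

/-- The inverse of `toShell`. -/
def ofShell (a : ℝ) (y : 𝔼 3) : 𝔼 4 :=
  !₂[radiusOfHeight a ‖y‖ / ‖y‖ * y 0, radiusOfHeight a ‖y‖ / ‖y‖ * y 1,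
    radiusOfHeight a ‖y‖ / ‖y‖ * y 2, ‖y‖]

theorem norm_toShell {a : ℝ} (ha : 0 < a) {q : 𝔼 4} (hq : q ∈ rotHypersurface a) :
    ‖toShell q‖ = q 3 := by
  obtain ⟨h1, h2, h3⟩ := (mem_rotHypersurface_iff ha).1 hq
  rw [toShell, norm_smul, EuclideanSpace.norm_eq]
  simp only [Fin.sum_univ_three, Real.norm_eq_abs, sq_abs]
  change |q 3 / _| * √(q 0 ^ 2 + q 1 ^ 2 + q 2 ^ 2) = _
  rw [h3, Real.sqrt_sq h2.le, abs_of_pos (div_pos h1.1 h2), div_mul_cancel₀ _ h2.ne']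

theorem toShell_mem {a : ℝ} (ha : 0 < a) {q : 𝔼 4} (hq : q ∈ rotHypersurface a) :
    toShell q ∈ shell a := by
  rw [shell, mem_ofPred_eq, norm_toShell ha hq]
  exact ((mem_rotHypersurface_iff ha).1 hq).1

theorem ofShell_toShell {a : ℝ} (ha : 0 < a) {q : 𝔼 4} (hq : q ∈ rotHypersurface a) :
    ofShell a (toShell q) = q := by
  obtain ⟨h1, h2, h3⟩ := (mem_rotHypersurface_iff ha).1 hq
  have h4 : ∀ r, radiusOfHeight a (q 3) / q 3 * ((q 3 / √(q 0 ^ 2 + q 1 ^ 2 + q 2 ^ 2)) * r) = r := by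
    intro r
    rw [h3, Real.sqrt_sq h2.le]
    have := h1.1.ne'
    have := h2.ne'
    field_simp
  rw [ofShell, norm_toShell ha hq]
  ext i
  fin_cases i
  · exact h4 _
  · exact h4 _
  · exact h4 _
  · rfl

theorem norm_sq_eq_three (y : 𝔼 3) : ‖y‖ ^ 2 = y 0 ^ 2 + y 1 ^ 2 + y 2 ^ 2 := by
  rw [EuclideanSpace.norm_sq_eq, Fin.sum_univ_three]
  simp

theorem ofShell_mem {a : ℝ} (ha : 0 < a) {y : 𝔼 3} (hy : y ∈ shell a) :
    ofShell a y ∈ rotHypersurface a := by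
  refine (mem_rotHypersurface_iff ha).2 ⟨hy, radiusOfHeight_pos ha hy, ?_⟩
  have h0 : ‖y‖ ≠ 0 := (show 0 < ‖y‖ from hy.1).ne'
  change (radiusOfHeight a ‖y‖ / ‖y‖ * y 0) ^ 2 + (radiusOfHeight a ‖y‖ / ‖y‖ * y 1) ^ 2
    + (radiusOfHeight a ‖y‖ / ‖y‖ * y 2) ^ 2 = radiusOfHeight a ‖y‖ ^ 2
  field_simp
  rw [norm_sq_eq_three]

theorem toShell_ofShell {a : ℝ} (ha : 0 < a) {y : 𝔼 3} (hy : y ∈ shell a) :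
    toShell (ofShell a y) = y := by
  obtain ⟨h1, h2, h3⟩ := (mem_rotHypersurface_iff ha).1 (ofShell_mem ha hy)
  have h0 : ‖y‖ ≠ 0 := (show 0 < ‖y‖ from hy.1).ne'
  rw [toShell, h3, Real.sqrt_sq h2.le]
  have h4 : ∀ r, ‖y‖ / radiusOfHeight a ‖y‖ * (radiusOfHeight a ‖y‖ / ‖y‖ * r) = r := by
    intro r
    have := (radiusOfHeight_pos ha hy).ne'
    field_simp
  ext i
  fin_cases i <;> exact h4 _

theorem differentiableAt_ofShell {a : ℝ} (ha : 0 < a) {y : 𝔼 3} (hy : y ∈ shell a) :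
    DifferentiableAt ℝ (ofShell a) y := by
  have h0 : ‖y‖ ≠ 0 := (show 0 < ‖y‖ from hy.1).ne'
  have hn : DifferentiableAt ℝ (fun y : 𝔼 3 => ‖y‖) y :=
    differentiableAt_id.norm ℝ (norm_ne_zero_iff.1 h0)
  have hq : DifferentiableAt ℝ (fun y : 𝔼 3 => radiusOfHeight a ‖y‖ / ‖y‖) y := by
    simp only [div_eq_mul_inv]
    exact (DifferentiableAt.comp (f := fun y : 𝔼 3 => ‖y‖) y
      (differentiableAt_radiusOfHeight ha hy) hn).mul (hn.inv h0)
  have hc : ∀ i : Fin 3, DifferentiableAt ℝ (fun y : 𝔼 3 => y i) y := fun i =>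
    (EuclideanSpace.proj i : 𝔼 3 →L[ℝ] ℝ).differentiableAt
  refine differentiableAt_euclidean.2 fun i => ?_
  fin_cases i
  · exact hq.mul (hc 0)
  · exact hq.mul (hc 1)
  · exact hq.mul (hc 2)
  · exact hn

theorem contDiffAt_toShell {q : 𝔼 4} (h : q 0 ^ 2 + q 1 ^ 2 + q 2 ^ 2 ≠ 0) :
    ContDiffAt ℝ 1 toShell q := by
  have hc : ∀ i : Fin 4, ContDiffAt ℝ 1 (fun y : 𝔼 4 => y i) q := fun i =>
    (EuclideanSpace.proj i : 𝔼 4 →L[ℝ] ℝ).contDiff.contDiffAt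
  have hs : ContDiffAt ℝ 1 (fun q : 𝔼 4 => q 3 / √(q 0 ^ 2 + q 1 ^ 2 + q 2 ^ 2)) q :=
    (hc 3).div (((((hc 0).pow 2).add ((hc 1).pow 2)).add ((hc 2).pow 2)).sqrt h)
      (Real.sqrt_ne_zero'.2 (lt_of_le_of_ne (by positivity) h.symm))
  refine hs.smul (contDiffAt_euclidean.2 fun i => ?_)
  fin_cases i
  · exact hc 0
  · exact hc 1
  · exact hc 2

theorem horizontal_ne_zero {a : ℝ} (ha : 0 < a) {q : 𝔼 4} (hq : q ∈ rotHypersurface a) :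
    q 0 ^ 2 + q 1 ^ 2 + q 2 ^ 2 ≠ 0 := by
  obtain ⟨-, h2, h3⟩ := (mem_rotHypersurface_iff ha).1 hq
  rw [h3]; positivity

theorem isOpen_shell (a : ℝ) : IsOpen (shell a) := isOpen_Ioo.preimage continuous_norm

/-- The model hypersurface is homeomorphic to a spherical shell. -/
def shellHomeomorph {a : ℝ} (ha : 0 < a) : rotHypersurface a ≃ₜ shell a where
  toFun q := ⟨toShell q, toShell_mem ha q.2⟩
  invFun y := ⟨ofShell a y, ofShell_mem ha y.2⟩
  left_inv q := Subtype.ext (ofShell_toShell ha q.2)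
  right_inv y := Subtype.ext (toShell_ofShell ha y.2)
  continuous_toFun := by
    refine Continuous.subtype_mk (continuous_iff_continuousAt.2 fun q => ?_) _
    exact (contDiffAt_toShell (horizontal_ne_zero ha q.2)).continuousAt.comp
      continuous_subtype_val.continuousAt
  continuous_invFun := by
    refine Continuous.subtype_mk (continuous_iff_continuousAt.2 fun y => ?_) _
    exact (differentiableAt_ofShell ha y.2).continuousAt.comp
      continuous_subtype_val.continuousAt

/-- This allows a map into the model to be tested for being a local homeomorphism after composition
with `toShell`, hence between open pieces of Euclidean 3-space, without a manifold structure on the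
model. -/
theorem isLocalHomeomorph_toShell {a : ℝ} (ha : 0 < a) :
    IsLocalHomeomorph fun q : rotHypersurface a => toShell q :=
  ((isOpen_shell a).isOpenEmbedding_subtypeVal.comp
    (shellHomeomorph ha).isOpenEmbedding).isLocalHomeomorph

/-! ### Immersions in charts -/

section Charts

variable {M : Type*} [TopologicalSpace M] [ChartedSpace (𝔼 3) M]
  [IsManifold 𝓘(ℝ, 𝔼 3) ∞ M] {m : ℕ}
  {F : Type*} [NormedAddCommGroup F] [NormedSpace ℝ F]

theorem contDiffOn_comp_symm {x : M → 𝔼 m} (hx : IsSmoothImmersion (n := 3) x)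
    {φ : OpenPartialHomeomorph M (𝔼 3)} (hφ : φ ∈ atlas (𝔼 3) M) :
    ContDiffOn ℝ ∞ (x ∘ φ.symm) φ.target := by
  rw [← contMDiffOn_iff_contDiffOn]
  exact hx.1.comp_contMDiffOn (contMDiffOn_symm_of_mem_maximalAtlas
    (IsManifold.subset_maximalAtlas hφ))

theorem hasMFDerivAt_of_eventuallyEq_comp_chart {φ : OpenPartialHomeomorph M (𝔼 3)}
    (hφ : φ ∈ atlas (𝔼 3) M) {p : M} (hp : p ∈ φ.source) {f : M → F} {g : 𝔼 3 → F}
    (hg : DifferentiableAt ℝ g (φ p)) (hf : f =ᶠ[𝓝 p] g ∘ φ) :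
    HasMFDerivAt 𝓘(ℝ, 𝔼 3) 𝓘(ℝ, F) f p
      ((fderiv ℝ g (φ p)).comp (mfderiv 𝓘(ℝ, 𝔼 3) 𝓘(ℝ, 𝔼 3) φ p)) := by
  have h1 : HasMFDerivAt 𝓘(ℝ, 𝔼 3) 𝓘(ℝ, 𝔼 3) φ p (mfderiv 𝓘(ℝ, 𝔼 3) 𝓘(ℝ, 𝔼 3) φ p) :=
    (mdifferentiableAt_atlas (I := 𝓘(ℝ, 𝔼 3)) hφ hp).hasMFDerivAt
  exact (hg.hasFDerivAt.hasMFDerivAt.comp p h1).congr_of_eventuallyEq hf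

theorem mfderiv_eq_comp_mfderiv_chart {φ : OpenPartialHomeomorph M (𝔼 3)}
    (hφ : φ ∈ atlas (𝔼 3) M) {p : M} (hp : p ∈ φ.source) {x : M → 𝔼 m}
    (hx : IsSmoothImmersion (n := 3) x) :
    mfderiv 𝓘(ℝ, 𝔼 3) 𝓘(ℝ, 𝔼 m) x p
      = (fderiv ℝ (x ∘ φ.symm) (φ p)).comp (mfderiv 𝓘(ℝ, 𝔼 3) 𝓘(ℝ, 𝔼 3) φ p) := by
  refine (hasMFDerivAt_of_eventuallyEq_comp_chart hφ hp ?_ ?_).mfderiv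
  · exact ((contDiffOn_comp_symm hx hφ).contDiffAt
      (φ.open_target.mem_nhds (φ.map_source hp))).differentiableAt (by simp)
  · filter_upwards [φ.open_source.mem_nhds hp] with z hz
    simp [φ.left_inv hz]

theorem mfderiv_chart_bijective {φ : OpenPartialHomeomorph M (𝔼 3)}
    (hφ : φ ∈ atlas (𝔼 3) M) {p : M} (hp : p ∈ φ.source) :
    Function.Bijective (mfderiv 𝓘(ℝ, 𝔼 3) 𝓘(ℝ, 𝔼 3) φ p) :=
  (mdifferentiable_of_mem_atlas (I := 𝓘(ℝ, 𝔼 3)) hφ).mfderiv_bijective hp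

theorem fderiv_comp_symm_injective {x : M → 𝔼 m} (hx : IsSmoothImmersion (n := 3) x)
    {φ : OpenPartialHomeomorph M (𝔼 3)} (hφ : φ ∈ atlas (𝔼 3) M) {y : 𝔼 3} (hy : y ∈ φ.target) :
    Function.Injective (fderiv ℝ (x ∘ φ.symm) y) := by
  have hp := φ.map_target hy
  have h := hx.2 (φ.symm y)
  rw [mfderiv_eq_comp_mfderiv_chart hφ hp hx, φ.right_inv hy] at h
  intro v w hvw
  obtain ⟨v', rfl⟩ := (mfderiv_chart_bijective hφ hp).2 v
  obtain ⟨w', rfl⟩ := (mfderiv_chart_bijective hφ hp).2 w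
  exact congrArg _ (h hvw)

/-- An immersion that takes values in the model hypersurface is a local homeomorphism onto it. -/
theorem isLocalHomeomorph_rotHypersurface {x : M → 𝔼 4} (hx : IsSmoothImmersion (n := 3) x)
    {a : ℝ} (ha : 0 < a) (h : ∀ p, x p ∈ rotHypersurface a) :
    IsLocalHomeomorph fun p => (⟨x p, h p⟩ : rotHypersurface a) := by
  refine IsLocalHomeomorph.of_comp (g := fun q : rotHypersurface a => toShell q)
    (f := fun p => (⟨x p, h p⟩ : rotHypersurface a)) ?_ (isLocalHomeomorph_toShell ha)
    (hx.1.continuous.subtype_mk _)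
  refine IsLocalHomeomorph.mk _ fun p => ?_
  set φ := chartAt (𝔼 3) p
  have hφ : φ ∈ atlas (𝔼 3) M := chart_mem_atlas _ p
  have hp : p ∈ φ.source := mem_chart_source _ p
  set X := x ∘ φ.symm
  have hX : ContDiffAt ℝ 1 X (φ p) :=
    ((contDiffOn_comp_symm hx hφ).contDiffAt (φ.open_target.mem_nhds (φ.map_source hp))).of_le
      (by simp)
  have hXp : X (φ p) = x p := congrArg x (φ.left_inv hp)
  have hY : ContDiffAt ℝ 1 (toShell ∘ X) (φ p) :=
    ContDiffAt.comp _ (contDiffAt_toShell (by rw [hXp]; exact horizontal_ne_zero ha (h p))) hX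
  -- `X` factors as `ofShell a ∘ (toShell ∘ X)`, so by the chain rule the injectivity of `dX` passes
  -- to the inner factor.
  have hinj : Function.Injective (fderiv ℝ (toShell ∘ X) (φ p)) := by
    have hXY : X = ofShell a ∘ (toShell ∘ X) := funext fun y => (ofShell_toShell ha (h _)).symm
    have hc : fderiv ℝ X (φ p) = (fderiv ℝ (ofShell a) ((toShell ∘ X) (φ p))).comp
        (fderiv ℝ (toShell ∘ X) (φ p)) := by
      conv_lhs => rw [hXY]
      exact fderiv_comp _ (differentiableAt_ofShell ha (toShell_mem ha (h _)))
        (hY.differentiableAt (by simp))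
    have := fderiv_comp_symm_injective hx hφ (φ.map_source hp)
    change Function.Injective (fderiv ℝ X (φ p)) at this
    rw [hc] at this
    exact Function.Injective.of_comp this
  let A : 𝔼 3 ≃L[ℝ] 𝔼 3 :=
    (LinearEquiv.ofInjectiveEndo (fderiv ℝ (toShell ∘ X) (φ p)).toLinearMap
      hinj).toContinuousLinearEquiv
  have hA : HasStrictFDerivAt (toShell ∘ X) (A : 𝔼 3 →L[ℝ] 𝔼 3) (φ p) := by
    have hAeq : (A : 𝔼 3 →L[ℝ] 𝔼 3) = fderiv ℝ (toShell ∘ X) (φ p) :=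
      ContinuousLinearMap.ext fun v => rfl
    rw [hAeq]
    exact hY.hasStrictFDerivAt (by simp)
  refine ⟨φ.trans (hA.toOpenPartialHomeomorph _), ?_, ?_⟩
  · rw [OpenPartialHomeomorph.trans_source]
    exact ⟨hp, hA.mem_toOpenPartialHomeomorph_source⟩
  · intro z hz
    rw [OpenPartialHomeomorph.trans_source] at hz
    change toShell (x z) = toShell (x (φ.symm (φ z)))
    rw [φ.left_inv hz.1]

end Charts

/-! ### Unit normal fields of parametrized hypersurfaces -/

/-- The second derivative `∂_v ∂_w X`. -/
def hess {n : ℕ} {F : Type*} [NormedAddCommGroup F] [NormedSpace ℝ F] (X : 𝔼 n → F)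
    (y v w : 𝔼 n) : F :=
  fderiv ℝ (fun z => fderiv ℝ X z w) y v

/-- On the open set `V`, the immersion `X` has the smooth unit normal field `N`, and its
differential has the smooth left inverse `L`. -/
structure NormalData (X : 𝔼 3 → 𝔼 4) (V : Set (𝔼 3)) (N : 𝔼 3 → 𝔼 4)
    (L : 𝔼 3 → 𝔼 4 →L[ℝ] 𝔼 3) : Prop where
  isOpen : IsOpen V
  smooth : ∀ y ∈ V, ContDiffAt ℝ ∞ X y
  smooth_normal : ∀ y ∈ V, ContDiffAt ℝ ∞ N y
  smooth_left : ∀ y ∈ V, ContDiffAt ℝ ∞ L y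
  left_inv : ∀ y ∈ V, ∀ v, L y (fderiv ℝ X y v) = v
  norm_normal : ∀ y ∈ V, ‖N y‖ = 1
  inner_normal : ∀ y ∈ V, ∀ v, ⟪fderiv ℝ X y v, N y⟫ = 0

theorem exists_norm_eq_one_orthogonal (D : 𝔼 3 →L[ℝ] 𝔼 4) :
    ∃ n : 𝔼 4, ‖n‖ = 1 ∧ ∀ v, ⟪D v, n⟫ = 0 := by
  have hlt : Module.finrank ℝ D.range < Module.finrank ℝ (𝔼 4) := by
    have h := LinearMap.finrank_range_le D.toLinearMap
    rw [finrank_euclideanSpace_fin] at h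
    rw [finrank_euclideanSpace_fin]
    exact Nat.lt_succ_of_le h
  have hne : D.rangeᗮ ≠ ⊥ := fun h => by
    rw [Submodule.orthogonal_eq_bot_iff] at h
    rw [h, finrank_top] at hlt
    exact lt_irrefl _ hlt
  obtain ⟨z, hz, hz0⟩ := Submodule.exists_mem_ne_zero_of_ne_bot hne
  refine ⟨‖z‖⁻¹ • z, norm_smul_inv_norm hz0, fun v => ?_⟩
  have hDv : ⟪D v, z⟫ = 0 :=
    Submodule.inner_right_of_mem_orthogonal (LinearMap.mem_range_self D.toLinearMap v) hz
  rw [inner_smul_right, hDv, mul_zero]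

theorem range_eq_orthogonal {D : 𝔼 3 →L[ℝ] 𝔼 4} (hD : Function.Injective D) {n : 𝔼 4}
    (hn : ‖n‖ = 1) (hDn : ∀ v, ⟪D v, n⟫ = 0) : D.range = (Submodule.span ℝ {n})ᗮ := by
  have hn0 : n ≠ 0 := norm_ne_zero_iff.1 (by rw [hn]; norm_num)
  refine Submodule.eq_of_le_of_finrank_eq ?_ ?_
  · rintro _ ⟨v, rfl⟩
    rw [Submodule.mem_orthogonal_singleton_iff_inner_left]
    exact hDn v
  · have : Fact (Module.finrank ℝ (𝔼 4) = 3 + 1) := ⟨finrank_euclideanSpace_fin⟩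
    rw [Submodule.finrank_orthogonal_span_singleton (n := 3) hn0,
      LinearMap.finrank_range_of_inj (f := D.toLinearMap) hD, finrank_euclideanSpace_fin]

theorem eq_or_eq_neg_of_orthogonal {D : 𝔼 3 →L[ℝ] 𝔼 4} (hD : Function.Injective D) {n n' : 𝔼 4}
    (hn : ‖n‖ = 1) (hDn : ∀ v, ⟪D v, n⟫ = 0) (hn' : ‖n'‖ = 1) (hDn' : ∀ v, ⟪D v, n'⟫ = 0) :
    n' = n ∨ n' = -n := by
  have h1 : n' ∈ D.rangeᗮ := by
    rintro _ ⟨v, rfl⟩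
    exact hDn' v
  rw [range_eq_orthogonal hD hn hDn, Submodule.orthogonal_orthogonal,
    Submodule.mem_span_singleton] at h1
  obtain ⟨c, rfl⟩ := h1
  rw [norm_smul, hn, mul_one, Real.norm_eq_abs] at hn'
  rcases eq_or_eq_neg_of_abs_eq hn' with rfl | rfl
  · exact Or.inl (one_smul _ _)
  · exact Or.inr (by rw [neg_smul, one_smul])

theorem exists_normalData {X : 𝔼 3 → 𝔼 4} {U : Set (𝔼 3)} (hU : IsOpen U)
    (hX : ContDiffOn ℝ ∞ X U) (hinj : ∀ y ∈ U, Function.Injective (fderiv ℝ X y)) {y₀ : 𝔼 3}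
    (hy₀ : y₀ ∈ U) : ∃ V ⊆ U, y₀ ∈ V ∧ ∃ N L, NormalData X V N L := by
  have hXs : ∀ y ∈ U, ContDiffAt ℝ ∞ X y := fun y hy => hX.contDiffAt (hU.mem_nhds hy)
  have hDs : ∀ y ∈ U, ContDiffAt ℝ ∞ (fderiv ℝ X) y := fun y hy =>
    (hXs y hy).fderiv_right (by simp)
  obtain ⟨P, hP⟩ : ∃ P : 𝔼 4 →L[ℝ] 𝔼 3, ∀ v, P (fderiv ℝ X y₀ v) = v := by
    obtain ⟨P, hP⟩ := LinearMap.exists_leftInverse_of_injective (fderiv ℝ X y₀).toLinearMap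
      (LinearMap.ker_eq_bot.2 (hinj y₀ hy₀))
    exact ⟨P.toContinuousLinearMap, fun v => LinearMap.congr_fun hP v⟩
  obtain ⟨n₀, hn₀, hperp⟩ := exists_norm_eq_one_orthogonal (fderiv ℝ X y₀)
  -- `P` is a left inverse of `dX` at `y₀` only. Near `y₀` the endomorphism `P ∘ dX` is still
  -- invertible, and `(P ∘ dX)⁻¹ ∘ P` is a left inverse depending smoothly on the point.
  let Q : 𝔼 3 → 𝔼 3 →L[ℝ] 𝔼 3 := fun y => P.comp (fderiv ℝ X y)
  have hQs : ∀ y ∈ U, ContDiffAt ℝ ∞ Q y := fun y hy => contDiffAt_const.clm_comp (hDs y hy)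
  let L : 𝔼 3 → 𝔼 4 →L[ℝ] 𝔼 3 := fun y => (Q y).inverse.comp P
  let V₁ := U ∩ Q ⁻¹' range ((↑) : (𝔼 3 ≃L[ℝ] 𝔼 3) → 𝔼 3 →L[ℝ] 𝔼 3)
  have hV₁ : IsOpen V₁ := ContinuousOn.isOpen_inter_preimage
    (fun y hy => (hQs y hy).continuousAt.continuousWithinAt) hU (ContinuousLinearEquiv.isOpen)
  have hLs : ∀ y ∈ V₁, ContDiffAt ℝ ∞ L y := by
    rintro y ⟨hy, e, he⟩
    have hinv : ContDiffAt ℝ ∞ (ContinuousLinearMap.inverse : (𝔼 3 →L[ℝ] 𝔼 3) → _) (Q y) := by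
      rw [← he]
      exact contDiffAt_map_inverse e
    exact ContDiffAt.clm_comp (hinv.comp y (hQs y hy)) contDiffAt_const
  have hL : ∀ y ∈ V₁, ∀ v, L y (fderiv ℝ X y v) = v := by
    rintro y ⟨hy, e, he⟩ v
    change (Q y).inverse (Q y v) = v
    rw [← he, ContinuousLinearMap.inverse_equiv]
    exact e.symm_apply_apply v
  have hy₁ : y₀ ∈ V₁ := by
    refine ⟨hy₀, ContinuousLinearEquiv.refl ℝ _, ContinuousLinearMap.ext fun v => ?_⟩
    exact (hP v).symm
  -- The map `z ↦ z - dX (L z)` annihilates tangent vectors, so the vector representing `z ↦ ⟪n₀, z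
  -- - dX (L z)⟫` is normal. It is written out in coordinates to make its smoothness visible, and at
  -- `y₀` its inner product with `n₀` is `1`, so it does not vanish nearby.
  let ν : 𝔼 3 → 𝔼 4 → ℝ := fun y z => ⟪n₀, z - fderiv ℝ X y (L y z)⟫
  let N₁ : 𝔼 3 → 𝔼 4 := fun y => ∑ i, ν y (EuclideanSpace.single i 1) • EuclideanSpace.single i 1
  have hN₁ : ∀ y z, ⟪N₁ y, z⟫ = ν y z := by
    intro y z
    have hz : z = ∑ i, z i • EuclideanSpace.single i (1 : ℝ) := by
      simpa using ((EuclideanSpace.basisFun (Fin 4) ℝ).sum_repr z).symm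
    have hlin : ν y z = ∑ i, z i * ν y (EuclideanSpace.single i 1) := by
      conv_lhs => rw [hz]
      simp only [ν, map_sum, map_smul, ← Finset.sum_sub_distrib, ← smul_sub, inner_sum,
        inner_smul_right]
    rw [hlin]
    simp only [N₁, sum_inner, inner_smul_left]
    refine Finset.sum_congr rfl fun i _ => ?_
    rw [EuclideanSpace.inner_single_left]
    simp [mul_comm]
  have hN₁s : ∀ y ∈ V₁, ContDiffAt ℝ ∞ N₁ y := by
    intro y hy
    refine ContDiffAt.sum fun i _ => ContDiffAt.fun_smul ?_ contDiffAt_const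
    exact contDiffAt_const.inner ℝ (contDiffAt_const.sub
      ((hDs y hy.1).clm_apply ((hLs y hy).clm_apply contDiffAt_const)))
  have hperp₁ : ∀ y ∈ V₁, ∀ v, ⟪N₁ y, fderiv ℝ X y v⟫ = 0 := by
    intro y hy v
    rw [hN₁]
    simp only [ν]
    rw [hL y hy, sub_self, inner_zero_right]
  let V := V₁ ∩ N₁ ⁻¹' {0}ᶜ
  have hV : IsOpen V := ContinuousOn.isOpen_inter_preimage
    (fun y hy => (hN₁s y hy).continuousAt.continuousWithinAt) hV₁ isOpen_compl_singleton
  refine ⟨V, fun y hy => hy.1.1, ⟨hy₁, fun h => ?_⟩, fun y => ‖N₁ y‖⁻¹ • N₁ y, L, hV,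
    fun y hy => hXs y hy.1.1, fun y hy => ?_, fun y hy => hLs y hy.1, fun y hy => hL y hy.1,
    fun y hy => ?_, fun y hy v => ?_⟩
  · have h1 := hN₁ y₀ n₀
    rw [mem_singleton_iff.1 h] at h1
    simp only [ν] at h1
    rw [inner_zero_left, inner_sub_right, real_inner_comm (fderiv ℝ X y₀ _) n₀, hperp, sub_zero,
      real_inner_self_eq_norm_sq, hn₀] at h1
    norm_num at h1
  · have h0 : N₁ y ≠ 0 := hy.2
    exact (((hN₁s y hy.1).norm ℝ h0).inv (norm_ne_zero_iff.2 h0)).smul (hN₁s y hy.1)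
  · have h0 : N₁ y ≠ 0 := hy.2
    exact norm_smul_inv_norm h0
  · rw [inner_smul_right, real_inner_comm, hperp₁ y hy.1, mul_zero]

theorem hess_eq {n : ℕ} {F : Type*} [NormedAddCommGroup F] [NormedSpace ℝ F] {X : 𝔼 n → F}
    {y : 𝔼 n} (hX : ContDiffAt ℝ ∞ X y) (v w : 𝔼 n) :
    hess X y v w = fderiv ℝ (fderiv ℝ X) y v w := by
  have h : DifferentiableAt ℝ (fderiv ℝ X) y :=
    (hX.fderiv_right (m := ∞) (by simp)).differentiableAt (by simp)
  unfold hess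
  rw [fderiv_clm_apply h (differentiableAt_const w)]
  simp

theorem two_le_infty : (2 : WithTop ℕ∞) ≤ ∞ := WithTop.coe_le_coe.2 (le_top : (2 : ℕ∞) ≤ ⊤)

theorem hess_symm {n : ℕ} {F : Type*} [NormedAddCommGroup F] [NormedSpace ℝ F] {X : 𝔼 n → F}
    {y : 𝔼 n} (hX : ContDiffAt ℝ ∞ X y) (v w : 𝔼 n) :
    hess X y v w = hess X y w v := by
  rw [hess_eq hX, hess_eq hX]
  exact (hX.isSymmSndFDerivAt (by simpa using two_le_infty)).eq v w

namespace NormalData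

variable {X : 𝔼 3 → 𝔼 4} {V : Set (𝔼 3)} {N : 𝔼 3 → 𝔼 4} {L : 𝔼 3 → 𝔼 4 →L[ℝ] 𝔼 3} {y : 𝔼 3}

theorem injective (h : NormalData X V N L) (hy : y ∈ V) : Function.Injective (fderiv ℝ X y) :=
  Function.LeftInverse.injective (h.left_inv y hy)

theorem range_eq (h : NormalData X V N L) (hy : y ∈ V) :
    (fderiv ℝ X y).range = (Submodule.span ℝ {N y})ᗮ :=
  range_eq_orthogonal (h.injective hy) (h.norm_normal y hy) (h.inner_normal y hy)

theorem map_left (h : NormalData X V N L) (hy : y ∈ V) {z : 𝔼 4} (hz : ⟪z, N y⟫ = 0) :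
    fderiv ℝ X y (L y z) = z := by
  have : z ∈ (fderiv ℝ X y).range := by
    rw [h.range_eq hy, Submodule.mem_orthogonal_singleton_iff_inner_left]
    exact hz
  obtain ⟨v, rfl⟩ := this
  exact congrArg _ (h.left_inv y hy v)

theorem secondFF_eq (h : NormalData X V N L) (hy : y ∈ V) (v w : 𝔼 3) :
    secondFF X y v w = ⟪hess X y v w, N y⟫ • N y := by
  have hs := Submodule.starProjection_unit_singleton ℝ (h.norm_normal y hy) (hess X y v w)
  rw [real_inner_comm] at hs
  rw [← hs]
  unfold secondFF hess
  have := h.range_eq hy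
  congr 2
  rw [this, Submodule.orthogonal_orthogonal]

theorem differentiableAt (h : NormalData X V N L) (hy : y ∈ V) : DifferentiableAt ℝ X y :=
  (h.smooth y hy).differentiableAt (by simp)

theorem differentiableAt_normal (h : NormalData X V N L) (hy : y ∈ V) : DifferentiableAt ℝ N y :=
  (h.smooth_normal y hy).differentiableAt (by simp)

theorem smooth_fderiv (h : NormalData X V N L) (hy : y ∈ V) (w : 𝔼 3) :
    ContDiffAt ℝ ∞ (fun z => fderiv ℝ X z w) y :=
  ((h.smooth y hy).fderiv_right (by simp)).clm_apply contDiffAt_const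

theorem differentiableAt_fderiv (h : NormalData X V N L) (hy : y ∈ V) (w : 𝔼 3) :
    DifferentiableAt ℝ (fun z => fderiv ℝ X z w) y :=
  (h.smooth_fderiv hy w).differentiableAt (by simp)

theorem inner_fderiv_normal_self (h : NormalData X V N L) (hy : y ∈ V) (v : 𝔼 3) :
    ⟪fderiv ℝ N y v, N y⟫ = 0 := by
  have h1 := fderiv_inner_apply ℝ (h.differentiableAt_normal hy) (h.differentiableAt_normal hy) v
  have h2 : (fun z => ⟪N z, N z⟫) =ᶠ[𝓝 y] fun _ => (1 : ℝ) := by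
    filter_upwards [h.isOpen.mem_nhds hy] with z hz
    rw [real_inner_self_eq_norm_sq, h.norm_normal z hz, one_pow]
  rw [h2.fderiv_eq] at h1
  simp only [fderiv_fun_const, Pi.zero_apply, zero_apply] at h1
  rw [real_inner_comm] at h1 ⊢
  linarith [real_inner_comm (N y) (fderiv ℝ N y v)]

/-- Differentiate `⟪dX w, N⟫ = 0`. -/
theorem inner_fderiv_normal (h : NormalData X V N L) (hy : y ∈ V) (v w : 𝔼 3) :
    ⟪fderiv ℝ N y v, fderiv ℝ X y w⟫ = -⟪hess X y v w, N y⟫ := by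
  have h1 := fderiv_inner_apply ℝ (h.differentiableAt_fderiv hy w) (h.differentiableAt_normal hy) v
  have h2 : (fun z => ⟪fderiv ℝ X z w, N z⟫) =ᶠ[𝓝 y] fun _ => (0 : ℝ) := by
    filter_upwards [h.isOpen.mem_nhds hy] with z hz
    exact h.inner_normal z hz w
  rw [h2.fderiv_eq] at h1
  simp only [fderiv_fun_const, Pi.zero_apply, zero_apply] at h1
  rw [real_inner_comm]
  unfold hess
  linarith

end NormalData

/-! ### The Gauss equation -/

theorem sum_smul_coordVec {n : ℕ} (v : 𝔼 n) : ∑ i, v i • coordVec i = v := by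
  simpa [coordVec] using (EuclideanSpace.basisFun (Fin n) ℝ).sum_repr v

theorem map_eq_sum_coordVec {n : ℕ} {F : Type*} [NormedAddCommGroup F] [NormedSpace ℝ F]
    (A : 𝔼 n →L[ℝ] F) (v : 𝔼 n) : A v = ∑ i, v i • A (coordVec i) := by
  conv_lhs => rw [← sum_smul_coordVec v]
  simp only [map_sum, map_smul]

theorem gram_eq {n m : ℕ} (X : 𝔼 n → 𝔼 m) (y : 𝔼 n) (i j : Fin n) :
    gram X y i j = ⟪fderiv ℝ X y (coordVec i), fderiv ℝ X y (coordVec j)⟫ := rfl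

theorem gram_mulVec {n m : ℕ} (X : 𝔼 n → 𝔼 m) (y c : 𝔼 n) (l : Fin n) :
    ∑ k, gram X y l k * c k = ⟪fderiv ℝ X y c, fderiv ℝ X y (coordVec l)⟫ := by
  rw [map_eq_sum_coordVec (fderiv ℝ X y) c, sum_inner]
  refine Finset.sum_congr rfl fun k _ => ?_
  rw [gram_eq, inner_smul_left, real_inner_comm]
  simp [mul_comm]

/-- A kernel vector of the Gram matrix has an image under `dX` that is orthogonal to the whole
range, in particular to itself. -/
theorem isUnit_gram {n m : ℕ} {X : 𝔼 n → 𝔼 m} {y : 𝔼 n}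
    (h : Function.Injective (fderiv ℝ X y)) : IsUnit (gram X y) := by
  rw [← Matrix.mulVec_injective_iff_isUnit]
  refine (injective_iff_map_eq_zero (Matrix.mulVecLin (gram X y))).2 fun c hc => ?_
  have h1 : ∀ l, ⟪fderiv ℝ X y (WithLp.toLp 2 c), fderiv ℝ X y (coordVec l)⟫ = 0 := fun l => by
    rw [← gram_mulVec]
    exact congrFun hc l
  have h2 : ⟪fderiv ℝ X y (WithLp.toLp 2 c), fderiv ℝ X y (WithLp.toLp 2 c)⟫ = 0 := by
    nth_rewrite 1 [map_eq_sum_coordVec (fderiv ℝ X y)]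
    rw [sum_inner]
    refine Finset.sum_eq_zero fun k _ => ?_
    rw [inner_smul_left, real_inner_comm, h1, mul_zero]
  have h3 := h ((inner_self_eq_zero.1 h2).trans (map_zero _).symm)
  exact congrArg WithLp.ofLp h3

namespace NormalData

variable {X : 𝔼 3 → 𝔼 4} {V : Set (𝔼 3)} {N : 𝔼 3 → 𝔼 4} {L : 𝔼 3 → 𝔼 4 →L[ℝ] 𝔼 3} {y : 𝔼 3}

theorem pderiv_gram (h : NormalData X V N L) (hy : y ∈ V) (i j l : Fin 3) :
    pderiv i (fun z => gram X z j l) y =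
      ⟪hess X y (coordVec i) (coordVec j), fderiv ℝ X y (coordVec l)⟫
        + ⟪fderiv ℝ X y (coordVec j), hess X y (coordVec i) (coordVec l)⟫ := by
  have h1 := fderiv_inner_apply ℝ (h.differentiableAt_fderiv hy (coordVec j))
    (h.differentiableAt_fderiv hy (coordVec l)) (coordVec i)
  unfold pderiv hess
  simp only [gram_eq]
  rw [h1]
  ring

/-- The tangential component of the second derivative, in coordinates. -/
def christoffelVec (X : 𝔼 3 → 𝔼 4) (N : 𝔼 3 → 𝔼 4) (L : 𝔼 3 → 𝔼 4 →L[ℝ] 𝔼 3) (i j : Fin 3)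
    (z : 𝔼 3) : 𝔼 3 :=
  L z (hess X z (coordVec i) (coordVec j) - ⟪hess X z (coordVec i) (coordVec j), N z⟫ • N z)

theorem hess_decomp (h : NormalData X V N L) (hy : y ∈ V) (i j : Fin 3) :
    hess X y (coordVec i) (coordVec j) = fderiv ℝ X y (christoffelVec X N L i j y)
      + ⟪hess X y (coordVec i) (coordVec j), N y⟫ • N y := by
  unfold christoffelVec
  rw [h.map_left hy, sub_add_cancel]
  rw [inner_sub_left, inner_smul_left, real_inner_self_eq_norm_sq, h.norm_normal y hy]
  simp

/-- The Koszul combination of derivatives of the metric is `2 ⟪∂_i ∂_j X, ∂_l X⟫`, in which only the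
tangential part of the second derivative counts. The inverse Gram matrix then extracts its
coordinates. -/
theorem christoffel_eq (h : NormalData X V N L) (hy : y ∈ V) (k i j : Fin 3) :
    christoffel X k i j y = christoffelVec X N L i j y k := by
  have hs := fun i j => hess_symm (h.smooth y hy) (coordVec i) (coordVec j)
  have h1 : ∀ l, pderiv i (fun z => gram X z j l) y + pderiv j (fun z => gram X z i l) y
      - pderiv l (fun z => gram X z i j) y
      = 2 * ∑ k, gram X y l k * christoffelVec X N L i j y k := by
    intro l
    rw [gram_mulVec, h.pderiv_gram hy, h.pderiv_gram hy, h.pderiv_gram hy, hs j i, hs l i, hs l j]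
    have h2 := congrArg (fun u => ⟪u, fderiv ℝ X y (coordVec l)⟫) (h.hess_decomp hy i j)
    simp only [inner_add_left, inner_smul_left] at h2
    rw [real_inner_comm (fderiv ℝ X y (coordVec l)) (N y), h.inner_normal y hy, mul_zero,
      add_zero] at h2
    rw [← h2, real_inner_comm (hess X y (coordVec i) (coordVec l)),
      real_inner_comm (hess X y (coordVec j) (coordVec l))]
    ring
  unfold christoffel
  simp only [h1]
  have h2 : (gram X y)⁻¹.mulVec ((gram X y).mulVec (christoffelVec X N L i j y)) k
      = christoffelVec X N L i j y k := by
    rw [Matrix.mulVec_mulVec, Matrix.nonsing_inv_mul _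
      ((Matrix.isUnit_iff_isUnit_det _).1 (isUnit_gram (h.injective hy))), Matrix.one_mulVec]
  rw [← h2]
  simp only [Matrix.mulVec, dotProduct]
  rw [Finset.mul_sum]
  refine Finset.sum_congr rfl fun l _ => ?_
  ring

theorem smooth_hess (h : NormalData X V N L) (hy : y ∈ V) (v w : 𝔼 3) :
    ContDiffAt ℝ ∞ (fun z => hess X z v w) y :=
  ((h.smooth_fderiv hy w).fderiv_right (by simp)).clm_apply contDiffAt_const

theorem smooth_christoffelVec (h : NormalData X V N L) (hy : y ∈ V) (i j : Fin 3) :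
    ContDiffAt ℝ ∞ (christoffelVec X N L i j) y :=
  (h.smooth_left y hy).clm_apply ((h.smooth_hess hy _ _).sub
    (((h.smooth_hess hy _ _).inner ℝ (h.smooth_normal y hy)).smul (h.smooth_normal y hy)))

theorem pderiv_christoffel (h : NormalData X V N L) (hy : y ∈ V) (i l j k : Fin 3) :
    pderiv i (christoffel X l j k) y
      = fderiv ℝ (christoffelVec X N L j k) y (coordVec i) l := by
  have h1 : christoffel X l j k =ᶠ[𝓝 y] fun z => christoffelVec X N L j k z l := by
    filter_upwards [h.isOpen.mem_nhds hy] with z hz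
    exact h.christoffel_eq hz l j k
  unfold pderiv
  rw [h1.fderiv_eq]
  have h2 := ((EuclideanSpace.proj l : 𝔼 3 →L[ℝ] ℝ).hasFDerivAt.comp y
    ((h.smooth_christoffelVec hy j k).differentiableAt (by simp)).hasFDerivAt).fderiv
  exact congrArg (fun A : 𝔼 3 →L[ℝ] ℝ => A (coordVec i)) h2

/-- The coordinate components of the second fundamental form with respect to `N`. -/
def coordSFF (X : 𝔼 3 → 𝔼 4) (N : 𝔼 3 → 𝔼 4) (i j : Fin 3) (z : 𝔼 3) : ℝ :=
  ⟪hess X z (coordVec i) (coordVec j), N z⟫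

/-- Differentiate the Gauss formula `∂_j ∂_k X = dX (Γ_jk) + B_jk N` and keep the tangential part.
The quadratic term in `B` comes from the derivative of `N`, and expanding `∂_i dX (Γ_jk)` by the
same formula gives the quadratic term in `Γ`. -/
theorem inner_third_deriv (h : NormalData X V N L) (hy : y ∈ V) (i j k q : Fin 3) :
    ⟪fderiv ℝ (fun z => hess X z (coordVec j) (coordVec k)) y (coordVec i),
        fderiv ℝ X y (coordVec q)⟫
      = ⟪fderiv ℝ X y (fderiv ℝ (christoffelVec X N L j k) y (coordVec i)
          + ∑ p, christoffelVec X N L j k y p • christoffelVec X N L i p y),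
          fderiv ℝ X y (coordVec q)⟫
        - coordSFF X N j k y * coordSFF X N i q y := by
  have hΓ : DifferentiableAt ℝ (christoffelVec X N L j k) y :=
    (h.smooth_christoffelVec hy j k).differentiableAt (by simp)
  have hDX : DifferentiableAt ℝ (fderiv ℝ X) y :=
    ((h.smooth y hy).fderiv_right (m := ∞) (by simp)).differentiableAt (by simp)
  have hB : DifferentiableAt ℝ (coordSFF X N j k) y :=
    ((h.smooth_hess hy _ _).inner ℝ (h.smooth_normal y hy)).differentiableAt (by simp)
  have h1 : (fun z => hess X z (coordVec j) (coordVec k)) =ᶠ[𝓝 y]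
      fun z => fderiv ℝ X z (christoffelVec X N L j k z) + coordSFF X N j k z • N z := by
    filter_upwards [h.isOpen.mem_nhds hy] with z hz
    exact h.hess_decomp hz j k
  have h2 := (hDX.hasFDerivAt.clm_apply hΓ.hasFDerivAt).add
    (hB.hasFDerivAt.smul (h.differentiableAt_normal hy).hasFDerivAt)
  have h3 := congrArg (fun A : 𝔼 3 →L[ℝ] 𝔼 4 => A (coordVec i)) (h1.fderiv_eq.trans h2.fderiv)
  simp only [add_apply, ContinuousLinearMap.coe_comp, Function.comp_apply,
    ContinuousLinearMap.flip_apply, smul_apply,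
    ContinuousLinearMap.smulRight_apply] at h3
  have h4 : fderiv ℝ (fderiv ℝ X) y (coordVec i) (christoffelVec X N L j k y)
      = ∑ p, christoffelVec X N L j k y p • (fderiv ℝ X y (christoffelVec X N L i p y)
        + coordSFF X N i p y • N y) := by
    rw [map_eq_sum_coordVec]
    refine Finset.sum_congr rfl fun p _ => ?_
    rw [← hess_eq (h.smooth y hy), h.hess_decomp hy i p]
    rfl
  have h5 : ⟪N y, fderiv ℝ X y (coordVec q)⟫ = 0 := by
    rw [real_inner_comm]; exact h.inner_normal y hy _
  rw [h3, h4]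
  simp only [inner_add_left, map_add, map_sum, map_smul, inner_smul_left, sum_inner, h5,
    h.inner_fderiv_normal hy, smul_add, mul_zero, add_zero]
  simp only [coordSFF, RCLike.conj_to_real]
  ring

/-- Antisymmetrize the third derivatives of `X` in `i` and `j`: the left sides of
`inner_third_deriv` cancel, leaving the Riemann tensor against the quadratic terms in the second
fundamental form. -/
theorem riemann_gram (h : NormalData X V N L) (hy : y ∈ V) (i j k q : Fin 3) :
    ∑ l, riemann X l k i j y * gram X y l q
      = coordSFF X N j k y * coordSFF X N i q y - coordSFF X N i k y * coordSFF X N j q y := by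
  set R : 𝔼 3 := (fderiv ℝ (christoffelVec X N L j k) y (coordVec i)
          + ∑ p, christoffelVec X N L j k y p • christoffelVec X N L i p y)
        - (fderiv ℝ (christoffelVec X N L i k) y (coordVec j)
          + ∑ p, christoffelVec X N L i k y p • christoffelVec X N L j p y) with hR
  have h1 : ∀ l, riemann X l k i j y = R l := by
    intro l
    unfold riemann
    rw [h.pderiv_christoffel hy, h.pderiv_christoffel hy, Finset.sum_sub_distrib]
    simp only [h.christoffel_eq hy, hR, PiLp.sub_apply, PiLp.add_apply, WithLp.ofLp_sum,
      Finset.sum_apply, PiLp.smul_apply, smul_eq_mul]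
    simp only [mul_comm]
    ring
  have h2 : ∑ l, riemann X l k i j y * gram X y l q
      = ⟪fderiv ℝ X y R, fderiv ℝ X y (coordVec q)⟫ := by
    rw [← gram_mulVec]
    refine Finset.sum_congr rfl fun l _ => ?_
    rw [h1, gram_eq, gram_eq, real_inner_comm, mul_comm]
  have h3 : fderiv ℝ (fun z => hess X z (coordVec j) (coordVec k)) y (coordVec i)
      = fderiv ℝ (fun z => hess X z (coordVec i) (coordVec k)) y (coordVec j) :=
    hess_symm (h.smooth_fderiv hy (coordVec k)) (coordVec i) (coordVec j)
  have h4 := h.inner_third_deriv hy i j k q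
  have h5 := h.inner_third_deriv hy j i k q
  rw [h3] at h4
  rw [h2, hR, map_sub, inner_sub_left]
  linarith

theorem inner_hess_eq_sum (h : NormalData X V N L) (hy : y ∈ V) (u v : 𝔼 3) :
    ⟪hess X y u v, N y⟫ = ∑ i, ∑ j, u i * v j * coordSFF X N i j y := by
  have h1 : hess X y u v = ∑ i, ∑ j, (u i * v j) • hess X y (coordVec i) (coordVec j) := by
    simp only [hess_eq (h.smooth y hy)]
    rw [map_eq_sum_coordVec (fderiv ℝ (fderiv ℝ X) y) u, sum_apply]
    refine Finset.sum_congr rfl fun i _ => ?_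
    rw [smul_apply, map_eq_sum_coordVec _ v, Finset.smul_sum]
    simp only [smul_smul]
  rw [h1]
  simp only [sum_inner, inner_smul_left, coordSFF, RCLike.conj_to_real]

/-- The **Gauss equation**. -/
theorem curvature_eq (h : NormalData X V N L) (hy : y ∈ V) (u v w z : 𝔼 3) :
    curvature X y u v w z = ⟪hess X y v w, N y⟫ * ⟪hess X y u z, N y⟫
      - ⟪hess X y u w, N y⟫ * ⟪hess X y v z, N y⟫ := by
  have h1 : curvature X y u v w z = ∑ i, ∑ j, ∑ k, ∑ q, u i * v j * w k * z q *
      (coordSFF X N j k y * coordSFF X N i q y - coordSFF X N i k y * coordSFF X N j q y) := by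
    unfold curvature
    refine Finset.sum_congr rfl fun i _ => Finset.sum_congr rfl fun j _ =>
      Finset.sum_congr rfl fun k _ => ?_
    rw [Finset.sum_comm]
    refine Finset.sum_congr rfl fun q _ => ?_
    rw [← h.riemann_gram hy, Finset.mul_sum]
    refine Finset.sum_congr rfl fun l _ => ?_
    ring
  rw [h1]
  simp only [h.inner_hess_eq_sum hy, Fin.sum_univ_three]
  ring

end NormalData

/-! ### The shape operator of a Casorati ideal hypersurface -/

theorem exists_ne_zero_of_two_functionals (α β : 𝔼 3 →ₗ[ℝ] ℝ) : ∃ u ≠ 0, α u = 0 ∧ β u = 0 := by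
  have h : LinearMap.ker (α.prod β) ≠ ⊥ := LinearMap.ker_ne_bot_of_finrank_lt (by simp)
  obtain ⟨u, hu, hu0⟩ := Submodule.exists_mem_ne_zero_of_ne_bot h
  rw [LinearMap.mem_ker, LinearMap.prod_apply] at hu
  exact ⟨u, hu0, congrArg Prod.fst hu, congrArg Prod.snd hu⟩

theorem exists_unit_of_two_orthogonal {D : 𝔼 3 →L[ℝ] 𝔼 4} (hD : Function.Injective D)
    (a b : 𝔼 4) : ∃ u, ‖D u‖ = 1 ∧ ⟪D u, a⟫ = 0 ∧ ⟪D u, b⟫ = 0 := by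
  obtain ⟨u, hu0, ha, hb⟩ := exists_ne_zero_of_two_functionals
    ((innerSL ℝ a).toLinearMap ∘ₗ D.toLinearMap) ((innerSL ℝ b).toLinearMap ∘ₗ D.toLinearMap)
  have hDu : D u ≠ 0 := fun h => hu0 (hD (h.trans (map_zero D).symm))
  have ha' : ⟪a, D u⟫ = 0 := ha
  have hb' : ⟪b, D u⟫ = 0 := hb
  refine ⟨‖D u‖⁻¹ • u, ?_, ?_, ?_⟩
  · rw [map_smul]; exact norm_smul_inv_norm hDu
  · rw [map_smul, inner_smul_left, real_inner_comm, ha', mul_zero]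
  · rw [map_smul, inner_smul_left, real_inner_comm, hb', mul_zero]

theorem eq_sum_of_orthonormal {D : 𝔼 3 →L[ℝ] 𝔼 4} {e : Fin 3 → 𝔼 3}
    (he : Orthonormal ℝ fun i => D (e i)) (v : 𝔼 3) : ∃ a : Fin 3 → ℝ, v = ∑ i, a i • e i := by
  have hli : LinearIndependent ℝ e := LinearIndependent.of_comp D.toLinearMap he.linearIndependent
  let b := basisOfLinearIndependentOfCardEqFinrank hli (by simp)
  refine ⟨fun i => b.repr v i, ?_⟩
  have := b.sum_repr v
  simpa [b] using this.symm

/-- `p, q, r` are the diagonal and `s, t, u` the off-diagonal entries of `h` in a frame adapted to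
the minimizing plane. The sum of squares is three times the difference of the two sides. -/
theorem quadratic_equality {p q r s t u : ℝ}
    (h : 1 / 3 * ((p * q - s ^ 2) + (p * r - t ^ 2) + (q * r - u ^ 2))
      = 1 / 2 * (1 / 3 * (p ^ 2 + q ^ 2 + r ^ 2 + 2 * s ^ 2 + 2 * t ^ 2 + 2 * u ^ 2))
        + 2 / 3 * (1 / 2 * (p ^ 2 + q ^ 2 + 2 * s ^ 2))) :
    q = p ∧ r = 2 * p ∧ s = 0 ∧ t = 0 ∧ u = 0 := by
  have h1 : 1 / 2 * (r - p - q) ^ 2 + (p - q) ^ 2 + 4 * s ^ 2 + 2 * t ^ 2 + 2 * u ^ 2 = 0 := by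
    linear_combination -3 * h
  have hs : s = 0 := by
    refine pow_eq_zero_iff (n := 2) (by norm_num) |>.1 ?_
    nlinarith [sq_nonneg (r - p - q), sq_nonneg (p - q), sq_nonneg s, sq_nonneg t, sq_nonneg u]
  have ht : t = 0 := by
    refine pow_eq_zero_iff (n := 2) (by norm_num) |>.1 ?_
    nlinarith [sq_nonneg (r - p - q), sq_nonneg (p - q), sq_nonneg s, sq_nonneg t, sq_nonneg u]
  have hu : u = 0 := by
    refine pow_eq_zero_iff (n := 2) (by norm_num) |>.1 ?_
    nlinarith [sq_nonneg (r - p - q), sq_nonneg (p - q), sq_nonneg s, sq_nonneg t, sq_nonneg u]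
  have hpq : p - q = 0 := by
    refine pow_eq_zero_iff (n := 2) (by norm_num) |>.1 ?_
    nlinarith [sq_nonneg (r - p - q), sq_nonneg (p - q), sq_nonneg s, sq_nonneg t, sq_nonneg u]
  have hr : r - p - q = 0 := by
    refine pow_eq_zero_iff (n := 2) (by norm_num) |>.1 ?_
    nlinarith [sq_nonneg (r - p - q), sq_nonneg (p - q), sq_nonneg s, sq_nonneg t, sq_nonneg u]
  exact ⟨by linarith, by linarith, hs, ht, hu⟩

namespace NormalData

variable {X : 𝔼 3 → 𝔼 4} {V : Set (𝔼 3)} {N : 𝔼 3 → 𝔼 4} {L : 𝔼 3 → 𝔼 4 →L[ℝ] 𝔼 3} {y : 𝔼 3}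

theorem norm_secondFF_sq (h : NormalData X V N L) (hy : y ∈ V) (v w : 𝔼 3) :
    ‖secondFF X y v w‖ ^ 2 = ⟪hess X y v w, N y⟫ ^ 2 := by
  rw [h.secondFF_eq hy, norm_smul, h.norm_normal y hy, mul_one, Real.norm_eq_abs, sq_abs]

theorem sectionalCurvature_eq (h : NormalData X V N L) (hy : y ∈ V) {u v : 𝔼 3}
    (huu : metric X y u u = 1) (hvv : metric X y v v = 1) (huv : metric X y u v = 0) :
    sectionalCurvature X y u v
      = ⟪hess X y u u, N y⟫ * ⟪hess X y v v, N y⟫ - ⟪hess X y u v, N y⟫ ^ 2 := by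
  unfold sectionalCurvature
  rw [h.curvature_eq hy, huu, hvv, huv, hess_symm (h.smooth y hy) v u]
  ring

theorem isCompact_frames (h : NormalData X V N L) (hy : y ∈ V) :
    IsCompact {f : Fin 2 → 𝔼 3 | IsOrthonormalFamily X y f} := by
  refine Metric.isCompact_of_isClosed_isBounded ?_ ?_
  · have : {f : Fin 2 → 𝔼 3 | IsOrthonormalFamily X y f} = ⋂ i, ⋂ j,
        {f | ⟪fderiv ℝ X y (f i), fderiv ℝ X y (f j)⟫ = if i = j then (1 : ℝ) else 0} := by
      ext f
      simp only [mem_ofPred_eq, mem_iInter, IsOrthonormalFamily, orthonormal_iff_ite]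
    rw [this]
    refine isClosed_iInter fun i => isClosed_iInter fun j => ?_
    exact isClosed_eq (by fun_prop) continuous_const
  · refine (Metric.isBounded_closedBall (x := (0 : Fin 2 → 𝔼 3)) (r := ‖L y‖)).subset ?_
    intro f hf
    rw [mem_closedBall_zero_iff, pi_norm_le_iff_of_nonneg (norm_nonneg _)]
    intro i
    rw [← h.left_inv y hy (f i)]
    refine ((L y).le_opNorm _).trans ?_
    rw [hf.1 i, mul_one]

theorem continuous_casorati (h : NormalData X V N L) (hy : y ∈ V) :
    Continuous fun f : Fin 2 → 𝔼 3 => casorati X y f := by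
  unfold casorati
  simp only [h.norm_secondFF_sq hy, hess_eq (h.smooth y hy)]
  fun_prop

theorem exists_frame (h : NormalData X V N L) (hy : y ∈ V) (f : Fin 2 → 𝔼 3)
    (hf : IsOrthonormalFamily X y f) :
    ∃ η, IsOrthonormalFamily X y ![f 0, f 1, η] := by
  obtain ⟨η, h1, h2, h3⟩ := exists_unit_of_two_orthogonal (h.injective hy)
    (fderiv ℝ X y (f 0)) (fderiv ℝ X y (f 1))
  have h01 : ⟪fderiv ℝ X y (f 0), fderiv ℝ X y (f 1)⟫ = 0 := hf.2 (by simp)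
  have h0 := hf.1 0
  have h1' := hf.1 1
  refine ⟨η, ?_, ?_⟩
  · intro i; fin_cases i
    · exact h0
    · exact h1'
    · exact h1
  · intro i j hij
    fin_cases i <;> fin_cases j <;>
      first
      | exact absurd rfl hij
      | exact h01
      | exact h2
      | exact h3
      | (rw [real_inner_comm]; first | exact h01 | exact h2 | exact h3)

theorem exists_frame_two (h : NormalData X V N L) (hy : y ∈ V) :
    ∃ f : Fin 2 → 𝔼 3, IsOrthonormalFamily X y f := by
  obtain ⟨u, hu, -, -⟩ := exists_unit_of_two_orthogonal (h.injective hy) 0 0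
  obtain ⟨v, hv, hvu, -⟩ := exists_unit_of_two_orthogonal (h.injective hy) (fderiv ℝ X y u) 0
  refine ⟨![u, v], ?_, ?_⟩
  · intro i; fin_cases i
    · exact hu
    · exact hv
  · intro i j hij
    fin_cases i <;> fin_cases j <;>
      first
      | exact absurd rfl hij
      | exact hvu
      | (rw [real_inner_comm]; exact hvu)

/-- If equality holds in the Casorati inequality, then the principal curvatures are `l, l, 2 l`. -/
theorem exists_frame_of_ideal (h : NormalData X V N L) (hy : y ∈ V)
    (hid : ∀ e : Fin 3 → 𝔼 3, IsOrthonormalFamily X y e →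
      normalizedScalarCurvature X y e = deltaCasorati X y e) :
    ∃ l : ℝ, ∃ e : Fin 3 → 𝔼 3, IsOrthonormalFamily X y e ∧ ∀ i j,
      ⟪hess X y (e i) (e j), N y⟫ = if i = j then (if i = 2 then 2 * l else l) else 0 := by
  -- The infimum in `δ_C(2)` is attained because the orthonormal 2-frames form a compact set. The
  -- frame is adapted to a minimizing plane, so the equality involves only the entries of `h` in
  -- that one frame.
  obtain ⟨f, hf, hmin⟩ := (h.isCompact_frames hy).exists_isMinOn (h.exists_frame_two hy)
    (h.continuous_casorati hy).continuousOn
  obtain ⟨η, he⟩ := h.exists_frame hy f hf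
  set e : Fin 3 → 𝔼 3 := ![f 0, f 1, η] with hedef
  have hInf : sInf {c | ∃ f : Fin (3 - 1) → 𝔼 3, IsOrthonormalFamily X y f ∧ c = casorati X y f}
      = casorati X y f := by
    refine IsLeast.csInf_eq ⟨⟨f, hf, rfl⟩, ?_⟩
    rintro c ⟨g, hg, rfl⟩
    exact hmin hg
  have hmet : ∀ i j, metric X y (e i) (e j) = if i = j then 1 else 0 := by
    intro i j
    exact orthonormal_iff_ite.1 he i j
  have hs := fun i j => hess_symm (h.smooth y hy) (e i) (e j)
  have hK : ∀ i j, i ≠ j → sectionalCurvature X y (e i) (e j)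
      = ⟪hess X y (e i) (e i), N y⟫ * ⟪hess X y (e j) (e j), N y⟫
        - ⟪hess X y (e i) (e j), N y⟫ ^ 2 := fun i j hij =>
    h.sectionalCurvature_eq hy (by simp [hmet]) (by simp [hmet]) (by simp [hmet, hij])
  have heq := hid e he
  have h1 : normalizedScalarCurvature X y e = 1 / 3 * (sectionalCurvature X y (e 0) (e 1)
      + sectionalCurvature X y (e 0) (e 2) + sectionalCurvature X y (e 1) (e 2)) := by
    unfold normalizedScalarCurvature
    simp only [Finset.sum_filter, Fin.sum_univ_three]
    norm_num [Fin.lt_def]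
  have h2 : casorati X y f = 1 / 2 * (⟪hess X y (e 0) (e 0), N y⟫ ^ 2
      + ⟪hess X y (e 1) (e 1), N y⟫ ^ 2 + 2 * ⟪hess X y (e 0) (e 1), N y⟫ ^ 2) := by
    unfold casorati
    simp only [Fin.sum_univ_two, h.norm_secondFF_sq hy]
    rw [hess_symm (h.smooth y hy) (f 1) (f 0)]
    change 1 / ((2 : ℕ) : ℝ) * _ = 1 / 2 * (⟪hess X y (f 0) (f 0), N y⟫ ^ 2
      + ⟪hess X y (f 1) (f 1), N y⟫ ^ 2 + 2 * ⟪hess X y (f 0) (f 1), N y⟫ ^ 2)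
    push_cast
    ring
  have h3 : casorati X y e = 1 / 3 * (⟪hess X y (e 0) (e 0), N y⟫ ^ 2
      + ⟪hess X y (e 1) (e 1), N y⟫ ^ 2 + ⟪hess X y (e 2) (e 2), N y⟫ ^ 2
      + 2 * ⟪hess X y (e 0) (e 1), N y⟫ ^ 2 + 2 * ⟪hess X y (e 0) (e 2), N y⟫ ^ 2
      + 2 * ⟪hess X y (e 1) (e 2), N y⟫ ^ 2) := by
    unfold casorati
    simp only [Fin.sum_univ_three, h.norm_secondFF_sq hy, hs 1 0, hs 2 0, hs 2 1]
    push_cast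
    ring
  unfold deltaCasorati at heq
  rw [hInf, h1, h2, h3, hK 0 1 (by decide), hK 0 2 (by decide), hK 1 2 (by decide)] at heq
  obtain ⟨q1, q2, q3, q4, q5⟩ := quadratic_equality (by rw [heq]; push_cast; ring)
  refine ⟨⟪hess X y (e 0) (e 0), N y⟫, e, he, fun i j => ?_⟩
  fin_cases i <;> fin_cases j
  · rfl
  · exact q3
  · exact q4
  · exact (congrArg (⟪·, N y⟫) (hs 1 0)).trans q3
  · exact q1
  · exact q5
  · exact (congrArg (⟪·, N y⟫) (hs 2 0)).trans q4
  · exact (congrArg (⟪·, N y⟫) (hs 2 1)).trans q5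
  · exact q2

theorem exists_shape_of_ideal (h : NormalData X V N L) (hy : y ∈ V)
    (hid : ∀ e : Fin 3 → 𝔼 3, IsOrthonormalFamily X y e →
      normalizedScalarCurvature X y e = deltaCasorati X y e) :
    ∃ l : ℝ, ∃ η : 𝔼 3, ‖fderiv ℝ X y η‖ = 1 ∧ ∀ v, fderiv ℝ N y v
      = -l • (fderiv ℝ X y v + ⟪fderiv ℝ X y v, fderiv ℝ X y η⟫ • fderiv ℝ X y η) := by
  obtain ⟨l, e, he, hB⟩ := h.exists_frame_of_ideal hy hid
  refine ⟨l, e 2, he.1 2, fun v => ?_⟩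
  have hon := orthonormal_iff_ite.1 he
  obtain ⟨a, ha⟩ := eq_sum_of_orthonormal he v
  have hv : ∀ j, ⟪fderiv ℝ X y v, fderiv ℝ X y (e j)⟫ = a j := by
    intro j
    rw [ha]
    simp [map_sum, sum_inner, inner_smul_left, hon]
  have hBv : ∀ j, ⟪hess X y v (e j), N y⟫ = a j * if j = 2 then 2 * l else l := by
    intro j
    rw [ha, hess_eq (h.smooth y hy)]
    simp only [map_sum, map_smul, sum_apply, smul_apply, sum_inner,
      inner_smul_left, ← hess_eq (h.smooth y hy), hB]
    simp
  have hz : ∀ j, ⟪fderiv ℝ N y v + l • (fderiv ℝ X y v + ⟪fderiv ℝ X y v, fderiv ℝ X y (e 2)⟫ •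
      fderiv ℝ X y (e 2)), fderiv ℝ X y (e j)⟫ = 0 := by
    intro j
    simp only [inner_add_left, inner_smul_left, h.inner_fderiv_normal hy, hBv, hv, hon]
    fin_cases j <;> simp <;> ring
  have hzN : ⟪fderiv ℝ N y v + l • (fderiv ℝ X y v + ⟪fderiv ℝ X y v, fderiv ℝ X y (e 2)⟫ •
      fderiv ℝ X y (e 2)), N y⟫ = 0 := by
    simp only [inner_add_left, inner_smul_left, h.inner_fderiv_normal_self hy,
      h.inner_normal y hy]
    simp
  -- The difference of the two sides is orthogonal to `N`, hence tangent, and orthogonal to every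
  -- frame vector, so it is orthogonal to itself.
  have hw := h.map_left hy hzN
  obtain ⟨b, hb⟩ := eq_sum_of_orthonormal he (L y (fderiv ℝ N y v + l • (fderiv ℝ X y v +
    ⟪fderiv ℝ X y v, fderiv ℝ X y (e 2)⟫ • fderiv ℝ X y (e 2))))
  have h0 : ⟪fderiv ℝ N y v + l • (fderiv ℝ X y v + ⟪fderiv ℝ X y v, fderiv ℝ X y (e 2)⟫ •
      fderiv ℝ X y (e 2)), fderiv ℝ N y v + l • (fderiv ℝ X y v +
      ⟪fderiv ℝ X y v, fderiv ℝ X y (e 2)⟫ • fderiv ℝ X y (e 2))⟫ = 0 := by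
    nth_rewrite 2 [← hw]
    rw [hb]
    simp only [map_sum, map_smul, inner_sum, inner_smul_right, hz, mul_zero,
      Finset.sum_const_zero]
  rw [neg_smul]
  exact eq_neg_of_add_eq_zero_left (inner_self_eq_zero.1 h0)

end NormalData

/-! ### The structure equations where the second fundamental form does not vanish -/

/-- A quarter of the mean curvature: the double principal curvature of an ideal hypersurface. -/
def shapeLam (N : 𝔼 3 → 𝔼 4) (L : 𝔼 3 → 𝔼 4 →L[ℝ] 𝔼 3) (y : 𝔼 3) : ℝ :=
  -(1 / 4) * LinearMap.trace ℝ (𝔼 3) ((L y).comp (fderiv ℝ N y)).toLinearMap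

/-- The structure of an ideal hypersurface where `h ≠ 0`: the principal curvatures are `lam`, `lam`
and `2 * lam > 0`, and `η` is a unit principal vector field for `2 * lam`. -/
structure ShapeData (X : 𝔼 3 → 𝔼 4) (V : Set (𝔼 3)) (N : 𝔼 3 → 𝔼 4) (L : 𝔼 3 → 𝔼 4 →L[ℝ] 𝔼 3)
    (lam : 𝔼 3 → ℝ) (η : 𝔼 3 → 𝔼 3) : Prop extends NormalData X V N L where
  smooth_lam : ∀ y ∈ V, ContDiffAt ℝ ∞ lam y
  smooth_eta : ∀ y ∈ V, ContDiffAt ℝ ∞ η y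
  lam_pos : ∀ y ∈ V, 0 < lam y
  norm_eta : ∀ y ∈ V, ‖fderiv ℝ X y (η y)‖ = 1
  shape : ∀ y ∈ V, ∀ v, fderiv ℝ N y v = -lam y • (fderiv ℝ X y v
    + ⟪fderiv ℝ X y v, fderiv ℝ X y (η y)⟫ • fderiv ℝ X y (η y))

namespace NormalData

variable {X : 𝔼 3 → 𝔼 4} {V : Set (𝔼 3)} {N : 𝔼 3 → 𝔼 4} {L : 𝔼 3 → 𝔼 4 →L[ℝ] 𝔼 3} {y : 𝔼 3}

theorem smooth_shapeLam (h : NormalData X V N L) (hy : y ∈ V) :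
    ContDiffAt ℝ ∞ (shapeLam N L) y := by
  let T : (𝔼 3 →L[ℝ] 𝔼 3) →L[ℝ] ℝ := LinearMap.toContinuousLinearMap
    ((LinearMap.trace ℝ (𝔼 3)) ∘ₗ (ContinuousLinearMap.coeLM ℝ))
  have h1 : ContDiffAt ℝ ∞ (fun z => T ((L z).comp (fderiv ℝ N z))) y :=
    T.contDiff.contDiffAt.comp y
      ((h.smooth_left y hy).clm_comp ((h.smooth_normal y hy).fderiv_right (by simp)))
  exact contDiffAt_const.mul h1

theorem left_normal_eq (h : NormalData X V N L) (hy : y ∈ V) {l : ℝ} {η : 𝔼 3}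
    (hs : ∀ v, fderiv ℝ N y v
      = -l • (fderiv ℝ X y v + ⟪fderiv ℝ X y v, fderiv ℝ X y η⟫ • fderiv ℝ X y η)) (v : 𝔼 3) :
    L y (fderiv ℝ N y v) = -l • (v + ⟪fderiv ℝ X y v, fderiv ℝ X y η⟫ • η) := by
  rw [hs, map_smul, map_add, map_smul, h.left_inv y hy, h.left_inv y hy]

/-- The trace of `-l (id + θ ⊗ η)` is `-l (3 + 1)`. Thus the pointwise eigenvalue is given by a
formula that is smooth also where it vanishes. -/
theorem shapeLam_eq (h : NormalData X V N L) (hy : y ∈ V) {l : ℝ} {η : 𝔼 3}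
    (hη : ‖fderiv ℝ X y η‖ = 1) (hs : ∀ v, fderiv ℝ N y v
      = -l • (fderiv ℝ X y v + ⟪fderiv ℝ X y v, fderiv ℝ X y η⟫ • fderiv ℝ X y η)) :
    shapeLam N L y = l := by
  let θ : 𝔼 3 →ₗ[ℝ] ℝ := (innerSL ℝ (fderiv ℝ X y η)).toLinearMap ∘ₗ (fderiv ℝ X y).toLinearMap
  have h1 : ((L y).comp (fderiv ℝ N y)).toLinearMap
      = -l • (LinearMap.id + θ.smulRight η) := by
    refine LinearMap.ext fun v => ?_
    change L y (fderiv ℝ N y v) = -l • (v + ⟪fderiv ℝ X y η, fderiv ℝ X y v⟫ • η)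
    rw [h.left_normal_eq hy hs, real_inner_comm]
  have h2 : θ η = 1 := by
    change ⟪fderiv ℝ X y η, fderiv ℝ X y η⟫ = 1
    rw [real_inner_self_eq_norm_sq, hη, one_pow]
  unfold shapeLam
  rw [h1, map_smul, map_add, LinearMap.trace_id, LinearMap.trace_smulRight, h2,
    finrank_euclideanSpace_fin, smul_eq_mul]
  push_cast
  ring

theorem exists_shapeData (h : NormalData X V N L)
    (hid : ∀ y ∈ V, ∀ e : Fin 3 → 𝔼 3, IsOrthonormalFamily X y e →
      normalizedScalarCurvature X y e = deltaCasorati X y e) {y₀ : 𝔼 3} (hy₀ : y₀ ∈ V)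
    (hpos : 0 < shapeLam N L y₀) :
    ∃ V' ⊆ V, y₀ ∈ V' ∧ ∃ η, ShapeData X V' N L (shapeLam N L) η := by
  obtain ⟨l₀, η₀, hη₀, hs₀⟩ := h.exists_shape_of_ideal hy₀ (hid y₀ hy₀)
  -- With the shape operator `A = -L ∘ dN`, this is `(A - lam) η₀` for a fixed vector `η₀`. As `A -
  -- lam` is `lam` times the projection to the `2 lam`-direction, it gives a smooth field in that
  -- direction, nonzero near `y₀`, without an appeal to smoothness of eigenvectors.
  let w : 𝔼 3 → 𝔼 3 := fun y => -(L y (fderiv ℝ N y η₀)) - shapeLam N L y • η₀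
  have hws : ∀ y ∈ V, ContDiffAt ℝ ∞ w y := fun y hy =>
    (((h.smooth_left y hy).clm_apply
      (((h.smooth_normal y hy).fderiv_right (by simp)).clm_apply contDiffAt_const)).neg).sub
      ((h.smooth_shapeLam hy).smul contDiffAt_const)
  have hw : ∀ y ∈ V, ∀ l η', shapeLam N L y = l → (∀ v, fderiv ℝ N y v
      = -l • (fderiv ℝ X y v + ⟪fderiv ℝ X y v, fderiv ℝ X y η'⟫ • fderiv ℝ X y η')) →
      w y = (l * ⟪fderiv ℝ X y η₀, fderiv ℝ X y η'⟫) • η' := by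
    intro y hy l η' hl hs
    simp only [w]
    rw [hl, h.left_normal_eq hy hs]
    module
  let V₁ := V ∩ {y | 0 < shapeLam N L y}
  have hV₁ : IsOpen V₁ := ContinuousOn.isOpen_inter_preimage
    (fun y hy => (h.smooth_shapeLam hy).continuousAt.continuousWithinAt) h.isOpen isOpen_Ioi
  let V' := V₁ ∩ w ⁻¹' {0}ᶜ
  have hV' : IsOpen V' := ContinuousOn.isOpen_inter_preimage
    (fun y hy => (hws y hy.1).continuousAt.continuousWithinAt) hV₁ isOpen_compl_singleton
  have hDw : ∀ y ∈ V', fderiv ℝ X y (w y) ≠ 0 := fun y hy h0 =>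
    hy.2 (h.injective hy.1.1 (h0.trans (map_zero _).symm))
  refine ⟨V', fun y hy => hy.1.1, ⟨⟨hy₀, hpos⟩, ?_⟩,
    fun y => ‖fderiv ℝ X y (w y)‖⁻¹ • w y, ⟨⟨hV', fun y hy => h.smooth y hy.1.1,
      fun y hy => h.smooth_normal y hy.1.1, fun y hy => h.smooth_left y hy.1.1,
      fun y hy => h.left_inv y hy.1.1, fun y hy => h.norm_normal y hy.1.1,
      fun y hy => h.inner_normal y hy.1.1⟩, fun y hy => h.smooth_shapeLam hy.1.1, fun y hy => ?_,
      fun y hy => hy.1.2, fun y hy => ?_, fun y hy v => ?_⟩⟩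
  · have h1 := h.shapeLam_eq hy₀ hη₀ hs₀
    intro h2
    rw [mem_singleton_iff, hw y₀ hy₀ l₀ η₀ h1 hs₀, real_inner_self_eq_norm_sq, hη₀, one_pow,
      mul_one, smul_eq_zero] at h2
    rcases h2 with h2 | h2
    · rw [h1, h2] at hpos
      exact lt_irrefl _ hpos
    · rw [h2, map_zero, norm_zero] at hη₀
      norm_num at hη₀
  · exact (((((h.smooth y hy.1.1).fderiv_right (by simp)).clm_apply (hws y hy.1.1)).norm ℝ
      (hDw y hy)).inv (norm_ne_zero_iff.2 (hDw y hy))).smul (hws y hy.1.1)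
  · rw [map_smul]
    exact norm_smul_inv_norm (hDw y hy)
  · obtain ⟨l, η', hη', hs⟩ := h.exists_shape_of_ideal hy.1.1 (hid y hy.1.1)
    have hl := h.shapeLam_eq hy.1.1 hη' hs
    have hwy := hw y hy.1.1 l η' hl hs
    have hwn : ‖fderiv ℝ X y (w y)‖ = |l * ⟪fderiv ℝ X y η₀, fderiv ℝ X y η'⟫| := by
      rw [hwy, map_smul, norm_smul, hη', mul_one, Real.norm_eq_abs]
    have hne : l * ⟪fderiv ℝ X y η₀, fderiv ℝ X y η'⟫ ≠ 0 := by
      rw [← abs_ne_zero, ← hwn]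
      exact norm_ne_zero_iff.2 (hDw y hy)
    generalize l * ⟪fderiv ℝ X y η₀, fderiv ℝ X y η'⟫ = t at hwy hwn hne
    have hη : ‖fderiv ℝ X y (w y)‖⁻¹ • w y = (|t|⁻¹ * t) • η' := by
      rw [hwn, hwy, smul_smul]
    have ht : (|t|⁻¹ * t) * (|t|⁻¹ * t) = 1 := by
      have := abs_ne_zero.2 hne
      field_simp
      exact (sq_abs t).symm
    rw [hl, hη, hs, map_smul, inner_smul_right, smul_smul, mul_assoc, mul_comm _ (|t|⁻¹ * t),
      ← mul_assoc, ht, one_mul]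

end NormalData

/-- The pointwise consequence of the Codazzi equation for a shape operator with eigenvalues
`l, l, 2 l`: the differentials `ℓ` of `l` and `R` of the principal vector field `ξ = D η`. -/
theorem codazzi_linear_algebra {D R : 𝔼 3 →L[ℝ] 𝔼 4} (hD : Function.Injective D)
    {η : 𝔼 3} (hη : ‖D η‖ = 1) {n : 𝔼 4} (hspan : ∀ z : 𝔼 4, ⟪z, n⟫ = 0 → ∃ v, D v = z)
    (hn : ‖n‖ = 1) (hDn : ∀ v, ⟪D v, n⟫ = 0) {ℓ : 𝔼 3 →L[ℝ] ℝ} {l : ℝ} (hl : l ≠ 0)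
    (hRξ : ∀ v, ⟪R v, D η⟫ = 0) (hRn : ∀ v, ⟪R v, n⟫ = 2 * l * ⟪D v, D η⟫)
    (hcod : ∀ u v, ℓ u • (D v + ⟪D v, D η⟫ • D η)
        + l • ((⟪D v, R u⟫) • D η + ⟪D v, D η⟫ • R u)
      = ℓ v • (D u + ⟪D u, D η⟫ • D η)
        + l • ((⟪D u, R v⟫) • D η + ⟪D u, D η⟫ • R v)) (v : 𝔼 3) :
    ℓ v = ℓ η * ⟪D v, D η⟫ ∧
      R v = (ℓ η / l) • (D v - ⟪D v, D η⟫ • D η) + (2 * l * ⟪D v, D η⟫) • n := by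
  have hηη : ⟪D η, D η⟫ = 1 := by rw [real_inner_self_eq_norm_sq, hη, one_pow]
  -- The eigenspace of `l` has dimension two: pair the Codazzi identity with a unit vector
  -- orthogonal to both `ξ` and `D v`.
  have hℓ : ∀ v, ⟪D v, D η⟫ = 0 → ℓ v = 0 := by
    intro v hv
    obtain ⟨u, hu, huη, huv⟩ := exists_unit_of_two_orthogonal hD (D η) (D v)
    have h1 := congrArg (fun z => ⟪z, D u⟫) (hcod u v)
    simp only [inner_add_left, inner_smul_left, RCLike.conj_to_real, hv, huη,
      real_inner_comm (D u) (D v), huv, real_inner_comm (D u) (D η),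
      real_inner_self_eq_norm_sq, hu] at h1
    linarith
  -- The Codazzi identity for `η` and `v ⊥ ξ`: its `ξ`-component gives the first claim, and what
  -- remains gives `R v`.
  have hR : ∀ v, ⟪D v, D η⟫ = 0 → ⟪D v, R η⟫ = 0 ∧ R v = (ℓ η / l) • D v := by
    intro v hv
    have h1 := hcod η v
    rw [hℓ v hv, hv, hηη, real_inner_comm (R v) (D η), hRξ] at h1
    have h2 := congrArg (fun z => ⟪z, D η⟫) h1
    simp only [inner_add_left, inner_smul_left, RCLike.conj_to_real, hv, hRξ, hηη] at h2
    have h3 : ⟪D v, R η⟫ = 0 := by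
      have : l * ⟪D v, R η⟫ = 0 := by linarith
      exact (mul_eq_zero.1 this).resolve_left hl
    refine ⟨h3, ?_⟩
    rw [h3] at h1
    simp only [zero_smul, smul_zero, add_zero, zero_add, one_smul] at h1
    rw [div_eq_inv_mul, mul_smul, h1, smul_smul, inv_mul_cancel₀ hl, one_smul]
  -- The difference is tangent and orthogonal to `ξ`, and by the previous step also to every tangent
  -- vector orthogonal to `ξ`, so it is zero. Geometrically, the `ξ`-curves are geodesics of the
  -- hypersurface.
  have hRη : R η = (2 * l) • n := by
    obtain ⟨w, hw⟩ := hspan (R η - (2 * l) • n) (by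
      rw [inner_sub_left, inner_smul_left, hRn, hηη, real_inner_self_eq_norm_sq, hn]
      simp)
    have hnD : ⟪n, D w⟫ = 0 := by rw [real_inner_comm]; exact hDn w
    have hwη : ⟪D w, D η⟫ = 0 := by
      rw [hw, inner_sub_left, inner_smul_left, hRξ, real_inner_comm, hDn]
      simp
    have h0 : ⟪D w, D w⟫ = 0 := by
      nth_rewrite 2 [hw]
      rw [inner_sub_right, inner_smul_right, hDn, (hR w hwη).1]
      simp
    rw [inner_self_eq_zero.1 h0] at hw
    exact (sub_eq_zero.1 hw.symm)
  have hv' : ⟪D (v - ⟪D v, D η⟫ • η), D η⟫ = 0 := by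
    rw [map_sub, map_smul, inner_sub_left, inner_smul_left, hηη]
    simp
  constructor
  · have := hℓ _ hv'
    rw [map_sub, map_smul, smul_eq_mul] at this
    linarith
  · have := (hR _ hv').2
    rw [map_sub, map_smul, hRη, map_sub, map_smul, sub_eq_iff_eq_add] at this
    rw [this, smul_smul, mul_comm ⟪D v, D η⟫]

namespace ShapeData

variable {X : 𝔼 3 → 𝔼 4} {V : Set (𝔼 3)} {N : 𝔼 3 → 𝔼 4} {L : 𝔼 3 → 𝔼 4 →L[ℝ] 𝔼 3} {y : 𝔼 3}
  {lam : 𝔼 3 → ℝ} {η : 𝔼 3 → 𝔼 3}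

/-- The principal direction of `2 * lam`, as a vector of the ambient space. -/
def xi (X : 𝔼 3 → 𝔼 4) (η : 𝔼 3 → 𝔼 3) (z : 𝔼 3) : 𝔼 4 := fderiv ℝ X z (η z)

/-- The one-form dual to `xi`. -/
def theta (X : 𝔼 3 → 𝔼 4) (η : 𝔼 3 → 𝔼 3) (v z : 𝔼 3) : ℝ := ⟪fderiv ℝ X z v, xi X η z⟫

/-- The derivative of `lam` in the principal direction `η`. -/
def mu (lam : 𝔼 3 → ℝ) (η : 𝔼 3 → 𝔼 3) (z : 𝔼 3) : ℝ := fderiv ℝ lam z (η z)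

theorem smooth_xi (h : ShapeData X V N L lam η) (hy : y ∈ V) : ContDiffAt ℝ ∞ (xi X η) y :=
  ((h.smooth y hy).fderiv_right (by simp)).clm_apply (h.smooth_eta y hy)

theorem smooth_theta (h : ShapeData X V N L lam η) (hy : y ∈ V) (v : 𝔼 3) :
    ContDiffAt ℝ ∞ (theta X η v) y :=
  (h.smooth_fderiv hy v).inner ℝ (h.smooth_xi hy)

theorem smooth_mu (h : ShapeData X V N L lam η) (hy : y ∈ V) : ContDiffAt ℝ ∞ (mu lam η) y :=
  ((h.smooth_lam y hy).fderiv_right (by simp)).clm_apply (h.smooth_eta y hy)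

theorem hasFDerivAt_xi (h : ShapeData X V N L lam η) (hy : y ∈ V) :
    HasFDerivAt (xi X η) (fderiv ℝ (xi X η) y) y :=
  ((h.smooth_xi hy).differentiableAt (by simp)).hasFDerivAt

theorem hasFDerivAt_theta (h : ShapeData X V N L lam η) (hy : y ∈ V) (v : 𝔼 3) :
    HasFDerivAt (theta X η v) (fderiv ℝ (theta X η v) y) y :=
  ((h.smooth_theta hy v).differentiableAt (by simp)).hasFDerivAt

theorem hasFDerivAt_mu (h : ShapeData X V N L lam η) (hy : y ∈ V) :
    HasFDerivAt (mu lam η) (fderiv ℝ (mu lam η) y) y :=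
  ((h.smooth_mu hy).differentiableAt (by simp)).hasFDerivAt

theorem hasFDerivAt_lam (h : ShapeData X V N L lam η) (hy : y ∈ V) :
    HasFDerivAt lam (fderiv ℝ lam y) y :=
  ((h.smooth_lam y hy).differentiableAt (by simp)).hasFDerivAt

theorem inner_xi_xi (h : ShapeData X V N L lam η) (hy : y ∈ V) : ⟪xi X η y, xi X η y⟫ = 1 := by
  rw [real_inner_self_eq_norm_sq, xi, h.norm_eta y hy, one_pow]

theorem theta_eta (h : ShapeData X V N L lam η) (hy : y ∈ V) : theta X η (η y) y = 1 :=
  h.inner_xi_xi hy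

theorem fderiv_normal (h : ShapeData X V N L lam η) (hy : y ∈ V) (v : 𝔼 3) :
    fderiv ℝ N y v = -lam y • (fderiv ℝ X y v + theta X η v y • xi X η y) := h.shape y hy v

theorem inner_fderiv_xi_xi (h : ShapeData X V N L lam η) (hy : y ∈ V) (v : 𝔼 3) :
    ⟪fderiv ℝ (xi X η) y v, xi X η y⟫ = 0 := by
  have hd := (h.hasFDerivAt_xi hy).differentiableAt
  have h1 := fderiv_inner_apply ℝ hd hd v
  have h2 : (fun z => ⟪xi X η z, xi X η z⟫) =ᶠ[𝓝 y] fun _ => (1 : ℝ) := by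
    filter_upwards [h.isOpen.mem_nhds hy] with z hz
    exact h.inner_xi_xi hz
  rw [h2.fderiv_eq] at h1
  simp only [fderiv_fun_const, Pi.zero_apply, zero_apply] at h1
  linarith [real_inner_comm (xi X η y) (fderiv ℝ (xi X η) y v)]

theorem inner_fderiv_xi_normal (h : ShapeData X V N L lam η) (hy : y ∈ V) (v : 𝔼 3) :
    ⟪fderiv ℝ (xi X η) y v, N y⟫ = 2 * lam y * theta X η v y := by
  have h1 := fderiv_inner_apply ℝ (h.hasFDerivAt_xi hy).differentiableAt
    (h.differentiableAt_normal hy) v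
  have h2 : (fun z => ⟪xi X η z, N z⟫) =ᶠ[𝓝 y] fun _ => (0 : ℝ) := by
    filter_upwards [h.isOpen.mem_nhds hy] with z hz
    exact h.inner_normal z hz _
  rw [h2.fderiv_eq] at h1
  simp only [fderiv_fun_const, Pi.zero_apply, zero_apply] at h1
  rw [h.fderiv_normal hy, inner_smul_right, inner_add_right, inner_smul_right,
    h.inner_xi_xi hy, real_inner_comm] at h1
  change 0 = -lam y * (theta X η v y + _) + _ at h1
  linarith

theorem fderiv_theta (h : ShapeData X V N L lam η) (hy : y ∈ V) (u v : 𝔼 3) :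
    fderiv ℝ (theta X η v) y u
      = ⟪hess X y u v, xi X η y⟫ + ⟪fderiv ℝ X y v, fderiv ℝ (xi X η) y u⟫ := by
  have := fderiv_inner_apply ℝ (h.differentiableAt_fderiv hy v)
    (h.hasFDerivAt_xi hy).differentiableAt u
  unfold theta hess
  rw [this]
  ring

theorem hess_normal (h : ShapeData X V N L lam η) (hy : y ∈ V) (u v : 𝔼 3) :
    hess N y u v = -lam y • (hess X y u v + (theta X η v y • fderiv ℝ (xi X η) y u
        + fderiv ℝ (theta X η v) y u • xi X η y))
      - fderiv ℝ lam y u • (fderiv ℝ X y v + theta X η v y • xi X η y) := by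
  have h1 : (fun z => fderiv ℝ N z v) =ᶠ[𝓝 y]
      fun z => -lam z • (fderiv ℝ X z v + theta X η v z • xi X η z) := by
    filter_upwards [h.isOpen.mem_nhds hy] with z hz
    exact h.fderiv_normal hz v
  have h2 := (h.hasFDerivAt_lam hy).neg.smul ((h.differentiableAt_fderiv hy v).hasFDerivAt.add
    ((h.hasFDerivAt_theta hy v).smul (h.hasFDerivAt_xi hy)))
  have h3 := congrArg (fun A : 𝔼 3 →L[ℝ] 𝔼 4 => A u) (h1.fderiv_eq.trans h2.fderiv)
  change hess N y u v = _ at h3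
  rw [h3]
  simp only [add_apply, smul_apply, neg_apply, ContinuousLinearMap.smulRight_apply, hess,
    Pi.neg_apply, Pi.add_apply, Pi.smul_apply']
  module

theorem fderiv_lam_and_xi (h : ShapeData X V N L lam η) (hy : y ∈ V) (v : 𝔼 3) :
    fderiv ℝ lam y v = mu lam η y * theta X η v y ∧
      fderiv ℝ (xi X η) y v = (mu lam η y / lam y) • (fderiv ℝ X y v - theta X η v y • xi X η y)
        + (2 * lam y * theta X η v y) • N y := by
  refine codazzi_linear_algebra (h.injective hy) (h.norm_eta y hy)
    (fun z hz => ⟨_, h.map_left hy hz⟩) (h.norm_normal y hy) (h.inner_normal y hy)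
    (h.lam_pos y hy).ne' (h.inner_fderiv_xi_xi hy) (h.inner_fderiv_xi_normal hy) ?_ v
  intro u v
  have h1 := hess_symm (h.smooth_normal y hy) u v
  rw [h.hess_normal hy, h.hess_normal hy, h.fderiv_theta hy, h.fderiv_theta hy,
    hess_symm (h.smooth y hy) v u] at h1
  change _ • (_ + theta X η v y • xi X η y) + _ • (_ • xi X η y + theta X η v y • _) =
    _ • (_ + theta X η u y • xi X η y) + _ • (_ • xi X η y + theta X η u y • _)
  rw [← sub_eq_zero, ← neg_eq_zero, ← sub_eq_zero.2 h1]
  module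

theorem fderiv_lam (h : ShapeData X V N L lam η) (hy : y ∈ V) (v : 𝔼 3) :
    fderiv ℝ lam y v = mu lam η y * theta X η v y := (h.fderiv_lam_and_xi hy v).1

theorem fderiv_xi (h : ShapeData X V N L lam η) (hy : y ∈ V) (v : 𝔼 3) :
    fderiv ℝ (xi X η) y v = (mu lam η y / lam y) • (fderiv ℝ X y v - theta X η v y • xi X η y)
        + (2 * lam y * theta X η v y) • N y := (h.fderiv_lam_and_xi hy v).2

theorem inner_fderiv_fderiv_xi (h : ShapeData X V N L lam η) (hy : y ∈ V) (u v : 𝔼 3) :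
    ⟪fderiv ℝ X y v, fderiv ℝ (xi X η) y u⟫ = mu lam η y / lam y *
      (⟪fderiv ℝ X y v, fderiv ℝ X y u⟫ - theta X η u y * theta X η v y) := by
  rw [h.fderiv_xi hy, inner_add_right, inner_smul_right, inner_smul_right, h.inner_normal y hy,
    inner_sub_right, inner_smul_right]
  change _ * (_ - _ * theta X η v y) + _ = _
  ring

theorem hess_lam (h : ShapeData X V N L lam η) (hy : y ∈ V) (u v : 𝔼 3) :
    hess lam y u v = mu lam η y * (⟪hess X y u v, xi X η y⟫ + mu lam η y / lam y *
        (⟪fderiv ℝ X y v, fderiv ℝ X y u⟫ - theta X η u y * theta X η v y))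
      + theta X η v y * fderiv ℝ (mu lam η) y u := by
  have h1 : (fun z => fderiv ℝ lam z v) =ᶠ[𝓝 y] fun z => mu lam η z * theta X η v z := by
    filter_upwards [h.isOpen.mem_nhds hy] with z hz
    exact h.fderiv_lam hz v
  have h2 := (h.hasFDerivAt_mu hy).mul (h.hasFDerivAt_theta hy v)
  have h3 := congrArg (fun A : 𝔼 3 →L[ℝ] ℝ => A u) (h1.fderiv_eq.trans h2.fderiv)
  change hess lam y u v = _ at h3
  rw [h3, ← h.inner_fderiv_fderiv_xi hy, ← h.fderiv_theta hy]
  simp [smul_eq_mul]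

/-- In the Hessian of `lam` every term but `θ(v) dμ(u)` is symmetric. Exchanging the principal
direction with `v` leaves `dμ(v) = dμ(η) θ(v)`. -/
theorem fderiv_mu_eq_mul (h : ShapeData X V N L lam η) (hy : y ∈ V) (v : 𝔼 3) :
    fderiv ℝ (mu lam η) y v = mu (mu lam η) η y * theta X η v y := by
  have h1 := hess_symm (h.smooth_lam y hy) (η y) v
  rw [h.hess_lam hy, h.hess_lam hy, hess_symm (h.smooth y hy) v, h.theta_eta hy,
    real_inner_comm (fderiv ℝ X y v)] at h1
  unfold mu at h1 ⊢
  linear_combination -h1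

/-- A multiple of the axis vector of the hypersurface. -/
def axis (X : 𝔼 3 → 𝔼 4) (N : 𝔼 3 → 𝔼 4) (lam : 𝔼 3 → ℝ) (η : 𝔼 3 → 𝔼 3) (z : 𝔼 3) : 𝔼 4 :=
  lam z ^ 2 • xi X η z + mu lam η z • N z

theorem smooth_axis (h : ShapeData X V N L lam η) (hy : y ∈ V) :
    ContDiffAt ℝ ∞ (axis X N lam η) y :=
  (((h.smooth_lam y hy).pow 2).smul (h.smooth_xi hy)).add
    ((h.smooth_mu hy).smul (h.smooth_normal y hy))

/-- The combination `lam² ξ + μ N` is chosen so that all tangential terms cancel. -/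
theorem fderiv_axis_eq_smul (h : ShapeData X V N L lam η) (hy : y ∈ V) (v : 𝔼 3) :
    fderiv ℝ (axis X N lam η) y v
      = ((2 * lam y ^ 3 + mu (mu lam η) η y) * theta X η v y) • N y := by
  have h1 := (((h.hasFDerivAt_lam hy).pow 2).smul (h.hasFDerivAt_xi hy)).add
    ((h.hasFDerivAt_mu hy).smul (h.differentiableAt_normal hy).hasFDerivAt)
  have h2 := congrArg (fun A : 𝔼 3 →L[ℝ] 𝔼 4 => A v) h1.fderiv
  change fderiv ℝ (axis X N lam η) y v = _ at h2
  rw [h2]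
  simp only [add_apply, smul_apply, ContinuousLinearMap.smulRight_apply, h.fderiv_xi hy,
    h.fderiv_normal hy, h.fderiv_lam hy, h.fderiv_mu_eq_mul hy]
  have := (h.lam_pos y hy).ne'
  match_scalars <;> simp <;> field_simp <;> ring

/-- The differential of the axis vector is `q N` with a one-form `q` proportional to `θ`. Its second
derivative in a unit direction `v ⊥ ξ` and in `η`, paired with `dX v`, is `-lam q(η)` in one order
and `0` in the other, since `q(v) = 0`. Hence `q(η) = 0`. -/
theorem mu_mu (h : ShapeData X V N L lam η) (hy : y ∈ V) :
    mu (mu lam η) η y = -2 * lam y ^ 3 := by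
  let q : 𝔼 3 → 𝔼 3 → ℝ := fun v z => (2 * lam z ^ 3 + mu (mu lam η) η z) * theta X η v z
  have hmm : ContDiffAt ℝ ∞ (mu (mu lam η) η) y :=
    ((h.smooth_mu hy).fderiv_right (by simp)).clm_apply (h.smooth_eta y hy)
  have hq : ∀ v, DifferentiableAt ℝ (q v) y := fun v =>
    (((contDiffAt_const.mul ((h.smooth_lam y hy).pow 3)).add hmm).mul
      (h.smooth_theta hy v)).differentiableAt (by simp)
  have hw : ∀ u v w, ⟪hess (axis X N lam η) y u v, fderiv ℝ X y w⟫
      = q v y * ⟪fderiv ℝ N y u, fderiv ℝ X y w⟫ := by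
    intro u v w
    have h1 : (fun z => fderiv ℝ (axis X N lam η) z v) =ᶠ[𝓝 y] fun z => q v z • N z := by
      filter_upwards [h.isOpen.mem_nhds hy] with z hz
      exact h.fderiv_axis_eq_smul hz v
    have h2 := (hq v).hasFDerivAt.smul (h.differentiableAt_normal hy).hasFDerivAt
    have h3 := congrArg (fun A : 𝔼 3 →L[ℝ] 𝔼 4 => A u) (h1.fderiv_eq.trans h2.fderiv)
    change hess _ y u v = _ at h3
    rw [h3]
    simp only [add_apply, smul_apply, ContinuousLinearMap.smulRight_apply, inner_add_left,
      inner_smul_left, RCLike.conj_to_real]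
    rw [real_inner_comm _ (N y), h.inner_normal y hy]
    ring
  obtain ⟨v, hv1, hv2, -⟩ := exists_unit_of_two_orthogonal (h.injective hy) (xi X η y) 0
  have h1 := hw v (η y) v
  rw [hess_symm (h.smooth_axis hy), hw, h.fderiv_normal hy v] at h1
  have hvt : theta X η v y = 0 := hv2
  simp only [q, h.theta_eta hy, hvt, mul_zero, zero_mul, zero_smul, add_zero, inner_smul_left,
    real_inner_self_eq_norm_sq, hv1, one_pow, RCLike.conj_to_real, mul_one] at h1
  have h2 := (mul_eq_zero.1 h1.symm).resolve_right (neg_ne_zero.2 (h.lam_pos y hy).ne')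
  linarith

theorem fderiv_mu (h : ShapeData X V N L lam η) (hy : y ∈ V) (v : 𝔼 3) :
    fderiv ℝ (mu lam η) y v = -2 * lam y ^ 3 * theta X η v y := by
  rw [h.fderiv_mu_eq_mul hy, h.mu_mu hy]

theorem fderiv_axis (h : ShapeData X V N L lam η) (hy : y ∈ V) (v : 𝔼 3) :
    fderiv ℝ (axis X N lam η) y v = 0 := by
  rw [h.fderiv_axis_eq_smul hy, h.mu_mu hy]
  have : 2 * lam y ^ 3 + -2 * lam y ^ 3 = 0 := by ring
  rw [this, zero_mul, zero_smul]

end ShapeData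

/-! ### The invariants of the hypersurface -/

/-- The axis vector, in terms of the normal `n`, the principal direction `ξ`, the principal
curvature `l` and its derivative `m`. -/
def axisInv (a : ℝ) (n ξ : 𝔼 4) (l m : ℝ) : 𝔼 4 := (2 / a ^ 2) • (l ^ 2 • ξ + m • n)

/-- The base point of the axis. -/
def centerInv (a : ℝ) (x n ξ : 𝔼 4) (l m : ℝ) : 𝔼 4 :=
  -- The vector removed here is radial: the radius `2l/a²` times the unit vector `(2/a²)(m ξ - l²
  -- n)`, which is orthogonal to the axis. The next term removes the height.
  x - (4 / a ^ 4) • ((l * m) • ξ - l ^ 3 • n)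
    - heightOfSlope a (2 / a ^ 2 * m) • axisInv a n ξ l m

/-- The invariants at a point are `a`, `E` and `C`. -/
structure Matches (a : ℝ) (E C x n ξ : 𝔼 4) (l m : ℝ) : Prop where
  energy : m ^ 2 + l ^ 4 = a ^ 4 / 4
  axis : axisInv a n ξ l m = E
  center : centerInv a x n ξ l m = C

theorem slope_sq_add {a l m : ℝ} (ha : 0 < a) (h : m ^ 2 + l ^ 4 = a ^ 4 / 4) :
    (2 / a ^ 2 * m) ^ 2 + 4 * l ^ 4 / a ^ 4 = 1 := by
  field_simp
  linear_combination 4 * h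

theorem slope_mem_Ioo {a l m : ℝ} (ha : 0 < a) (hl : 0 < l) (h : m ^ 2 + l ^ 4 = a ^ 4 / 4) :
    2 / a ^ 2 * m ∈ Ioo (-1 : ℝ) 1 := by
  have h1 := slope_sq_add ha h
  have h2 : 0 < 4 * l ^ 4 / a ^ 4 := by positivity
  exact abs_lt.1 ((sq_lt_one_iff_abs_lt_one _).1 (by linarith))

theorem eq_of_fderiv_eq_zero {F : Type*} [NormedAddCommGroup F] [NormedSpace ℝ F]
    {V : Set (𝔼 3)} (hV : IsOpen V) (hc : Convex ℝ V) {f : 𝔼 3 → F}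
    (hf : ∀ y ∈ V, HasFDerivAt f (0 : 𝔼 3 →L[ℝ] F) y) {y z : 𝔼 3} (hy : y ∈ V) (hz : z ∈ V) :
    f y = f z :=
  hc.is_const_of_fderivWithin_eq_zero
    (fun y hy => (hf y hy).differentiableAt.differentiableWithinAt)
    (fun y hy => (hf y hy).hasFDerivWithinAt.fderivWithin (hV.uniqueDiffWithinAt hy)) hy hz

namespace ShapeData

variable {X : 𝔼 3 → 𝔼 4} {V : Set (𝔼 3)} {N : 𝔼 3 → 𝔼 4} {L : 𝔼 3 → 𝔼 4 →L[ℝ] 𝔼 3} {y : 𝔼 3}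
  {lam : 𝔼 3 → ℝ} {η : 𝔼 3 → 𝔼 3}

theorem energy_eq (h : ShapeData X V N L lam η) (hc : Convex ℝ V) {y z : 𝔼 3} (hy : y ∈ V)
    (hz : z ∈ V) : mu lam η y ^ 2 + lam y ^ 4 = mu lam η z ^ 2 + lam z ^ 4 := by
  refine eq_of_fderiv_eq_zero (f := fun y => mu lam η y ^ 2 + lam y ^ 4) h.isOpen hc ?_ hy hz
  intro y hy
  refine (((h.hasFDerivAt_mu hy).pow 2).add ((h.hasFDerivAt_lam hy).pow 4)).congr_fderiv ?_
  refine ContinuousLinearMap.ext fun v => ?_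
  simp only [add_apply, smul_apply, h.fderiv_lam hy, h.fderiv_mu hy, zero_apply, smul_eq_mul,
    nsmul_eq_mul]
  push_cast
  ring

theorem axis_eq (h : ShapeData X V N L lam η) (hc : Convex ℝ V) {y z : 𝔼 3} (hy : y ∈ V)
    (hz : z ∈ V) : axis X N lam η y = axis X N lam η z := by
  refine eq_of_fderiv_eq_zero h.isOpen hc (fun y hy => ?_) hy hz
  have h1 : fderiv ℝ (axis X N lam η) y = 0 :=
    ContinuousLinearMap.ext fun v => h.fderiv_axis hy v
  rw [← h1]
  exact ((h.smooth_axis hy).differentiableAt (by simp)).hasFDerivAt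

/-- The coefficient of `dX` is `1 - (4/a⁴)(μ² + lam⁴)`, zero by the energy relation. The
coefficients of `ξ` and `N` cancel against the height term, whose derivative is `2 lam² θ / a²`
times the axis vector. -/
theorem hasFDerivAt_center (h : ShapeData X V N L lam η) (hy : y ∈ V) {a : ℝ} (ha : 0 < a)
    (he : mu lam η y ^ 2 + lam y ^ 4 = a ^ 4 / 4) {E : 𝔼 4}
    (hE : (2 / a ^ 2) • axis X N lam η y = E) :
    HasFDerivAt (fun z => X z - (4 / a ^ 4) • ((lam z * mu lam η z) • xi X η z - lam z ^ 3 • N z)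
      - heightOfSlope a (2 / a ^ 2 * mu lam η z) • E) (0 : 𝔼 3 →L[ℝ] 𝔼 4) y := by
  have hl := h.lam_pos y hy
  have hH := HasDerivAt.comp_hasFDerivAt (h₂ := heightOfSlope a)
    (f := fun z => 2 / a ^ 2 * mu lam η z) y (hasDerivAt_heightOfSlope ha hl
      (slope_mem_Ioo ha hl he) (slope_sq_add ha he)).2 ((h.hasFDerivAt_mu hy).const_mul (2 / a ^ 2))
  have h1 := ((h.differentiableAt hy).hasFDerivAt.sub
    (((((h.hasFDerivAt_lam hy).mul (h.hasFDerivAt_mu hy)).smul (h.hasFDerivAt_xi hy)).sub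
      (((h.hasFDerivAt_lam hy).pow 3).smul
        (h.differentiableAt_normal hy).hasFDerivAt)).const_smul (4 / a ^ 4))).sub
    (hH.smul_const E)
  refine h1.congr_fderiv (ContinuousLinearMap.ext fun v => ?_)
  rw [← hE]
  simp only [add_apply, sub_apply, smul_apply, ContinuousLinearMap.smulRight_apply,
    h.fderiv_xi hy, h.fderiv_normal hy, h.fderiv_lam hy, h.fderiv_mu hy, zero_apply, axis,
    Pi.mul_apply, nsmul_eq_mul, smul_eq_mul]
  have hm : mu lam η y ^ 2 = a ^ 4 / 4 - lam y ^ 4 := by linarith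
  match_scalars
  · simp
    field_simp
    linear_combination (-4 : ℝ) * hm
  · simp
    field_simp
    ring
  · simp
    field_simp
    ring

/-- The invariants are constant on convex sets. -/
theorem matches_of_matches (h : ShapeData X V N L lam η) (hc : Convex ℝ V) {a : ℝ} (ha : 0 < a)
    {E C : 𝔼 4} {y z : 𝔼 3} (hy : y ∈ V) (hz : z ∈ V)
    (hm : Matches a E C (X y) (N y) (xi X η y) (lam y) (mu lam η y)) :
    Matches a E C (X z) (N z) (xi X η z) (lam z) (mu lam η z) := by
  have hE : ∀ w ∈ V, (2 / a ^ 2) • axis X N lam η w = E := fun w hw => by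
    rw [h.axis_eq hc hw hy]; exact hm.axis
  have he : ∀ w ∈ V, mu lam η w ^ 2 + lam w ^ 4 = a ^ 4 / 4 := fun w hw => by
    rw [h.energy_eq hc hw hy]; exact hm.energy
  -- The axis vector is already known to be constant, so it is replaced by `E` before the center is
  -- differentiated.
  have hcen : ∀ w ∈ V, centerInv a (X w) (N w) (xi X η w) (lam w) (mu lam η w)
      = X w - (4 / a ^ 4) • ((lam w * mu lam η w) • xi X η w - lam w ^ 3 • N w)
      - heightOfSlope a (2 / a ^ 2 * mu lam η w) • E := fun w hw => by
    rw [← hE w hw]; rfl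
  refine ⟨he z hz, hE z hz, ?_⟩
  rw [← hm.center, hcen z hz, hcen y hy]
  exact eq_of_fderiv_eq_zero h.isOpen hc
    (fun w hw => h.hasFDerivAt_center hw ha (he w hw) (hE w hw)) hz hy

end ShapeData

/-- The bound for `mu ^ 2 / lam` in terms of second derivatives. -/
def slopeBound (X : 𝔼 3 → 𝔼 4) (N : 𝔼 3 → 𝔼 4) (L : 𝔼 3 → 𝔼 4 →L[ℝ] 𝔼 3) (y : 𝔼 3) : ℝ :=
  ‖fderiv ℝ (fderiv ℝ (shapeLam N L)) y‖ * ‖L y‖ ^ 2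
    + ‖fderiv ℝ (shapeLam N L) y‖ * ‖L y‖ * (‖fderiv ℝ (fderiv ℝ X) y‖ * ‖L y‖ ^ 2)

theorem continuousAt_norm_fderiv_fderiv {F : Type*} [NormedAddCommGroup F] [NormedSpace ℝ F]
    {f : 𝔼 3 → F} {y : 𝔼 3} (h : ContDiffAt ℝ ∞ f y) :
    ContinuousAt (fun z => ‖fderiv ℝ (fderiv ℝ f) z‖) y :=
  (((h.fderiv_right (m := ∞) (by simp)).fderiv_right (m := ∞) (by simp)).continuousAt).norm

theorem continuousAt_slopeBound {X : 𝔼 3 → 𝔼 4} {V : Set (𝔼 3)} {N : 𝔼 3 → 𝔼 4}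
    {L : 𝔼 3 → 𝔼 4 →L[ℝ] 𝔼 3} {y : 𝔼 3} (h : NormalData X V N L) (hy : y ∈ V) :
    ContinuousAt (slopeBound X N L) y := by
  have c1 : ContinuousAt (fderiv ℝ (shapeLam N L)) y :=
    ((h.smooth_shapeLam hy).fderiv_right (m := ∞) (by simp)).continuousAt
  have c2 := continuousAt_norm_fderiv_fderiv (h.smooth_shapeLam hy)
  have c4 := continuousAt_norm_fderiv_fderiv (h.smooth y hy)
  have c5 := (h.smooth_left y hy).continuousAt
  exact (c2.mul (c5.norm.pow 2)).add ((c1.norm.mul c5.norm).mul (c4.mul (c5.norm.pow 2)))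

namespace ShapeData

variable {X : 𝔼 3 → 𝔼 4} {V : Set (𝔼 3)} {N : 𝔼 3 → 𝔼 4} {L : 𝔼 3 → 𝔼 4 →L[ℝ] 𝔼 3} {y : 𝔼 3}
  {η : 𝔼 3 → 𝔼 3}

/-- For a unit tangent vector `v ⊥ ξ` the Hessian of `lam` on `(v, v)` equals `μ (⟪∂_v ∂_v X, ξ⟫ + μ
/ lam)`. Solving for `μ² / lam` leaves only derivatives of `X` and of `shapeLam`, which stay bounded
even where `lam` tends to zero. -/
theorem mu_sq_le (h : ShapeData X V N L (shapeLam N L) η) (hy : y ∈ V) :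
    mu (shapeLam N L) η y ^ 2 ≤ shapeLam N L y * slopeBound X N L y := by
  obtain ⟨v, hv1, hv2, -⟩ := exists_unit_of_two_orthogonal (h.injective hy) (xi X η y) 0
  have hvt : theta X η v y = 0 := hv2
  have hl := h.lam_pos y hy
  have h1 := h.hess_lam hy v v
  rw [hvt, real_inner_self_eq_norm_sq, hv1] at h1
  have h2 : mu (shapeLam N L) η y ^ 2 = shapeLam N L y *
      (hess (shapeLam N L) y v v - mu (shapeLam N L) η y * ⟪hess X y v v, xi X η y⟫) := by
    rw [h1]
    field_simp
    ring
  have hv : ‖v‖ ≤ ‖L y‖ := by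
    have := (L y).le_opNorm (fderiv ℝ X y v)
    rwa [h.left_inv y hy, hv1, mul_one] at this
  have hη : ‖η y‖ ≤ ‖L y‖ := by
    have := (L y).le_opNorm (fderiv ℝ X y (η y))
    rwa [h.left_inv y hy, h.norm_eta y hy, mul_one] at this
  have hb1 : |hess (shapeLam N L) y v v|
      ≤ ‖fderiv ℝ (fderiv ℝ (shapeLam N L)) y‖ * ‖L y‖ ^ 2 := by
    rw [hess_eq (h.smooth_lam y hy), ← Real.norm_eq_abs]
    refine (ContinuousLinearMap.le_opNorm₂ _ v v).trans ?_
    rw [mul_assoc, ← sq]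
    gcongr
  have hb2 : |mu (shapeLam N L) η y| ≤ ‖fderiv ℝ (shapeLam N L) y‖ * ‖L y‖ := by
    rw [← Real.norm_eq_abs]
    refine ((fderiv ℝ (shapeLam N L) y).le_opNorm (η y)).trans ?_
    gcongr
  have hb3 : |⟪hess X y v v, xi X η y⟫| ≤ ‖fderiv ℝ (fderiv ℝ X) y‖ * ‖L y‖ ^ 2 := by
    refine (abs_real_inner_le_norm _ _).trans ?_
    rw [xi, h.norm_eta y hy, mul_one, hess_eq (h.smooth y hy)]
    refine (ContinuousLinearMap.le_opNorm₂ _ v v).trans ?_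
    rw [mul_assoc, ← sq]
    gcongr
  rw [h2]
  refine mul_le_mul_of_nonneg_left ?_ hl.le
  have hb4 := mul_le_mul hb2 hb3 (abs_nonneg _) (by positivity)
  rw [← abs_mul] at hb4
  unfold slopeBound
  linarith [le_abs_self (hess (shapeLam N L) y v v),
    neg_abs_le (mu (shapeLam N L) η y * ⟪hess X y v v, xi X η y⟫)]

end ShapeData

/-! ### Frames on the manifold -/

theorem NormalData.mono {X : 𝔼 3 → 𝔼 4} {V V' : Set (𝔼 3)} {N : 𝔼 3 → 𝔼 4}
    {L : 𝔼 3 → 𝔼 4 →L[ℝ] 𝔼 3} (h : NormalData X V N L) (hV' : IsOpen V') (hs : V' ⊆ V) :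
    NormalData X V' N L :=
  ⟨hV', fun y hy => h.smooth y (hs hy), fun y hy => h.smooth_normal y (hs hy),
    fun y hy => h.smooth_left y (hs hy), fun y hy => h.left_inv y (hs hy),
    fun y hy => h.norm_normal y (hs hy), fun y hy => h.inner_normal y (hs hy)⟩

theorem ShapeData.mono {X : 𝔼 3 → 𝔼 4} {V V' : Set (𝔼 3)} {N : 𝔼 3 → 𝔼 4}
    {L : 𝔼 3 → 𝔼 4 →L[ℝ] 𝔼 3} {lam : 𝔼 3 → ℝ} {η : 𝔼 3 → 𝔼 3} (h : ShapeData X V N L lam η)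
    (hV' : IsOpen V') (hs : V' ⊆ V) : ShapeData X V' N L lam η :=
  ⟨h.toNormalData.mono hV' hs, fun y hy => h.smooth_lam y (hs hy),
    fun y hy => h.smooth_eta y (hs hy), fun y hy => h.lam_pos y (hs hy),
    fun y hy => h.norm_eta y (hs hy), fun y hy => h.shape y (hs hy)⟩

theorem NormalData.neg {X : 𝔼 3 → 𝔼 4} {V : Set (𝔼 3)} {N : 𝔼 3 → 𝔼 4}
    {L : 𝔼 3 → 𝔼 4 →L[ℝ] 𝔼 3} (h : NormalData X V N L) : NormalData X V (-N) L :=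
  ⟨h.isOpen, h.smooth, fun y hy => (h.smooth_normal y hy).neg, h.smooth_left, h.left_inv,
    fun y hy => by rw [Pi.neg_apply, norm_neg, h.norm_normal y hy],
    fun y hy v => by rw [Pi.neg_apply, inner_neg_right, h.inner_normal y hy, neg_zero]⟩

theorem shapeLam_neg (N : 𝔼 3 → 𝔼 4) (L : 𝔼 3 → 𝔼 4 →L[ℝ] 𝔼 3) (y : 𝔼 3) :
    shapeLam (-N) L y = -shapeLam N L y := by
  unfold shapeLam
  rw [fderiv_neg]
  have : ((L y).comp (-fderiv ℝ N y)).toLinearMap = -((L y).comp (fderiv ℝ N y)).toLinearMap := by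
    refine LinearMap.ext fun v => ?_
    simp
  rw [this, map_neg]
  ring

section Manifold

variable {M : Type*} [TopologicalSpace M] [ChartedSpace (𝔼 3) M]
  {F : Type*} [NormedAddCommGroup F] [NormedSpace ℝ F]

/-- The differential of a function on the manifold with values in a vector space. -/
def mdiff (f : M → F) (p : M) : 𝔼 3 →L[ℝ] F := mfderiv 𝓘(ℝ, 𝔼 3) 𝓘(ℝ, F) f p

/-- On the open set `W`, the immersion `x` has unit normal `n`, principal curvatures `l`, `l` and
`2 l > 0`, and unit principal direction `ξ` for `2 l`, along which `l` has the derivative `m`; the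
invariants are constant on `W`. -/
structure LocalFrame (x : M → 𝔼 4) (W : Set M) (n ξ : M → 𝔼 4) (l m : M → ℝ) : Prop where
  isOpen : IsOpen W
  norm_normal : ∀ p ∈ W, ‖n p‖ = 1
  mdiff_normal : ∀ p ∈ W, MDifferentiableAt 𝓘(ℝ, 𝔼 3) 𝓘(ℝ, 𝔼 4) n p
  inner_normal : ∀ p ∈ W, ∀ v, ⟪mdiff x p v, n p⟫ = 0
  tangent : ∀ p ∈ W, ∃ v, mdiff x p v = ξ p
  norm_xi : ∀ p ∈ W, ‖ξ p‖ = 1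
  pos : ∀ p ∈ W, 0 < l p
  shape : ∀ p ∈ W, ∀ v, mdiff n p v = -l p • (mdiff x p v + ⟪mdiff x p v, ξ p⟫ • ξ p)
  mdiff_curvature : ∀ p ∈ W, ∀ v, mdiff l p v = m p * ⟪mdiff x p v, ξ p⟫
  matches_of_matches : ∀ a > 0, ∀ E C, ∀ p ∈ W, ∀ q ∈ W,
    Matches a E C (x p) (n p) (ξ p) (l p) (m p) → Matches a E C (x q) (n q) (ξ q) (l q) (m q)

theorem mdiff_injective {x : M → 𝔼 4} (hx : IsSmoothImmersion (n := 3) x) (p : M) :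
    Function.Injective (mdiff x p) := hx.2 p

theorem mdiff_eq_comp_chart [IsManifold 𝓘(ℝ, 𝔼 3) ∞ M] {φ : OpenPartialHomeomorph M (𝔼 3)}
    (hφ : φ ∈ atlas (𝔼 3) M) {p : M} (hp : p ∈ φ.source) {f : M → F} {g : 𝔼 3 → F}
    (hg : DifferentiableAt ℝ g (φ p)) (hf : f =ᶠ[𝓝 p] g ∘ φ) :
    mdiff f p = (fderiv ℝ g (φ p)).comp (mdiff φ p) :=
  (hasMFDerivAt_of_eventuallyEq_comp_chart hφ hp hg hf).mfderiv

/-- Two unit normal fields agree near a point up to a sign. -/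
theorem exists_sign_of_unit_normals {x : M → 𝔼 4} (hx : IsSmoothImmersion (n := 3) x) {p : M}
    {n n' : M → 𝔼 4} (hn : ∀ᶠ q in 𝓝 p, ‖n q‖ = 1 ∧ ∀ v, ⟪mdiff x q v, n q⟫ = 0)
    (hn' : ∀ᶠ q in 𝓝 p, ‖n' q‖ = 1 ∧ ∀ v, ⟪mdiff x q v, n' q⟫ = 0)
    (hc : MDifferentiableAt 𝓘(ℝ, 𝔼 3) 𝓘(ℝ, 𝔼 4) n p) (hc' : ContinuousAt n' p) :
    (n' p = n p ∧ mdiff n' p = mdiff n p) ∨ (n' p = -n p ∧ mdiff n' p = -mdiff n p) := by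
  have hpm : ∀ᶠ q in 𝓝 p, n' q = n q ∨ n' q = -n q := by
    filter_upwards [hn, hn'] with q h1 h2
    exact eq_or_eq_neg_of_orthogonal (mdiff_injective hx q) h1.1 h1.2 h2.1 h2.2
  have hin : ContinuousAt (fun q => ⟪n q, n' q⟫) p := hc.continuousAt.inner hc'
  have hnp := hn.self_of_nhds.1
  rcases hpm.self_of_nhds with h0 | h0
  · left
    refine ⟨h0, ?_⟩
    have h1 : ∀ᶠ q in 𝓝 p, 0 < ⟪n q, n' q⟫ := hin.eventually_const_lt (by
      simp only [h0, real_inner_self_eq_norm_sq, hnp]; norm_num)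
    have h2 : n' =ᶠ[𝓝 p] n := by
      filter_upwards [h1, hpm] with q h3 h4
      rcases h4 with h4 | h4
      · exact h4
      · rw [h4, inner_neg_right, real_inner_self_eq_norm_sq] at h3
        linarith [sq_nonneg ‖n q‖]
    exact h2.mfderiv_eq
  · right
    refine ⟨h0, ?_⟩
    have h1 : ∀ᶠ q in 𝓝 p, ⟪n q, n' q⟫ < 0 := hin.eventually_lt_const (by
      simp only [h0, inner_neg_right, real_inner_self_eq_norm_sq, hnp]; norm_num)
    have h2 : n' =ᶠ[𝓝 p] -n := by
      filter_upwards [h1, hpm] with q h3 h4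
      rcases h4 with h4 | h4
      · rw [h4, real_inner_self_eq_norm_sq] at h3
        linarith [sq_nonneg ‖n q‖]
      · exact h4
    exact h2.mfderiv_eq.trans hc.hasMFDerivAt.neg.mfderiv

namespace LocalFrame

variable {x : M → 𝔼 4} {W W' : Set M} {n ξ n' ξ' : M → 𝔼 4} {l m l' m' : M → ℝ} {p : M}

theorem eventually_unit_normal (h : LocalFrame x W n ξ l m) (hp : p ∈ W) :
    ∀ᶠ q in 𝓝 p, ‖n q‖ = 1 ∧ ∀ v, ⟪mdiff x q v, n q⟫ = 0 := by
  filter_upwards [h.isOpen.mem_nhds hp] with q hq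
  exact ⟨h.norm_normal q hq, h.inner_normal q hq⟩

theorem inner_xi_xi (h : LocalFrame x W n ξ l m) (hp : p ∈ W) : ⟪ξ p, ξ p⟫ = 1 := by
  rw [real_inner_self_eq_norm_sq, h.norm_xi p hp, one_pow]

theorem inner_xi_normal (h : LocalFrame x W n ξ l m) (hp : p ∈ W) : ⟪ξ p, n p⟫ = 0 := by
  obtain ⟨v, hv⟩ := h.tangent p hp
  rw [← hv]
  exact h.inner_normal p hp v

/-- `a` and `b` are the simple eigenvectors of two presentations of the same shape operator. With `r
= ⟪a, b⟫`, pairing and adding gives `(s - t)(3 + r²) = 0`, and then `r² = 1`. -/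
theorem eq_of_shape_eq {a b : 𝔼 4} {s t : ℝ} (ha : ⟪a, a⟫ = 1) (hb : ⟪b, b⟫ = 1) (hs : 0 < s)
    (hab : s • (a + ⟪a, a⟫ • a) = t • (a + ⟪a, b⟫ • b))
    (hba : s • (b + ⟪b, a⟫ • a) = t • (b + ⟪b, b⟫ • b)) : t = s ∧ (b = a ∨ b = -a) := by
  have h1 := congrArg (fun z => ⟪z, a⟫) hab
  have h2 := congrArg (fun z => ⟪z, b⟫) hba
  simp only [inner_smul_left, inner_add_left, RCLike.conj_to_real, ha, hb,
    real_inner_comm a b] at h1 h2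
  set r := ⟪a, b⟫ with hr
  have hts : t = s := by
    have h3 : (s - t) * (3 + r ^ 2) = 0 := by linear_combination h1 + h2
    have h4 : (3 + r ^ 2) ≠ 0 := by positivity
    linarith [(mul_eq_zero.1 h3).resolve_right h4]
  refine ⟨hts, ?_⟩
  have hr2 : r ^ 2 = 1 := by
    rw [hts] at h1
    have : s * (r ^ 2 - 1) = 0 := by linear_combination -h1
    linarith [(mul_eq_zero.1 this).resolve_left hs.ne']
  have hz : ⟪b - r • a, b - r • a⟫ = 0 := by
    simp only [inner_sub_left, inner_sub_right, inner_smul_left, inner_smul_right, ha, hb,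
      RCLike.conj_to_real, real_inner_comm a b, ← hr]
    linear_combination -hr2
  have hbr : b = r • a := sub_eq_zero.1 (inner_self_eq_zero.1 hz)
  rcases eq_or_eq_neg_of_sq_eq_sq r 1 (by rw [hr2, one_pow]) with h | h
  · left; rw [hbr, h, one_smul]
  · right; rw [hbr, h, neg_smul, one_smul]

theorem compare_aux (hx : IsSmoothImmersion (n := 3) x) (h : LocalFrame x W n ξ l m)
    (h' : LocalFrame x W' n' ξ' l' m') (hp : p ∈ W) (hp' : p ∈ W') :
    n' p = n p ∧ l' p = l p ∧ (ξ' p = ξ p ∨ ξ' p = -ξ p) := by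
  obtain ⟨v, hv⟩ := h.tangent p hp
  obtain ⟨v', hv'⟩ := h'.tangent p hp'
  have hs := h.shape p hp
  have hs' := h'.shape p hp'
  have hξ := h.inner_xi_xi hp
  have hξ' := h'.inner_xi_xi hp'
  rcases exists_sign_of_unit_normals hx (h.eventually_unit_normal hp)
    (h'.eventually_unit_normal hp') (h.mdiff_normal p hp) (h'.mdiff_normal p hp').continuousAt
    with ⟨h1, h2⟩ | ⟨h1, h2⟩
  · rw [h2] at hs'
    have e1 := (hs v).symm.trans (hs' v)
    have e2 := (hs v').symm.trans (hs' v')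
    rw [hv, neg_smul, neg_smul, neg_inj] at e1
    rw [hv', neg_smul, neg_smul, neg_inj] at e2
    exact ⟨h1, eq_of_shape_eq hξ hξ' (h.pos p hp) e1 e2⟩
  -- Opposite normals would give the same operator both signs, while both frames have `l > 0`.
  · exfalso
    rw [h2] at hs'
    have e1 := hs' v
    rw [neg_apply, hs v, hv] at e1
    have e3 := congrArg (fun z => ⟪z, ξ p⟫) e1
    simp only [inner_smul_left, inner_add_left, RCLike.conj_to_real, hξ, inner_neg_left,
      real_inner_comm (ξ p) (ξ' p)] at e3
    have := h.pos p hp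
    have := h'.pos p hp'
    nlinarith [mul_nonneg this.le (sq_nonneg ⟪ξ p, ξ' p⟫)]

/-- Two frames agree up to the sign of the principal direction. -/
theorem compare (hx : IsSmoothImmersion (n := 3) x) (h : LocalFrame x W n ξ l m)
    (h' : LocalFrame x W' n' ξ' l' m') (hp : p ∈ W) (hp' : p ∈ W') :
    n' p = n p ∧ l' p = l p ∧ ((ξ' p = ξ p ∧ m' p = m p) ∨ (ξ' p = -ξ p ∧ m' p = -m p)) := by
  obtain ⟨h1, h2, h3⟩ := compare_aux hx h h' hp hp'
  refine ⟨h1, h2, ?_⟩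
  have hl : l' =ᶠ[𝓝 p] l := by
    filter_upwards [h.isOpen.mem_nhds hp, h'.isOpen.mem_nhds hp'] with q hq hq'
    exact (compare_aux hx h h' hq hq').2.1
  have hd : mdiff l' p = mdiff l p := hl.mfderiv_eq
  obtain ⟨v, hv⟩ := h.tangent p hp
  have e := (h'.mdiff_curvature p hp' v).symm.trans ((congrArg (· v) hd).trans
    (h.mdiff_curvature p hp v))
  rw [hv, h.inner_xi_xi hp] at e
  rcases h3 with h3 | h3
  · rw [h3, h.inner_xi_xi hp] at e
    exact Or.inl ⟨h3, by linarith⟩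
  · rw [h3, inner_neg_right, h.inner_xi_xi hp] at e
    exact Or.inr ⟨h3, by linarith⟩

end LocalFrame

end Manifold

theorem ShapeData.neg {X : 𝔼 3 → 𝔼 4} {V : Set (𝔼 3)} {N : 𝔼 3 → 𝔼 4}
    {L : 𝔼 3 → 𝔼 4 →L[ℝ] 𝔼 3} {lam : 𝔼 3 → ℝ} {η : 𝔼 3 → 𝔼 3} (h : ShapeData X V N L lam η) :
    ShapeData X V N L lam (-η) :=
  ⟨h.toNormalData, h.smooth_lam, fun y hy => (h.smooth_eta y hy).neg, h.lam_pos,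
    fun y hy => by rw [Pi.neg_apply, map_neg, norm_neg, h.norm_eta y hy],
    fun y hy v => by
      rw [Pi.neg_apply, map_neg, inner_neg_right, smul_neg, neg_smul ⟪_, _⟫, neg_neg,
        h.shape y hy]⟩

theorem isOpen_source_inter_preimage {M : Type*} [TopologicalSpace M]
    {φ : OpenPartialHomeomorph M (𝔼 3)} {V : Set (𝔼 3)} (hV : IsOpen V) : IsOpen (φ.source ∩ φ ⁻¹' V) :=
  φ.continuousOn.isOpen_inter_preimage φ.open_source hV

/-! ### Frames obtained from charts, and the set of points with given invariants -/

section Manifold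

variable {M : Type*} [TopologicalSpace M] [ChartedSpace (𝔼 3) M]
  {x : M → 𝔼 4} {φ : OpenPartialHomeomorph M (𝔼 3)} {V : Set (𝔼 3)} {N : 𝔼 3 → 𝔼 4}
  {L : 𝔼 3 → 𝔼 4 →L[ℝ] 𝔼 3}

/-- The mean curvature vanishes only where the differential of the normal does. -/
theorem fderiv_normal_eq_zero (hideal : IsCasoratiIdeal (n := 3) x) (hφ : φ ∈ atlas (𝔼 3) M)
    (h : NormalData (x ∘ φ.symm) V N L) {p : M} (hp : p ∈ φ.source)
    (hpV : φ p ∈ V) (h0 : shapeLam N L (φ p) = 0) : fderiv ℝ N (φ p) = 0 := by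
  obtain ⟨l, η, hη, hs⟩ := h.exists_shape_of_ideal hpV (hideal φ hφ p hp)
  have hl := h.shapeLam_eq hpV hη hs
  refine ContinuousLinearMap.ext fun v => ?_
  rw [hs, ← hl, h0, neg_zero, zero_smul, zero_apply]

/-- The points at which some frame has the invariants `a`, `E` and `C`. -/
def matchSet (x : M → 𝔼 4) (a : ℝ) (E C : 𝔼 4) : Set M :=
  {p | ∃ W n ξ l m, p ∈ W ∧ LocalFrame x W n ξ l m ∧ Matches a E C (x p) (n p) (ξ p) (l p) (m p)}

theorem isOpen_matchSet {a : ℝ} (ha : 0 < a) (E C : 𝔼 4) : IsOpen (matchSet x a E C) := by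
  refine isOpen_iff_mem_nhds.2 ?_
  rintro p ⟨W, n, ξ, l, m, hp, hF, hm⟩
  filter_upwards [hF.isOpen.mem_nhds hp] with q hq
  exact ⟨W, n, ξ, l, m, hq, hF, hF.matches_of_matches a ha E C p hp q hq hm⟩

variable [IsManifold 𝓘(ℝ, 𝔼 3) ∞ M]

theorem mdiff_immersion (hx : IsSmoothImmersion (n := 3) x) (hφ : φ ∈ atlas (𝔼 3) M) {p : M}
    (hp : p ∈ φ.source) :
    mdiff x p = (fderiv ℝ (x ∘ φ.symm) (φ p)).comp (mdiff φ p) :=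
  mfderiv_eq_comp_mfderiv_chart hφ hp hx

theorem ShapeData.localFrame {lam : 𝔼 3 → ℝ} {η : 𝔼 3 → 𝔼 3}
    (hx : IsSmoothImmersion (n := 3) x) (hφ : φ ∈ atlas (𝔼 3) M)
    (h : ShapeData (x ∘ φ.symm) V N L lam η) (hc : Convex ℝ V) :
    LocalFrame x (φ.source ∩ φ ⁻¹' V) (N ∘ φ) (xi (x ∘ φ.symm) η ∘ φ) (lam ∘ φ)
      (mu lam η ∘ φ) := by
  have hd : ∀ p ∈ φ.source ∩ φ ⁻¹' V, ∀ v,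
      mdiff x p v = fderiv ℝ (x ∘ φ.symm) (φ p) (mdiff φ p v) := fun p hp v => by
    rw [mdiff_immersion hx hφ hp.1]; rfl
  have hX : ∀ p ∈ φ.source ∩ φ ⁻¹' V, (x ∘ φ.symm) (φ p) = x p := fun p hp =>
    congrArg x (φ.left_inv hp.1)
  refine ⟨isOpen_source_inter_preimage h.isOpen, fun p hp => h.norm_normal _ hp.2,
    fun p hp => ?_, fun p hp v => ?_, fun p hp => ?_, fun p hp => h.norm_eta _ hp.2,
    fun p hp => h.lam_pos _ hp.2, fun p hp v => ?_, fun p hp v => ?_,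
    fun a ha E C p hp q hq hm => ?_⟩
  · exact (hasMFDerivAt_of_eventuallyEq_comp_chart hφ hp.1 (h.differentiableAt_normal hp.2)
      EventuallyEq.rfl).mdifferentiableAt
  · rw [hd p hp]
    exact h.inner_normal _ hp.2 _
  · obtain ⟨v, hv⟩ := (mfderiv_chart_bijective hφ hp.1).2 (η (φ p))
    refine ⟨v, (hd p hp v).trans ?_⟩
    exact congrArg (fderiv ℝ (x ∘ φ.symm) (φ p)) hv
  · rw [hd p hp, mdiff_eq_comp_chart hφ hp.1 (h.differentiableAt_normal hp.2) EventuallyEq.rfl]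
    exact h.shape _ hp.2 _
  · rw [hd p hp, mdiff_eq_comp_chart hφ hp.1 (h.hasFDerivAt_lam hp.2).differentiableAt
      EventuallyEq.rfl]
    exact h.fderiv_lam hp.2 _
  · have := h.matches_of_matches hc ha (E := E) (C := C) hp.2 hq.2 (by rw [hX p hp]; exact hm)
    rw [hX q hq] at this
    exact this

/-- Frames exist where the mean curvature does not vanish, in both orientations of the principal
direction. -/
theorem exists_localFrame (hx : IsSmoothImmersion (n := 3) x)
    (hideal : IsCasoratiIdeal (n := 3) x) (hφ : φ ∈ atlas (𝔼 3) M)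
    (h : NormalData (x ∘ φ.symm) V N L) (hV : V ⊆ φ.target) {p : M} (hp : p ∈ φ.source)
    (hpV : φ p ∈ V) (hpos : 0 < shapeLam N L (φ p)) :
    ∃ W n ξ l m, p ∈ W ∧ LocalFrame x W n ξ l m ∧ LocalFrame x W n (-ξ) l (-m) ∧
      l p = shapeLam N L (φ p) ∧
      m p ^ 2 ≤ shapeLam N L (φ p) * slopeBound (x ∘ φ.symm) N L (φ p) := by
  have hid : ∀ y ∈ V, ∀ e : Fin 3 → 𝔼 3, IsOrthonormalFamily (x ∘ φ.symm) y e →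
      normalizedScalarCurvature (x ∘ φ.symm) y e = deltaCasorati (x ∘ φ.symm) y e := by
    intro y hy e he
    have := hideal φ hφ (φ.symm y) (φ.map_target (hV hy)) e
    rw [φ.right_inv (hV hy)] at this
    exact this he
  obtain ⟨V₁, -, hp₁, η, hS⟩ := h.exists_shapeData hid hpV hpos
  -- A ball is convex, so the invariants are constant on it.
  obtain ⟨ε, hε, hball⟩ := Metric.isOpen_iff.1 hS.isOpen _ hp₁
  have hS' := hS.mono Metric.isOpen_ball hball
  have hF := hS'.localFrame hx hφ (convex_ball _ _)
  have hF' := hS'.neg.localFrame hx hφ (convex_ball _ _)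
  refine ⟨φ.source ∩ φ ⁻¹' Metric.ball (φ p) ε, _, _, _, _, ⟨hp, Metric.mem_ball_self hε⟩, hF, ?_, rfl, hS.mu_sq_le hp₁⟩
  have h1 : ShapeData.xi (x ∘ φ.symm) (-η) ∘ φ = -(ShapeData.xi (x ∘ φ.symm) η ∘ φ) :=
    funext fun q => map_neg (fderiv ℝ (x ∘ φ.symm) (φ q)) (η (φ q))
  have h2 : ShapeData.mu (shapeLam N L) (-η) ∘ φ = -(ShapeData.mu (shapeLam N L) η ∘ φ) :=
    funext fun q => map_neg (fderiv ℝ (shapeLam N L) (φ q)) (η (φ q))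
  rwa [h1, h2] at hF'

/-- Near every point there is a normal field in any given chart. -/
theorem exists_normalData_chart (hx : IsSmoothImmersion (n := 3) x) (hφ : φ ∈ atlas (𝔼 3) M)
    {p : M} (hp : p ∈ φ.source) :
    ∃ V ⊆ φ.target, φ p ∈ V ∧ ∃ N L, NormalData (x ∘ φ.symm) V N L :=
  exists_normalData φ.open_target (contDiffOn_comp_symm hx hφ)
    (fun _ hy => fderiv_comp_symm_injective hx hφ hy) (φ.map_source hp)

theorem exists_localFrame_of_ne_zero (hx : IsSmoothImmersion (n := 3) x)
    (hideal : IsCasoratiIdeal (n := 3) x) (hφ : φ ∈ atlas (𝔼 3) M)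
    (h : NormalData (x ∘ φ.symm) V N L) (hV : V ⊆ φ.target) {p : M} (hp : p ∈ φ.source)
    (hpV : φ p ∈ V) (hne : shapeLam N L (φ p) ≠ 0) :
    ∃ W n ξ l m, p ∈ W ∧ LocalFrame x W n ξ l m ∧ LocalFrame x W n (-ξ) l (-m) ∧
      l p = |shapeLam N L (φ p)| ∧ m p ^ 2 ≤ |shapeLam N L (φ p)| *
        max (slopeBound (x ∘ φ.symm) N L (φ p)) (slopeBound (x ∘ φ.symm) (-N) L (φ p)) := by
  rcases hne.lt_or_gt with hlt | hgt
  · obtain ⟨W, n, ξ, l, m, h1, h2, h3, h4, h5⟩ := exists_localFrame hx hideal hφ h.neg hV hp hpV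
      (by rw [shapeLam_neg]; linarith)
    rw [shapeLam_neg] at h4 h5
    refine ⟨W, n, ξ, l, m, h1, h2, h3, by rw [h4, abs_of_neg hlt], h5.trans ?_⟩
    rw [abs_of_neg hlt]
    exact mul_le_mul_of_nonneg_left (le_max_right _ _) (by linarith)
  · obtain ⟨W, n, ξ, l, m, h1, h2, h3, h4, h5⟩ := exists_localFrame hx hideal hφ h hV hp hpV hgt
    refine ⟨W, n, ξ, l, m, h1, h2, h3, by rw [h4, abs_of_pos hgt], h5.trans ?_⟩
    rw [abs_of_pos hgt]
    exact mul_le_mul_of_nonneg_left (le_max_left _ _) hgt.le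

/-- In a chart, the mean curvature does not vanish on the domain of a frame. -/
theorem LocalFrame.shapeLam_ne_zero {W : Set M} {n ξ : M → 𝔼 4} {l m : M → ℝ}
    (hx : IsSmoothImmersion (n := 3) x) (hideal : IsCasoratiIdeal (n := 3) x)
    (hφ : φ ∈ atlas (𝔼 3) M) (h : NormalData (x ∘ φ.symm) V N L) {p : M}
    (hp : p ∈ φ.source) (hpV : φ p ∈ V) (hF : LocalFrame x W n ξ l m) (hpW : p ∈ W) :
    shapeLam N L (φ p) ≠ 0 := by
  intro h0
  have hd : mdiff (N ∘ φ) p = 0 := by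
    rw [mdiff_eq_comp_chart hφ hp (h.differentiableAt_normal hpV) EventuallyEq.rfl,
      fderiv_normal_eq_zero hideal hφ h hp hpV h0, ContinuousLinearMap.zero_comp]
  have hn' : ∀ᶠ q in 𝓝 p, ‖(N ∘ φ) q‖ = 1 ∧ ∀ v, ⟪mdiff x q v, (N ∘ φ) q⟫ = 0 := by
    filter_upwards [(isOpen_source_inter_preimage h.isOpen).mem_nhds ⟨hp, hpV⟩] with q hq
    refine ⟨h.norm_normal _ hq.2, fun v => ?_⟩
    rw [mdiff_immersion hx hφ hq.1]
    exact h.inner_normal _ hq.2 _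
  -- Near `p` the normal `n` is `±N ∘ φ`, so its differential vanishes at `p`, while the frame
  -- requires `dn(ξ) = -2l ξ ≠ 0`.
  have hdn : mdiff n p = 0 := by
    rcases exists_sign_of_unit_normals hx (hF.eventually_unit_normal hpW) hn'
      (hF.mdiff_normal p hpW)
      (ContinuousAt.comp (h.differentiableAt_normal hpV).continuousAt (φ.continuousAt hp))
      with ⟨-, h1⟩ | ⟨-, h1⟩
    · rw [← h1, hd]
    · rw [← neg_eq_zero, ← h1, hd]
  obtain ⟨v, hv⟩ := hF.tangent p hpW
  have h1 := hF.shape p hpW v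
  rw [hdn, hv, hF.inner_xi_xi hpW] at h1
  have h2 := congrArg (fun z => ⟪z, ξ p⟫) h1
  simp only [zero_apply, inner_zero_left, inner_smul_left, inner_add_left, RCLike.conj_to_real,
    hF.inner_xi_xi hpW] at h2
  linarith [hF.pos p hpW]

/-- The essential point is that matched points cannot accumulate at a point where `h` vanishes. At
any other limit point a frame exists and inherits the invariants from nearby matched points. -/
theorem isClosed_matchSet (hx : IsSmoothImmersion (n := 3) x)
    (hideal : IsCasoratiIdeal (n := 3) x) {a : ℝ} (ha : 0 < a) (E C : 𝔼 4) :
    IsClosed (matchSet x a E C) := by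
  refine isClosed_of_closure_subset fun q hq => ?_
  set φ := chartAt (𝔼 3) q
  have hφ : φ ∈ atlas (𝔼 3) M := chart_mem_atlas _ q
  have hqs : q ∈ φ.source := mem_chart_source _ q
  obtain ⟨V, hV, hqV, N, L, h⟩ := exists_normalData_chart hx hφ hqs
  by_cases h0 : shapeLam N L (φ q) = 0
  · exfalso
    -- `Φ` bounds `m² + l⁴` for either choice of normal. It is continuous at `q` and vanishes there,
    -- so near `q` it falls below the value `a⁴/4` required at matched points.
    let Φ : M → ℝ := fun p => |shapeLam N L (φ p)| *
        max (slopeBound (x ∘ φ.symm) N L (φ p)) (slopeBound (x ∘ φ.symm) (-N) L (φ p))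
        + |shapeLam N L (φ p)| ^ 4
    have hΦ : ContinuousAt Φ q := by
      have c0 := φ.continuousAt hqs
      have c1 : ContinuousAt (fun p => shapeLam N L (φ p)) q :=
        ContinuousAt.comp (g := shapeLam N L) (h.smooth_shapeLam hqV).continuousAt c0
      have c2 : ContinuousAt (fun p => slopeBound (x ∘ φ.symm) N L (φ p)) q :=
        ContinuousAt.comp (g := slopeBound (x ∘ φ.symm) N L) (continuousAt_slopeBound h hqV) c0
      have c3 : ContinuousAt (fun p => slopeBound (x ∘ φ.symm) (-N) L (φ p)) q :=
        ContinuousAt.comp (g := slopeBound (x ∘ φ.symm) (-N) L)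
          (continuousAt_slopeBound h.neg hqV) c0
      exact (c1.abs.mul (c2.max c3)).add (c1.abs.pow 4)
    have hΦq : Φ q < a ^ 4 / 4 := by
      simp only [Φ, h0, abs_zero, zero_mul, zero_add]
      rw [zero_pow (by norm_num)]
      positivity
    have hev : ∀ᶠ p in 𝓝 q, Φ p < a ^ 4 / 4 ∧ p ∈ φ.source ∩ φ ⁻¹' V :=
      (hΦ.eventually_lt_const hΦq).and
        ((isOpen_source_inter_preimage h.isOpen).mem_nhds ⟨hqs, hqV⟩)
    obtain ⟨p, ⟨hp1, hps, hpV⟩, W, n, ξ, l, m, hpW, hF, hm⟩ := mem_closure_iff_nhds.1 hq _ hev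
    have hne := hF.shapeLam_ne_zero hx hideal hφ h hps hpV hpW
    obtain ⟨W', n', ξ', l', m', hpW', hF', -, hl, hmu⟩ :=
      exists_localFrame_of_ne_zero hx hideal hφ h hV hps hpV hne
    obtain ⟨-, hll, hmm⟩ := LocalFrame.compare hx hF hF' hpW hpW'
    have hmsq : m' p ^ 2 = m p ^ 2 := by
      rcases hmm with ⟨-, hmm⟩ | ⟨-, hmm⟩ <;> rw [hmm]
      ring
    have he := hm.energy
    rw [← hmsq, ← hll, hl] at he
    simp only [Φ] at hp1
    linarith
  · obtain ⟨W', n', ξ', l', m', hqW', hF', hF'', -, -⟩ :=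
      exists_localFrame_of_ne_zero hx hideal hφ h hV hqs hqV h0
    obtain ⟨p, hpW', W, n, ξ, l, m, hpW, hF, hm⟩ :=
      mem_closure_iff_nhds.1 hq _ (hF'.isOpen.mem_nhds hqW')
    obtain ⟨h1, h2, ⟨h3, h4⟩ | ⟨h3, h4⟩⟩ := LocalFrame.compare hx hF hF' hpW hpW'
    · refine ⟨W', n', ξ', l', m', hqW', hF', hF'.matches_of_matches a ha E C p hpW' q hqW' ?_⟩
      rw [h1, h2, h3, h4]
      exact hm
    -- Reversing `ξ` and `m` together reverses the axis vector, so only the frame with the opposite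
    -- principal direction matches the given `E`.
    · refine ⟨W', n', -ξ', l', -m', hqW', hF'', hF''.matches_of_matches a ha E C p hpW' q hqW' ?_⟩
      rw [Pi.neg_apply, Pi.neg_apply, h1, h2, h3, h4, neg_neg, neg_neg]
      exact hm

end Manifold

/-! ### The classification -/

/-- A point with invariants `a`, `E` and `C` lies on the model hypersurface with axis vector `E`
and base point `C`. -/
theorem Matches.mem_rotHypersurface {a : ℝ} (ha : 0 < a) {E C x n ξ : 𝔼 4} {l m : ℝ}
    (hm : Matches a E C x n ξ l m) (hl : 0 < l) (hn : ⟪n, n⟫ = 1) (hξ : ⟪ξ, ξ⟫ = 1)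
    (hξn : ⟪ξ, n⟫ = 0) {b : OrthonormalBasis (Fin 4) ℝ (𝔼 4)} (hb : b 3 = E) :
    b.repr (x - C) ∈ rotHypersurface a := by
  have hnξ : ⟪n, ξ⟫ = 0 := by rw [real_inner_comm]; exact hξn
  have he := hm.energy
  have hs := slope_mem_Ioo ha hl he
  have hsd := (hasDerivAt_heightOfSlope ha hl hs (slope_sq_add ha he)).1
  set H := heightOfSlope a (2 / a ^ 2 * m) with hH
  have hxC : x - C = (4 / a ^ 4) • ((l * m) • ξ - l ^ 3 • n) + H • E := by
    rw [← hm.center, ← hm.axis, centerInv, ← hH]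
    abel
  have hEE : ⟪E, E⟫ = 1 := by
    rw [← hb, real_inner_self_eq_norm_sq, b.norm_eq_one, one_pow]
  have hEz : ⟪E, (l * m) • ξ - l ^ 3 • n⟫ = 0 := by
    rw [← hm.axis, axisInv]
    simp only [inner_smul_left, inner_smul_right, inner_add_left, inner_sub_right, hn, hξ, hξn,
      hnξ, RCLike.conj_to_real]
    ring
  -- By the energy relation the radial part of `x - C` has length `2l/a²`, which is the profile
  -- radius at the parameter where `sd = 2l/a`.
  have hzz : ⟪(l * m) • ξ - l ^ 3 • n, (l * m) • ξ - l ^ 3 • n⟫ = l ^ 2 * (a ^ 4 / 4) := by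
    rw [← he]
    simp only [inner_smul_left, inner_smul_right, inner_sub_left, inner_sub_right, hn, hξ, hξn,
      hnξ, RCLike.conj_to_real]
    ring
  have h3 : b.repr (x - C) 3 = H := by
    rw [b.repr_apply_apply, hb, hxC, inner_add_right, inner_smul_right, inner_smul_right, hEz, hEE]
    ring
  have hnorm : ‖b.repr (x - C)‖ ^ 2 = 4 * l ^ 2 / a ^ 4 + H ^ 2 := by
    rw [LinearIsometryEquiv.norm_map, ← real_inner_self_eq_norm_sq, hxC]
    simp only [inner_add_left, inner_add_right, inner_smul_left, inner_smul_right, hEz, hEE, hzz,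
      real_inner_comm E, RCLike.conj_to_real]
    field_simp
    ring
  rw [EuclideanSpace.norm_sq_eq, Fin.sum_univ_four] at hnorm
  simp only [Real.norm_eq_abs, sq_abs, h3] at hnorm
  have hu := jacobiSdDerivInv_mem hs
  have hat : a * (jacobiSdDerivInv (2 / a ^ 2 * m) / a) = jacobiSdDerivInv (2 / a ^ 2 * m) :=
    mul_div_cancel₀ _ ha.ne'
  refine Casorati.mem_rotHypersurface (t := jacobiSdDerivInv (2 / a ^ 2 * m) / a) ha
    (div_pos hu.1 ha) (div_lt_div_of_pos_right hu.2 ha) ?_ h3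
  have hr : profileRadius a (jacobiSdDerivInv (2 / a ^ 2 * m) / a) ^ 2 = 4 * l ^ 2 / a ^ 4 := by
    rw [profileRadius, hat, hsd]
    field_simp
    ring
  rw [hr]
  linarith

theorem LocalFrame.norm_axis {M : Type*} [TopologicalSpace M] [ChartedSpace (𝔼 3) M]
    {x : M → 𝔼 4} {W : Set M} {n ξ : M → 𝔼 4} {l m : M → ℝ} {p : M}
    (h : LocalFrame x W n ξ l m) {a : ℝ} (ha : 0 < a) {E C : 𝔼 4} (hp : p ∈ W)
    (hm : Matches a E C (x p) (n p) (ξ p) (l p) (m p)) : ‖E‖ = 1 := by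
  have hn : ⟪n p, n p⟫ = 1 := by rw [real_inner_self_eq_norm_sq, h.norm_normal p hp, one_pow]
  have hnξ : ⟪n p, ξ p⟫ = 0 := by rw [real_inner_comm]; exact h.inner_xi_normal hp
  have h1 : ‖E‖ ^ 2 = 1 := by
    rw [← real_inner_self_eq_norm_sq, ← hm.axis, axisInv]
    simp only [inner_smul_left, inner_smul_right, inner_add_left, inner_add_right, hn,
      h.inner_xi_xi hp, h.inner_xi_normal hp, hnξ, RCLike.conj_to_real]
    have := hm.energy
    field_simp
    linear_combination 4 * this
  exact (pow_eq_one_iff_of_nonneg (norm_nonneg _) (by norm_num)).1 h1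

theorem exists_orthonormalBasis_last {E : 𝔼 4} (hE : ‖E‖ = 1) :
    ∃ b : OrthonormalBasis (Fin 4) ℝ (𝔼 4), b 3 = E := by
  have hv : Orthonormal ℝ (({3} : Set (Fin 4)).domRestrict fun _ => E) := by
    refine ⟨fun _ => hE, fun i j hij => absurd (Subsingleton.elim i j) hij⟩
  obtain ⟨b, hb⟩ := hv.exists_orthonormalBasis_extension_of_card_eq (by simp)
  exact ⟨b, hb 3 rfl⟩

theorem IsSmoothImmersion.comp_isometry {M : Type*} [TopologicalSpace M] [ChartedSpace (𝔼 3) M]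
    {x : M → 𝔼 4} (hx : IsSmoothImmersion (n := 3) x) (A : 𝔼 4 ≃ₗᵢ[ℝ] 𝔼 4) (C : 𝔼 4) :
    IsSmoothImmersion (n := 3) fun p => A (x p - C) := by
  have hT : ∀ z, HasFDerivAt (fun z => A (z - C)) (A : 𝔼 4 →L[ℝ] 𝔼 4) z := fun z =>
    (A : 𝔼 4 →L[ℝ] 𝔼 4).hasFDerivAt.comp z ((hasFDerivAt_id z).sub_const C)
  have hTs : ContDiff ℝ ∞ fun z => A (z - C) :=
    A.contDiff.comp (contDiff_id.sub contDiff_const)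
  refine ⟨hTs.contMDiff.comp hx.1, fun p => ?_⟩
  have h1 : HasMFDerivAt 𝓘(ℝ, 𝔼 3) 𝓘(ℝ, 𝔼 4) x p (mfderiv 𝓘(ℝ, 𝔼 3) 𝓘(ℝ, 𝔼 4) x p) :=
    ((hx.1 p).mdifferentiableAt (by simp)).hasMFDerivAt
  have h2 := ((hT (x p)).hasMFDerivAt.comp p h1).mfderiv
  intro v w hvw
  have h3 := (congrArg (· v) h2).symm.trans (hvw.trans (congrArg (· w) h2))
  exact hx.2 p (A.injective h3)

theorem exists_invariants {M : Type*} [TopologicalSpace M] [ChartedSpace (𝔼 3) M]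
    [IsManifold 𝓘(ℝ, 𝔼 3) ∞ M] {x : M → 𝔼 4} (hx : IsSmoothImmersion (n := 3) x)
    (hideal : IsCasoratiIdeal (n := 3) x) (hgeo : ¬ IsTotallyGeodesic (n := 3) x) :
    ∃ a > 0, ∃ E C, (matchSet x a E C).Nonempty := by
  unfold IsTotallyGeodesic at hgeo
  push Not at hgeo
  obtain ⟨φ, hφ, p, hp, v, w, hne⟩ := hgeo
  obtain ⟨V, hV, hpV, N, L, h⟩ := exists_normalData_chart hx hφ hp
  -- If it vanished, so would the differential of the normal, and with it `h`.
  have h0 : shapeLam N L (φ p) ≠ 0 := by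
    intro h0
    apply hne
    have h1 := h.inner_fderiv_normal hpV v w
    rw [fderiv_normal_eq_zero hideal hφ h hp hpV h0, zero_apply, inner_zero_left] at h1
    rw [h.secondFF_eq hpV, neg_eq_zero.1 h1.symm, zero_smul]
  obtain ⟨W, n, ξ, l, m, hpW, hF, -⟩ :=
    exists_localFrame_of_ne_zero hx hideal hφ h hV hp hpV h0
  have hc : 0 < 4 * (m p ^ 2 + l p ^ 4) := by
    have := hF.pos p hpW
    positivity
  have ha : √√(4 * (m p ^ 2 + l p ^ 4)) ^ 4 = 4 * (m p ^ 2 + l p ^ 4) := by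
    rw [show 4 = 2 * 2 from rfl, pow_mul, Real.sq_sqrt (Real.sqrt_nonneg _),
      Real.sq_sqrt hc.le]
  -- `a` is the fourth root that makes the energy `a⁴/4`. `E` and `C` are then by definition the
  -- values of the invariants at `p`.
  refine ⟨√√(4 * (m p ^ 2 + l p ^ 4)), Real.sqrt_pos.2 (Real.sqrt_pos.2 hc), _, _, p, W, n, ξ, l,
    m, hpW, hF, ⟨?_, rfl, rfl⟩⟩
  rw [ha]
  ring

end Casorati

end

theorem theorem5p4 {M : Type*} [TopologicalSpace M] [T2Space M] [SecondCountableTopology M]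
    [ConnectedSpace M] [ChartedSpace (EuclideanSpace ℝ (Fin 3)) M]
    [IsManifold (modelWithCornersSelf ℝ (EuclideanSpace ℝ (Fin 3))) ∞ M]
    (x : M → EuclideanSpace ℝ (Fin 4)) (hx : Casorati.IsSmoothImmersion (n := 3) x)
    (hideal : Casorati.IsCasoratiIdeal (n := 3) x)
    (hgeo : ¬ Casorati.IsTotallyGeodesic (n := 3) x) :
    ∃ a : ℝ, 0 < a ∧ ∃ T : EuclideanSpace ℝ (Fin 4) ≃ᵢ EuclideanSpace ℝ (Fin 4),
      ∃ hT : ∀ p : M, T (x p) ∈ Casorati.rotHypersurface a,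
        IsLocalHomeomorph
          (fun p : M => (⟨T (x p), hT p⟩ : Casorati.rotHypersurface a)) := by
  obtain ⟨a, ha, E, C, hne⟩ := Casorati.exists_invariants hx hideal hgeo
  have huniv : Casorati.matchSet x a E C = Set.univ :=
    IsClopen.eq_univ ⟨Casorati.isClosed_matchSet hx hideal ha E C,
      Casorati.isOpen_matchSet ha E C⟩ hne
  have hmem : ∀ p, p ∈ Casorati.matchSet x a E C := fun p => huniv ▸ Set.mem_univ p
  obtain ⟨b, hb⟩ : ∃ b : OrthonormalBasis (Fin 4) ℝ (EuclideanSpace ℝ (Fin 4)), b 3 = E := by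
    obtain ⟨p, W, n, ξ, l, m, hp, hF, hm⟩ := hne
    exact Casorati.exists_orthonormalBasis_last (hF.norm_axis ha hp hm)
  have hT : ∀ p, b.repr (x p - C) ∈ Casorati.rotHypersurface a := by
    intro p
    obtain ⟨W, n, ξ, l, m, hp, hF, hm⟩ := hmem p
    exact hm.mem_rotHypersurface ha (hF.pos p hp)
      (by rw [real_inner_self_eq_norm_sq, hF.norm_normal p hp, one_pow]) (hF.inner_xi_xi hp)
      (hF.inner_xi_normal hp) hb
  -- The isometry moves `C` to the origin and the axis direction `E` to the last coordinate vector.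
  exact ⟨a, ha, (IsometryEquiv.subRight C).trans b.repr.toIsometryEquiv, hT,
    Casorati.isLocalHomeomorph_rotHypersurface (hx.comp_isometry b.repr C) ha hT⟩
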